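/- **Setting.** Let $d,d_o\ge 1$, let $\Omega_o\subset\mathbb R^{d_o}$ and $\Omega_s\subset\mathbb R^d$ be compact, $\operatorname{int}\Omega_s\neq\emptyset$, and let $k:\Omega_o\times\Omega_s\to\mathbb R$ be continuous and three times differentiable in its second variable $y$, with $y$-derivatives up to order three bounded uniformly on $\Omega_o\times\operatorname{int}\Omega_s$. Let $\mathcal M(\Omega_s)$ be the space of (signed, finite) Radon measures on $\Omega_s$ with the total variation norm, and let $\mu^\dagger=\sum_{n=1}^{N}q_n^\dagger\delta_{y_n^\dagger}$ with $q_n^\dagger\ne0$ and $y_n^\dagger\in\operatorname{int}\Omega_s$; put $m^\dagger=(q^\dagger;y^\dagger)$, $\rho=\operatorname{sign}q^\dagger$. For $(\delta q;\delta y)\in\mathbb R^N\times(\mathbb R^d)^N$ let $$\|(\delta q;\delta y)\|_{W_\dagger}^2=\sum_{n=1}^N\Big(\frac{|\delta q_n|^2}{4|q_n^\dagger|}+|q_n^\dagger|\,\|\delta y_n\|_2^2\Big),$$ with $W_\dagger$ the corresponding diagonal matrix, and let $B_{W_\dagger}(m,r)$ denote closed balls. A measurement setup consists of points $x_1,\dots,x_{N_o}\in\Omega_o$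 and a positive definite diagonal matrix $\Sigma_0$ with $\operatorname{tr}\Sigma_0^{-1}=1$. Write $\|v\|_{\Sigma_0^{-1}}=\|\Sigma_0^{-1/2}v\|_2$, $(K\mu)_j=\int k(x_j,y)\,d\mu(y)$, $(K^*z)(y)=\sum_j z_jk(x_j,y)$, $G(q;y)=\sum_n q_n\,(k(x_j,y_n))_j$, $\mathcal I_0=G'(m^\dagger)^\top\Sigma_0^{-1}G'(m^\dagger)$. For noise $\varepsilon\in\mathbb R^{N_o}$ and $\beta>0$ consider the Tikhonov problem $$(P_{\beta,\varepsilon})\qquad \min_{\mu\in\mathcal M(\Omega_s)}\ \tfrac12\|K\mu-K\mu^\dagger-\varepsilon\|_{\Sigma_0^{-1}}^2+\beta\|\mu\|_{\mathcal M(\Omega_s)} .$$ A point $m=(q;y)\in(\mathbb R\times\Omega_s)^N$ is called stationary if $G'(m)^\top\Sigma_0^{-1}(G(m)-G(m^\dagger)-\varepsilon)+\beta(\bar\rho;0)=0$ for some $\bar\rho\in\partial\|q\|_1$. The minimal-norm dual certificate of $\mu^\dagger$ is $\eta^\dagger=K^*\Sigma_0^{-1}\zeta^\dagger$, where $\zeta^\dagger$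 has minimal norm $\|\zeta\|_{\Sigma_0^{-1}}$ among all minimizers $\zeta\in\mathbb R^{N_o}$ of $-\int K^*\Sigma_0^{-1}\zeta\,d\mu^\dagger$ subject to $\|K^*\Sigma_0^{-1}\zeta\|_{C(\Omega_s)}\le1$. For $\theta\in(0,1]$ it is called $\theta$-admissible for $\mu^\dagger$ if $\eta^\dagger(y_n^\dagger)=\operatorname{sign}q_n^\dagger$ for all $n$ and $$|\eta^\dagger(y)|\le1-\theta\min\Big\{\theta,\ \min_n|q_n^\dagger|\,\|y-y_n^\dagger\|_2^2\Big\}\qquad\text{for all }y\in\Omega_s .$$ For positive measures the Hellinger–Kantorovich distance is given by $d_{HK}(\mu_1,\mu_2)^2=\inf W_2(\tilde\mu_1,\tilde\mu_2)^2$ over probability measures $\tilde\mu_i$ on $\mathbb R^+\times\Omega_s$ with finite second moment and $\int r^2\,d\tilde\mu_i(r,\cdot)=\mu_i$, where $W_2$ is taken for the cone metric $d_{cone}((r_1,y_1),(r_2,y_2))^2=(r_1-r_2)^2+4r_1r_2\sin^2\!\big(\min\{\|y_1-y_2\|_2/2,\pi/2\}\big)$; for signed measures, $d_{HK}(\mu_1,\mu_2)=d_{HK}(\mu_1^++\mu_2^-,\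 \mu_2^++\mu_1^-)$. **Theorem.** For every $M$ there are constants $C_1,C_2,\hat r>0$, depending only on $k$ (with its domain), $\mu^\dagger$ and $M$, such that $B_{W_\dagger}(m^\dagger,\tfrac32\hat r)\subset(\mathbb R\times\operatorname{int}\Omega_s)^N$ and the following holds. Consider any measurement setup for which $G'(m^\dagger)$ has full column rank and $\|\mathcal I_0^{-1}\|_{W_\dagger^{-1}\to W_\dagger}\le M$, any $\theta\in(0,1]$ for which $\eta^\dagger$ is $\theta$-admissible for $\mu^\dagger$, and any $\varepsilon\in\mathbb R^{N_o}$, $\beta>0$ with $$C_1(\|\varepsilon\|_{\Sigma_0^{-1}}+\beta)\le\sqrt{\theta/32},\qquad C_2\,\beta^{-1}\big((\|\varepsilon\|_{\Sigma_0^{-1}}+\beta)^2+\|\varepsilon\|_{\Sigma_0^{-1}}\big)\le\theta^2/32 .$$ Then there is exactly one stationary point $\hat m=(\hat q;\hat y)$ in $B_{W_\dagger}(m^\dagger,\tfrac32\hat r)$; it lies in $B_{W_\dagger}(m^\dagger,\hat r)$, and $\hat\mu=\sum_{n=1}^N\hat q_n\delta_{\hat y_n}$ is the unique solution of $(P_{\beta,\varepsilon})$.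 Moreover the linearized problem $$\min_{\delta m=(\delta q;\delta y)}\ \tfrac12\|G'(m^\dagger)\delta m-\varepsilon\|_{\Sigma_0^{-1}}^2+\beta\,\rho^\top\delta q$$ has the unique solution $\delta\hat m=\mathcal I_0^{-1}\big(G'(m^\dagger)^\top\Sigma_0^{-1}\varepsilon-\beta(\rho;0)\big)$, and $$d_{HK}(\hat\mu,\mu^\dagger)^2\le 8\,\|\delta\hat m\|_{W_\dagger}^2 .$$ -/

import Mathlib

open MeasureTheory
open scoped ENNReal NNReal Matrix

namespace SparseInverse

noncomputable section

/-- The Euclidean space `ℝ^d`. -/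
abbrev Pt (d : ℕ) := EuclideanSpace ℝ (Fin d)

/-! ### Weighted norms -/

/-- `‖v‖_W = ‖W^{1/2} v‖_2` for the diagonal matrix `W` with positive diagonal `w`. -/
def wNorm {ι : Type*} [Fintype ι] (w v : ι → ℝ) : ℝ := √(∑ i, w i * v i ^ 2)

/-- The operator norm `‖A‖_{U → W} = sup {‖A v‖_W : ‖v‖_U ≤ 1}` for positive diagonal weights. -/
def wOpNorm {ι κ : Type*} [Fintype ι] [Fintype κ] (u : ι → ℝ) (w : κ → ℝ)
    (A : Matrix κ ι ℝ) : ℝ :=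
  sSup {t | ∃ v : ι → ℝ, wNorm u v ≤ 1 ∧ t = wNorm w (A *ᵥ v)}

/-! ### The kernel -/

/-- The kernel is continuous on `Ωo × Ωs` and three times differentiable in the second variable,
with derivatives that are bounded uniformly on `Ωo × int Ωs`. -/
structure KernelRegular {p d : ℕ} (Ωo : Set (Pt p)) (Ωs : Set (Pt d))
    (k : Pt p → Pt d → ℝ) : Prop where
  continuousOn : ContinuousOn (fun z : Pt p × Pt d => k z.1 z.2) (Ωo ×ˢ Ωs)
  differentiableOn : ∀ x ∈ Ωo, ∀ i < 3,
    DifferentiableOn ℝ (iteratedFDeriv ℝ i (k x)) (interior Ωs)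
  bounded : ∃ C : ℝ, ∀ x ∈ Ωo, ∀ y ∈ interior Ωs, ∀ i ≤ 3, ‖iteratedFDeriv ℝ i (k x) y‖ ≤ C

/-! ### Radon measures on the compact set `Ωs`

These are the finite signed Borel measures on the subtype `Ωs`. -/

/-- The total variation norm `‖μ‖_{M(X)} = |μ|(X)`. -/
def tvNorm {X : Type*} [MeasurableSpace X] (μ : SignedMeasure X) : ℝ :=
  (μ.totalVariation Set.univ).toReal

/-- The sparse measure `∑ n, q n • δ_{y n}`. -/
def sparse {X : Type*} [MeasurableSpace X] {N : ℕ} (q : Fin N → ℝ) (y : Fin N → X) :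
    SignedMeasure X :=
  ∑ n, q n • (Measure.dirac (y n)).toSignedMeasure

/-- The source-to-measurements operator `(K μ)_j = ∫ k(x_j, y) dμ(y)`. -/
def forwardOp {p d No : ℕ} {Ωs : Set (Pt d)} (k : Pt p → Pt d → ℝ) (x : Fin No → Pt p)
    (μ : SignedMeasure Ωs) : Fin No → ℝ :=
  fun j => ∫ᵛ y : Ωs, k (x j) y ∂<•μ

/-- `(K^* z)(y) = ∑ j, z j * k(x_j, y)`. -/
def adjointOp {p d No : ℕ} (k : Pt p → Pt d → ℝ) (x : Fin No → Pt p) (z : Fin No → ℝ)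
    (y : Pt d) : ℝ :=
  ∑ j, z j * k (x j) y

/-- The Tikhonov functional `½ ‖K μ - z‖²_{Σ₀⁻¹} + β ‖μ‖`, where `Σ₀ = diag s`. -/
def tikhonov {p d No : ℕ} {Ωs : Set (Pt d)} (k : Pt p → Pt d → ℝ) (x : Fin No → Pt p)
    (s : Fin No → ℝ) (β : ℝ) (z : Fin No → ℝ) (μ : SignedMeasure Ωs) : ℝ :=
  (1 / 2) * wNorm s⁻¹ (forwardOp k x μ - z) ^ 2 + β * tvNorm μ

/-! ### The minimal-norm dual certificate and its non-degeneracy -/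

/-- The function `K^* Σ₀⁻¹ ζ`, where `Σ₀ = diag s`. -/
def certificate {p d No : ℕ} (k : Pt p → Pt d → ℝ) (x : Fin No → Pt p) (s ζ : Fin No → ℝ) :
    Pt d → ℝ :=
  adjointOp k x (s⁻¹ * ζ)

/-- `ζ` minimizes `-⟨μ, K^* Σ₀⁻¹ ζ⟩` subject to `‖K^* Σ₀⁻¹ ζ‖_{C(Ωs)} ≤ 1`. -/
def IsDualSolution {p d No : ℕ} {Ωs : Set (Pt d)} (k : Pt p → Pt d → ℝ) (x : Fin No → Pt p)
    (s : Fin No → ℝ) (μ : SignedMeasure Ωs) (ζ : Fin No → ℝ) : Prop :=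
  IsMinOn (fun ξ => -∫ᵛ y : Ωs, certificate k x s ξ y ∂<•μ)
      {ξ | ∀ y ∈ Ωs, |certificate k x s ξ y| ≤ 1} ζ ∧
    ∀ y ∈ Ωs, |certificate k x s ζ y| ≤ 1

/-- `ζ` is the dual solution of minimal norm `‖ζ‖_{Σ₀⁻¹}`; then `K^* Σ₀⁻¹ ζ` is the minimal-norm
dual certificate of `μ`. -/
def IsMinNormDualSolution {p d No : ℕ} {Ωs : Set (Pt d)} (k : Pt p → Pt d → ℝ)
    (x : Fin No → Pt p) (s : Fin No → ℝ) (μ : SignedMeasure Ωs) (ζ : Fin No → ℝ) : Prop :=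
  IsDualSolution k x s μ ζ ∧
    ∀ ξ, IsDualSolution k x s μ ξ → wNorm s⁻¹ ζ ≤ wNorm s⁻¹ ξ

/-- `η` is `θ`-admissible for `∑ n, q n • δ_{y n}`, with weights `w n = √|q n|`. The infimum over
`Option (Fin N)` is `min {θ, min_n ‖w n (z - y n)‖²}`. -/
def IsAdmissible {d N : ℕ} (Ωs : Set (Pt d)) (θ : ℝ) (q : Fin N → ℝ) (y : Fin N → Pt d)
    (η : Pt d → ℝ) : Prop :=
  (∀ z ∈ Ωs, |η z| ≤
      1 - θ * ⨅ o : Option (Fin N), o.elim θ (fun n => ‖√|q n| • (z - y n)‖ ^ 2)) ∧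
    ∀ n, η (y n) = Real.sign (q n)

/-! ### The parametrized problem

A parameter `m = (q; y)` has the `(1 + d) N` coordinates `Fin N ⊕ Fin N × Fin d`. -/

/-- The index set of the coordinates of `(q; y)`. -/
abbrev Idx (N d : ℕ) := Fin N ⊕ Fin N × Fin d

/-- Stack amplitudes and locations in one coordinate vector. -/
def stack {N d : ℕ} (q : Fin N → ℝ) (y : Fin N → Pt d) : Idx N d → ℝ :=
  Sum.elim q (fun a => y a.1 a.2)

/-- The diagonal of `W = diag (w⁻² / 4; w²; …; w²)` with `w = √|q|`. -/
def weight {N : ℕ} (d : ℕ) (q : Fin N → ℝ) : Idx N d → ℝ :=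
  Sum.elim (fun n => (4 * |q n|)⁻¹) (fun a => |q a.1|)

/-- The source-to-observable map `G(q; y)_j = ∑ n, q n * k(x_j, y n)`. -/
def obs {p d No N : ℕ} (k : Pt p → Pt d → ℝ) (x : Fin No → Pt p) (q : Fin N → ℝ)
    (y : Fin N → Pt d) : Fin No → ℝ :=
  fun j => ∑ n, q n * k (x j) (y n)

/-- The Jacobian `G'(q; y)`, with columns `k(x, y n)` and `q n * ∂_i k(x, y n)`. -/
def jac {p d No N : ℕ} (k : Pt p → Pt d → ℝ) (x : Fin No → Pt p) (q : Fin N → ℝ)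
    (y : Fin N → Pt d) : Matrix (Fin No) (Idx N d) ℝ :=
  Matrix.of fun j => Sum.elim (fun n => k (x j) (y n))
    (fun a => q a.1 * fderiv ℝ (k (x j)) (y a.1) (EuclideanSpace.single a.2 1))

/-- The Fisher information matrix `G'(m)ᵀ Σ₀⁻¹ G'(m)`. -/
def fisher {p d No N : ℕ} (k : Pt p → Pt d → ℝ) (x : Fin No → Pt p) (s : Fin No → ℝ)
    (q : Fin N → ℝ) (y : Fin N → Pt d) : Matrix (Idx N d) (Idx N d) ℝ :=
  (jac k x q y)ᵀ * Matrix.diagonal s⁻¹ * jac k x q y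

/-- `ρ` belongs to the subdifferential of `‖·‖_1` at `q`. -/
def IsSubgradientL1 {N : ℕ} (q ρ : Fin N → ℝ) : Prop :=
  ∀ q' : Fin N → ℝ, ∑ n, |q n| + ∑ n, ρ n * (q' n - q n) ≤ ∑ n, |q' n|

/-- `(q; y)` is a stationary point of `½ ‖G(m) - z‖²_{Σ₀⁻¹} + β ‖q‖_1`:
`G'(m)ᵀ Σ₀⁻¹ (G(m) - z) + β (ρ; 0) = 0` for a subgradient `ρ` of `‖·‖_1` at `q`. -/
def IsStationary {p d No N : ℕ} (k : Pt p → Pt d → ℝ) (x : Fin No → Pt p) (s : Fin No → ℝ)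
    (β : ℝ) (z : Fin No → ℝ) (q : Fin N → ℝ) (y : Fin N → Pt d) : Prop :=
  ∃ ρ : Fin N → ℝ, IsSubgradientL1 q ρ ∧
    (jac k x q y)ᵀ *ᵥ (s⁻¹ * (obs k x q y - z)) + β • (Sum.elim ρ 0 : Idx N d → ℝ) = 0

/-- The objective `½ ‖G'(m) δ - ε‖²_{Σ₀⁻¹} + β sign(q)ᵀ δq` of the linearized problem. -/
def linObjective {p d No N : ℕ} (k : Pt p → Pt d → ℝ) (x : Fin No → Pt p) (s : Fin No → ℝ)
    (β : ℝ) (ε : Fin No → ℝ) (q : Fin N → ℝ) (y : Fin N → Pt d) (δ : Idx N d → ℝ) : ℝ :=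
  (1 / 2) * wNorm s⁻¹ (jac k x q y *ᵥ δ - ε) ^ 2 + β * ∑ n, Real.sign (q n) * δ (Sum.inl n)

/-- The linearized estimate `δm̂ = I₀⁻¹ (G'(m)ᵀ Σ₀⁻¹ ε - β (sign q; 0))`. -/
def linEstimate {p d No N : ℕ} (k : Pt p → Pt d → ℝ) (x : Fin No → Pt p) (s : Fin No → ℝ)
    (β : ℝ) (ε : Fin No → ℝ) (q : Fin N → ℝ) (y : Fin N → Pt d) : Idx N d → ℝ :=
  (fisher k x s q y)⁻¹ *ᵥ ((jac k x q y)ᵀ *ᵥ (s⁻¹ * ε) -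
    β • (Sum.elim (fun n => Real.sign (q n)) 0 : Idx N d → ℝ))

/-! ### The Hellinger-Kantorovich distance -/

/-- The squared cone metric `(r₁ - r₂)² + 4 r₁ r₂ sin₊²(|y₁ - y₂| / 2)` on `ℝ⁺ × X`, where
`sin₊ z = sin (min z (π / 2))`. -/
def coneDistSq {X : Type*} [MetricSpace X] (a b : ℝ≥0 × X) : ℝ :=
  ((a.1 : ℝ) - b.1) ^ 2 + 4 * a.1 * b.1 * Real.sin (min (dist a.2 b.2 / 2) (Real.pi / 2)) ^ 2

/-- The squared Wasserstein-2 distance on the cone: the infimum over couplings of the integral of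
the squared cone metric. -/
def coneW2Sq {X : Type*} [MetricSpace X] [MeasurableSpace X] (ν₁ ν₂ : Measure (ℝ≥0 × X)) : ℝ≥0∞ :=
  ⨅ γ ∈ {γ : Measure ((ℝ≥0 × X) × (ℝ≥0 × X)) | γ.map Prod.fst = ν₁ ∧ γ.map Prod.snd = ν₂},
    ∫⁻ c, ENNReal.ofReal (coneDistSq c.1 c.2) ∂γ

/-- The two-homogeneous marginal `h₂(ν) = ∫ r² dν(r, ·)`. -/
def homMarginal {X : Type*} [MeasurableSpace X] (ν : Measure (ℝ≥0 × X)) : Measure X :=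
  (ν.withDensity (fun a => (a.1 : ℝ≥0∞) ^ 2)).map Prod.snd

/-- `ν` is a probability measure on `ℝ⁺ × X` with finite second moment and `h₂(ν) = μ`. -/
def IsLift {X : Type*} [MeasurableSpace X] (μ : Measure X) (ν : Measure (ℝ≥0 × X)) : Prop :=
  IsProbabilityMeasure ν ∧ ∫⁻ a, (a.1 : ℝ≥0∞) ^ 2 ∂ν < ∞ ∧ homMarginal ν = μ

/-- The Hellinger-Kantorovich distance of two positive measures. -/
def hkPos {X : Type*} [MetricSpace X] [MeasurableSpace X] (μ₁ μ₂ : Measure X) : ℝ≥0∞ :=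
  (⨅ ν₁ ∈ {ν | IsLift μ₁ ν}, ⨅ ν₂ ∈ {ν | IsLift μ₂ ν}, coneW2Sq ν₁ ν₂) ^ (1 / 2 : ℝ)

/-- The Hellinger-Kantorovich distance of two signed measures,
`d_HK(μ₁, μ₂) = d_HK(μ₁⁺ + μ₂⁻, μ₂⁺ + μ₁⁻)`, through the Jordan decompositions. -/
def dHK {X : Type*} [MetricSpace X] [MeasurableSpace X] (μ₁ μ₂ : SignedMeasure X) : ℝ≥0∞ :=
  hkPos (μ₁.toJordanDecomposition.posPart + μ₂.toJordanDecomposition.negPart)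
    (μ₂.toJordanDecomposition.posPart + μ₁.toJordanDecomposition.negPart)

end

end SparseInverse

/-! Near `m†` the amplitudes keep their signs, so stationarity is the smooth equation `∇(m) = 0` for
the least squares misfit plus the linear term `β ρᵀ q`. It is solved by the Newton map with frozen
matrix, `T m = m - I₀⁻¹ ∇(m)`. In the norm `‖·‖_{W†}` this map has Lipschitz constant `5 M L² (r +
‖ε‖)` on the ball of radius `r`, and `T m† - m†` is exactly the linearized estimate `δm̂`. A
contraction argument gives the unique stationary point `m̂`, the bound `‖m̂ - m†‖ ≤ 2 ‖δm̂‖`, and a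
quadratic bound for `m̂ - m† - δm̂` (`LeastSquaresModel.exists_unique_zero`).

Global optimality comes from a dual certificate. Put `ζ' = -β⁻¹ (G(m̂) - G(m†) - ε)`. Stationarity
says that `K^* Σ₀⁻¹ ζ'` takes the values `sign q†` at the recovered locations, with vanishing
gradient there. It remains to show that its modulus is below one elsewhere. An admissible
minimal-norm certificate has the closed form `ζ† = G'(m†) I₀⁻¹ (ρ; 0)`
(`IsMinNormDualSolution.eq_precertificate`), and this is also the leading part of `ζ'`. Hence `ζ' -
ζ†` is of order `β⁻¹ ((‖ε‖ + β)² + ‖ε‖)` (`LeastSquaresModel.wNorm_residual_le`). Far from the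
sources, uniform closeness preserves the admissibility gap. Near a source a Taylor comparison, which
needs three derivatives of the kernel, preserves the quadratic peak (`BoundedC3.add_le_of_peak`).
Convex duality then shows that every minimizer lives on the recovered locations and has the same
observation; uniqueness of the stationary point fixes its amplitudes.

For the error estimate, the atoms are coupled one by one. This gives a squared distance of at most
`2 ‖m̂ - m†‖² ≤ 8 ‖δm̂‖²`.

The constants do not depend on the setup: since `tr Σ₀⁻¹ = 1`, bounds that are uniform in the
observation point pass to the weighted norms whatever the number of observations. -/

namespace SparseInverse

/-! ### Weighted Euclidean norms, their duality, and a fixed point theorem -/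

noncomputable section WeightedNorm

variable {ι κ : Type*} [Fintype ι] [Fintype κ]

theorem wNorm_nonneg (w v : ι → ℝ) : 0 ≤ wNorm w v := Real.sqrt_nonneg _

theorem wNorm_sq {w : ι → ℝ} (hw : ∀ i, 0 ≤ w i) (v : ι → ℝ) :
    wNorm w v ^ 2 = ∑ i, w i * v i ^ 2 :=
  Real.sq_sqrt (Finset.sum_nonneg fun i _ => mul_nonneg (hw i) (sq_nonneg _))

theorem wNorm_eq_norm {w : ι → ℝ} (hw : ∀ i, 0 ≤ w i) (v : ι → ℝ) :
    wNorm w v = ‖WithLp.toLp 2 (fun i => √(w i) * v i)‖ := by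
  rw [EuclideanSpace.norm_eq, wNorm]
  congr 1
  refine Finset.sum_congr rfl fun i _ => ?_
  rw [Real.norm_eq_abs, sq_abs, mul_pow, Real.sq_sqrt (hw i)]

theorem wNorm_add_le {w : ι → ℝ} (hw : ∀ i, 0 ≤ w i) (u v : ι → ℝ) :
    wNorm w (u + v) ≤ wNorm w u + wNorm w v := by
  rw [wNorm_eq_norm hw, wNorm_eq_norm hw, wNorm_eq_norm hw]
  refine le_trans (le_of_eq ?_) (norm_add_le _ _)
  congr 1
  ext i
  simp [mul_add]

@[simp]
theorem wNorm_neg (w v : ι → ℝ) : wNorm w (-v) = wNorm w v := by simp [wNorm]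

@[simp]
theorem wNorm_zero (w : ι → ℝ) : wNorm w 0 = 0 := by simp [wNorm]

theorem wNorm_sub_comm (w u v : ι → ℝ) : wNorm w (u - v) = wNorm w (v - u) := by
  rw [← wNorm_neg, neg_sub]

theorem wNorm_smul (w v : ι → ℝ) (c : ℝ) : wNorm w (c • v) = |c| * wNorm w v := by
  rw [wNorm, wNorm, ← Real.sqrt_sq_eq_abs, ← Real.sqrt_mul (sq_nonneg c), Finset.mul_sum]
  congr 1
  refine Finset.sum_congr rfl fun i _ => ?_
  simp only [Pi.smul_apply, smul_eq_mul]
  ring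

theorem wNorm_sub_le {w : ι → ℝ} (hw : ∀ i, 0 ≤ w i) (u v : ι → ℝ) :
    wNorm w (u - v) ≤ wNorm w u + wNorm w v := by
  simpa [sub_eq_add_neg] using wNorm_add_le hw u (-v)

theorem wNorm_sub_le_sub {w : ι → ℝ} (hw : ∀ i, 0 ≤ w i) (u v z : ι → ℝ) :
    wNorm w (u - z) ≤ wNorm w (u - v) + wNorm w (v - z) := by
  simpa using wNorm_add_le hw (u - v) (v - z)

theorem eq_zero_of_wNorm_eq_zero {w : ι → ℝ} (hw : ∀ i, 0 < w i) {v : ι → ℝ}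
    (h : wNorm w v = 0) : v = 0 := by
  have h2 : ∑ i, w i * v i ^ 2 = 0 := by
    rw [← wNorm_sq (fun i => (hw i).le), h]; simp
  rw [Finset.sum_eq_zero_iff_of_nonneg
    (fun i _ => mul_nonneg (hw i).le (sq_nonneg _))] at h2
  funext i
  have := h2 i (Finset.mem_univ i)
  simpa [(hw i).ne'] using this

theorem abs_sum_mul_mul_le {w : ι → ℝ} (hw : ∀ i, 0 ≤ w i) (u v : ι → ℝ) :
    |∑ i, w i * u i * v i| ≤ wNorm w u * wNorm w v := by
  rw [wNorm_eq_norm hw, wNorm_eq_norm hw]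
  refine le_trans (le_of_eq ?_) (abs_real_inner_le_norm
    (WithLp.toLp 2 (fun i => √(w i) * u i)) (WithLp.toLp 2 (fun i => √(w i) * v i)))
  congr 1
  rw [PiLp.inner_apply]
  refine Finset.sum_congr rfl fun i _ => ?_
  simp only [RCLike.inner_apply, conj_trivial]
  linear_combination (-(u i * v i)) * Real.mul_self_sqrt (hw i)

/-- A mean with total weight at most one does not exceed the maximum. This is how pointwise kernel
bounds become norm bounds independent of the number of observations. -/
theorem wNorm_le_of_forall_abs_le {w : ι → ℝ} (hw : ∀ i, 0 ≤ w i) (hw1 : ∑ i, w i ≤ 1)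
    {v : ι → ℝ} {c : ℝ} (hc : 0 ≤ c) (h : ∀ i, |v i| ≤ c) : wNorm w v ≤ c := by
  refine Real.sqrt_le_iff.2 ⟨hc, ?_⟩
  calc ∑ i, w i * v i ^ 2 ≤ ∑ i, w i * c ^ 2 := by
        refine Finset.sum_le_sum fun i _ => mul_le_mul_of_nonneg_left ?_ (hw i)
        exact sq_le_sq' (by linarith [neg_abs_le (v i), h i]) ((le_abs_self _).trans (h i))
    _ = (∑ i, w i) * c ^ 2 := by rw [Finset.sum_mul]
    _ ≤ c ^ 2 := by nlinarith [sq_nonneg c]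

/-- The norms with weights `w` and `w⁻¹` are dual to each other; the test vector `w⁻¹ * u` attains
the supremum. -/
theorem wNorm_inv_le_of_dotProduct_le {w : ι → ℝ} (hw : ∀ i, 0 < w i) {u : ι → ℝ} {c : ℝ}
    (hc : 0 ≤ c) (h : ∀ v, u ⬝ᵥ v ≤ c * wNorm w v) : wNorm w⁻¹ u ≤ c := by
  have hw' : ∀ i, 0 ≤ w⁻¹ i := fun i => inv_nonneg.2 (hw i).le
  have h1 := h (w⁻¹ * u)
  have e1 : u ⬝ᵥ (w⁻¹ * u) = wNorm w⁻¹ u ^ 2 := by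
    rw [wNorm_sq hw', dotProduct]
    refine Finset.sum_congr rfl fun i _ => ?_
    simp only [Pi.mul_apply]; ring
  have e2 : wNorm w (w⁻¹ * u) = wNorm w⁻¹ u := by
    rw [wNorm, wNorm]
    congr 1
    refine Finset.sum_congr rfl fun i _ => ?_
    have := (hw i).ne'
    simp only [Pi.mul_apply, Pi.inv_apply]
    field_simp
  rw [e1, e2] at h1
  by_contra! hcon
  nlinarith [wNorm_nonneg w⁻¹ u]

theorem continuous_wNorm (w : ι → ℝ) : Continuous (wNorm w) := by
  unfold wNorm
  fun_prop

theorem isCompact_wNorm_ball {w : ι → ℝ} (hw : ∀ i, 0 < w i) (a : ι → ℝ) (r : ℝ) :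
    IsCompact {v | wNorm w (v - a) ≤ r} := by
  refine Metric.isCompact_of_isClosed_isBounded ?_ ?_
  · exact isClosed_le ((continuous_wNorm w).comp (continuous_id.sub continuous_const))
      continuous_const
  · refine (isCompact_univ_pi fun i => isCompact_Icc
      (a := a i - r / √(w i)) (b := a i + r / √(w i))).isBounded.subset fun v hv i _ => ?_
    have h1 : √(w i) * |v i - a i| ≤ r := by
      refine le_trans ?_ hv
      rw [← Real.sqrt_sq_eq_abs, ← Real.sqrt_mul (hw i).le]
      exact Real.sqrt_le_sqrt (Finset.single_le_sum
        (f := fun i => w i * (v - a) i ^ 2)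
        (fun i _ => mul_nonneg (hw i).le (sq_nonneg _)) (Finset.mem_univ i))
    have h2 : |v i - a i| ≤ r / √(w i) := by
      rw [le_div_iff₀ (Real.sqrt_pos.2 (hw i))]; linarith
    rw [abs_le] at h2
    exact ⟨by linarith, by linarith⟩

/-- The operator norm is a real `sSup`, which would be zero for an unbounded set; compactness of the
unit ball rules this out. -/
theorem wNorm_mulVec_le {u : ι → ℝ} {w : κ → ℝ} (hu : ∀ i, 0 < u i) (A : Matrix κ ι ℝ)
    (v : ι → ℝ) : wNorm w (A *ᵥ v) ≤ wOpNorm u w A * wNorm u v := by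
  have hbdd : BddAbove {t | ∃ v : ι → ℝ, wNorm u v ≤ 1 ∧ t = wNorm w (A *ᵥ v)} := by
    have hc : IsCompact ((fun v => wNorm w (A *ᵥ v)) '' {v | wNorm u (v - 0) ≤ 1}) :=
      (isCompact_wNorm_ball hu 0 1).image
        ((continuous_wNorm w).comp (by fun_prop))
    refine hc.bddAbove.mono ?_
    rintro t ⟨v, hv, rfl⟩
    exact ⟨v, by simpa using hv, rfl⟩
  rcases eq_or_ne (wNorm u v) 0 with h0 | h0
  · rw [h0, eq_zero_of_wNorm_eq_zero hu h0]; simp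
  · have hpos : 0 < wNorm u v := lt_of_le_of_ne (wNorm_nonneg _ _) (Ne.symm h0)
    have h1 : wNorm w (A *ᵥ ((wNorm u v)⁻¹ • v)) ≤ wOpNorm u w A := by
      refine le_csSup hbdd ⟨(wNorm u v)⁻¹ • v, ?_, rfl⟩
      rw [wNorm_smul, abs_of_pos (inv_pos.2 hpos), inv_mul_cancel₀ h0]
    rw [Matrix.mulVec_smul, wNorm_smul, abs_of_pos (inv_pos.2 hpos), inv_mul_le_iff₀ hpos] at h1
    linarith

/-- The displacement `‖T u - u‖` attains its minimum on the compact ball. Applying `T` once more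
halves it, so the minimum is zero. The bound `r / 2` at the centre keeps `T u` inside the ball. -/
theorem exists_fixedPoint_of_contraction {w : ι → ℝ} (hw : ∀ i, 0 < w i)
    {T : (ι → ℝ) → ι → ℝ} {a : ι → ℝ} {r : ℝ} (hr : 0 ≤ r)
    (hT : ∀ u v, wNorm w (u - a) ≤ r → wNorm w (v - a) ≤ r →
      wNorm w (T u - T v) ≤ 1 / 2 * wNorm w (u - v))
    (ha : wNorm w (T a - a) ≤ r / 2) : ∃ u, wNorm w (u - a) ≤ r ∧ T u = u := by
  have hw' : ∀ i, 0 ≤ w i := fun i => (hw i).le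
  have haa : wNorm w (a - a) ≤ r := by simpa using hr
  have hle : ∀ u v, wNorm w (u - a) ≤ r → wNorm w (v - a) ≤ r →
      wNorm w (T u - u) ≤ wNorm w (T v - v) + 3 / 2 * wNorm w (u - v) := by
    intro u v hu hv
    have h1 := wNorm_sub_le_sub hw' (T u) (T v) u
    have h2 := wNorm_sub_le_sub hw' (T v) v u
    rw [wNorm_sub_comm w v u] at h2
    linarith [hT u v hu hv]
  have hcont : ContinuousOn (fun u => wNorm w (T u - u)) {v | wNorm w (v - a) ≤ r} := by
    intro v hv
    have h0 : Filter.Tendsto (fun u => 3 / 2 * wNorm w (u - v))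
        (nhdsWithin v {v | wNorm w (v - a) ≤ r}) (nhds 0) := by
      have : Continuous fun u => 3 / 2 * wNorm w (u - v) :=
        continuous_const.mul ((continuous_wNorm w).comp (by fun_prop))
      have := (this.tendsto v).mono_left (nhdsWithin_le_nhds (s := {v | wNorm w (v - a) ≤ r}))
      simpa using this
    refine tendsto_iff_dist_tendsto_zero.2 (squeeze_zero' (Filter.Eventually.of_forall
      fun _ => dist_nonneg) ?_ h0)
    filter_upwards [self_mem_nhdsWithin] with u hu
    rw [Real.dist_eq, abs_le]
    have h1 := hle u v hu hv
    have h2 := hle v u hv hu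
    rw [wNorm_sub_comm w v u] at h2
    constructor <;> linarith
  obtain ⟨u, hu, hmin⟩ := (isCompact_wNorm_ball hw a r).exists_isMinOn ⟨a, haa⟩ hcont
  refine ⟨u, hu, ?_⟩
  have hTu : wNorm w (T u - a) ≤ r := by
    have h1 := wNorm_sub_le_sub hw' (T u) (T a) a
    have h2 := hT u a hu haa
    have h3 : wNorm w (u - a) ≤ r := hu
    linarith
  have h1 : wNorm w (T u - u) ≤ wNorm w (T (T u) - T u) := hmin hTu
  have h2 := hT (T u) u hTu hu
  have h3 : wNorm w (T u - u) = 0 := le_antisymm (by linarith) (wNorm_nonneg _ _)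
  exact sub_eq_zero.1 (eq_zero_of_wNorm_eq_zero hw h3)

end WeightedNorm

/-! ### Functions with three bounded derivatives and Taylor comparisons -/

noncomputable section SmoothFunctions

set_option maxSynthPendingDepth 3

variable {E : Type*} [NormedAddCommGroup E] [NormedSpace ℝ E]

/-- `f` is three times differentiable on `U`, and `f` and its derivatives are bounded by `L`. -/
structure BoundedC3 (L : ℝ) (U : Set E) (f : E → ℝ) : Prop where
  diff₀ : ∀ z ∈ U, DifferentiableAt ℝ f z
  diff₁ : ∀ z ∈ U, DifferentiableAt ℝ (fderiv ℝ f) z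
  diff₂ : ∀ z ∈ U, DifferentiableAt ℝ (fderiv ℝ (fderiv ℝ f)) z
  bound₀ : ∀ z ∈ U, |f z| ≤ L
  bound₁ : ∀ z ∈ U, ‖fderiv ℝ f z‖ ≤ L
  bound₂ : ∀ z ∈ U, ‖fderiv ℝ (fderiv ℝ f) z‖ ≤ L
  bound₃ : ∀ z ∈ U, ‖fderiv ℝ (fderiv ℝ (fderiv ℝ f)) z‖ ≤ L

namespace BoundedC3

variable {L τ : ℝ} {U V : Set E} {f e : E → ℝ}

theorem mono (hf : BoundedC3 L U f) {L' : ℝ} (h : L ≤ L') : BoundedC3 L' U f where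
  diff₀ := hf.diff₀
  diff₁ := hf.diff₁
  diff₂ := hf.diff₂
  bound₀ z hz := (hf.bound₀ z hz).trans h
  bound₁ z hz := (hf.bound₁ z hz).trans h
  bound₂ z hz := (hf.bound₂ z hz).trans h
  bound₃ z hz := (hf.bound₃ z hz).trans h

theorem abs_sub_le (hf : BoundedC3 L U f) (hV : Convex ℝ V) (hVU : V ⊆ U) {a b : E}
    (ha : a ∈ V) (hb : b ∈ V) : |f a - f b| ≤ L * ‖a - b‖ :=
  hV.norm_image_sub_le_of_norm_fderiv_le (𝕜 := ℝ) (fun z hz => hf.diff₀ z (hVU hz))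
    (fun z hz => hf.bound₁ z (hVU hz)) hb ha

theorem norm_fderiv_sub_le (hf : BoundedC3 L U f) (hV : Convex ℝ V) (hVU : V ⊆ U) {a b : E}
    (ha : a ∈ V) (hb : b ∈ V) : ‖fderiv ℝ f a - fderiv ℝ f b‖ ≤ L * ‖a - b‖ :=
  hV.norm_image_sub_le_of_norm_fderiv_le (𝕜 := ℝ) (fun z hz => hf.diff₁ z (hVU hz))
    (fun z hz => hf.bound₂ z (hVU hz)) hb ha

theorem norm_fderiv_fderiv_sub_le (hf : BoundedC3 L U f) (hV : Convex ℝ V) (hVU : V ⊆ U)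
    {a b : E} (ha : a ∈ V) (hb : b ∈ V) :
    ‖fderiv ℝ (fderiv ℝ f) a - fderiv ℝ (fderiv ℝ f) b‖ ≤ L * ‖a - b‖ :=
  hV.norm_image_sub_le_of_norm_fderiv_le (𝕜 := ℝ) (fun z hz => hf.diff₂ z (hVU hz))
    (fun z hz => hf.bound₃ z (hVU hz)) hb ha

theorem nonneg (hf : BoundedC3 L U f) {a : E} (ha : a ∈ U) : 0 ≤ L :=
  (abs_nonneg _).trans (hf.bound₀ a ha)

/-- Mean value inequality for `f` minus its linear part frozen at the centre `c`, whose derivative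
on the ball is at most `L * δ`. -/
theorem abs_sub_sub_fderiv_le (hf : BoundedC3 L U f) {c : E} {δ : ℝ}
    (hU : Metric.closedBall c δ ⊆ U) {a b : E} (ha : ‖a - c‖ ≤ δ) (hb : ‖b - c‖ ≤ δ) :
    |f a - f b - fderiv ℝ f c (a - b)| ≤ L * δ * ‖a - b‖ := by
  have hδ : 0 ≤ δ := (norm_nonneg _).trans ha
  have hc : c ∈ Metric.closedBall c δ := Metric.mem_closedBall_self hδ
  have hL : 0 ≤ L := hf.nonneg (hU hc)
  refine (convex_closedBall c δ).norm_image_sub_le_of_norm_fderiv_le' (𝕜 := ℝ)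
    (fun z hz => hf.diff₀ z (hU hz)) (fun z hz => ?_) (mem_closedBall_iff_norm.2 hb)
    (mem_closedBall_iff_norm.2 ha)
  refine (hf.norm_fderiv_sub_le (convex_closedBall c δ) hU hz hc).trans ?_
  exact mul_le_mul_of_nonneg_left (mem_closedBall_iff_norm.1 hz) hL

/-- With `s = b - a`, the difference of the two remainders is the remainder at `a` of `z ↦ f (z + s)
- f z`. The derivative of that function is Lipschitz with constant `L * ‖s‖` by the bound on the
third derivative, so the difference vanishes with `‖b - a‖`. -/
theorem abs_taylor_sub_taylor_le (hf : BoundedC3 L U f) {a b v : E} {δ : ℝ}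
    (hU : Metric.closedBall a δ ⊆ U) (hδ : ‖b - a‖ + ‖v‖ ≤ δ) :
    |f (b + v) - f b - fderiv ℝ f b v - (f (a + v) - f a - fderiv ℝ f a v)|
      ≤ L * ‖b - a‖ * ‖v‖ ^ 2 := by
  set s := b - a with hs
  set W := Metric.closedBall a ‖v‖ with hW
  have hconv : Convex ℝ W := convex_closedBall _ _
  have hm : ∀ z ∈ W, z ∈ Metric.closedBall a δ ∧ z + s ∈ Metric.closedBall a δ := by
    intro z hz
    have h1 := mem_closedBall_iff_norm.1 hz
    constructor
    · exact mem_closedBall_iff_norm.2 (by linarith [norm_nonneg s])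
    · refine mem_closedBall_iff_norm.2 ?_
      have : z + s - a = (z - a) + s := by abel
      rw [this]
      linarith [norm_add_le (z - a) s]
  have hd : ∀ z ∈ W, HasFDerivAt (fun z => f (z + s) - f z)
      (fderiv ℝ f (z + s) - fderiv ℝ f z) z := by
    intro z hz
    have h1 := (hasFDerivAt_comp_add_right s).2 (hf.diff₀ _ (hU (hm z hz).2)).hasFDerivAt
    exact h1.sub (hf.diff₀ _ (hU (hm z hz).1)).hasFDerivAt
  have hd2 : ∀ z ∈ W, HasFDerivAt (fun z => fderiv ℝ f (z + s) - fderiv ℝ f z)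
      (fderiv ℝ (fderiv ℝ f) (z + s) - fderiv ℝ (fderiv ℝ f) z) z := by
    intro z hz
    have h1 := (hasFDerivAt_comp_add_right s).2 (hf.diff₁ _ (hU (hm z hz).2)).hasFDerivAt
    exact h1.sub (hf.diff₁ _ (hU (hm z hz).1)).hasFDerivAt
  have ha : a ∈ W := Metric.mem_closedBall_self (norm_nonneg _)
  have hL : 0 ≤ L := hf.nonneg (hU (hm a ha).1)
  have h1 : ∀ z ∈ W, ‖(fderiv ℝ f (z + s) - fderiv ℝ f z) -
      (fderiv ℝ f (a + s) - fderiv ℝ f a)‖ ≤ L * ‖s‖ * ‖v‖ := by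
    intro z hz
    refine (hconv.norm_image_sub_le_of_norm_hasFDerivWithin_le
      (fun u hu => (hd2 u hu).hasFDerivWithinAt) (C := L * ‖s‖) (fun u hu => ?_) ha hz).trans ?_
    · have := hf.norm_fderiv_fderiv_sub_le (convex_closedBall a δ) hU (hm u hu).2 (hm u hu).1
      simpa using this
    · exact mul_le_mul_of_nonneg_left (mem_closedBall_iff_norm.1 hz) (by positivity)
  have hav : a + v ∈ W := mem_closedBall_iff_norm.2 (by simp)
  have h2 := hconv.norm_image_sub_le_of_norm_hasFDerivWithin_le'
    (fun u hu => (hd u hu).hasFDerivWithinAt) h1 ha hav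
  have e : f (b + v) - f b - fderiv ℝ f b v - (f (a + v) - f a - fderiv ℝ f a v) =
      (f (a + v + s) - f (a + v)) - (f (a + s) - f a) -
        (fderiv ℝ f (a + s) - fderiv ℝ f a) (a + v - a) := by
    have e1 : a + s = b := by simp [hs]
    have e2 : a + v + s = b + v := by rw [add_right_comm, e1]
    rw [e1, e2]
    simp only [add_sub_cancel_left, sub_apply]
    ring
  rw [e, ← Real.norm_eq_abs]
  calc _ ≤ _ := h2
    _ = L * ‖s‖ * ‖v‖ ^ 2 := by rw [add_sub_cancel_left]; ring

/-- A peak of height one that decays quadratically persists under a small perturbation, as long as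
it still has height one and a critical point. -/
theorem add_le_of_peak (hf : BoundedC3 L U f) (he : BoundedC3 τ U e) {a b : E} {R δ c : ℝ}
    (hU : Metric.closedBall a δ ⊆ U) (hδ : ‖b - a‖ + R ≤ δ) (hfa : f a = 1)
    (hfa' : fderiv ℝ f a = 0) (hpeak : ∀ z, ‖z - a‖ ≤ R → f z ≤ 1 - c * ‖z - a‖ ^ 2)
    (hb : f b + e b = 1) (hb' : fderiv ℝ f b + fderiv ℝ e b = 0) {y : E} (hy : ‖y - b‖ ≤ R) :
    f y + e y ≤ 1 - (c - L * ‖b - a‖ - τ) * ‖y - b‖ ^ 2 := by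
  set v := y - b with hv
  have h1 := hf.abs_taylor_sub_taylor_le hU (v := v) (b := b) (by linarith)
  have hbv : b + v = y := by simp [hv]
  have hsub : Metric.closedBall b ‖v‖ ⊆ U := by
    refine (Metric.closedBall_subset_closedBall' ?_).trans hU
    rw [dist_eq_norm]; linarith
  have h2 := he.abs_sub_sub_fderiv_le hsub (a := y) (b := b) le_rfl (by simp)
  have h3 := hpeak (a + v) (by simpa using hy)
  have h4 : fderiv ℝ f b v + fderiv ℝ e b v = 0 := by
    rw [← add_apply, hb', zero_apply]
  rw [hbv, hfa', hfa, zero_apply] at h1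
  rw [add_sub_cancel_left] at h3
  rw [← hv] at h2
  -- Expand `f` and `e` around `b`: the values add up to one and the gradients cancel. What is left
  -- is the peak of `f` at `a` read at the same displacement `v`, plus the two remainders.
  have h1' := (abs_le.1 h1).2
  have h2' := (abs_le.1 h2).2
  nlinarith

theorem sum {J : Type*} [Fintype J] {κ : J → E → ℝ} (hL : 0 ≤ L) (hκ : ∀ j, BoundedC3 L U (κ j))
    (hU : IsOpen U) {c : J → ℝ} {C : ℝ} (hc : ∑ j, |c j| ≤ C) :
    BoundedC3 (C * L) U (fun z => ∑ j, c j * κ j z) ∧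
      ∀ z ∈ U, fderiv ℝ (fun z => ∑ j, c j * κ j z) z = ∑ j, c j • fderiv ℝ (κ j) z := by
  have key : ∀ {G : Type _} [NormedAddCommGroup G] [NormedSpace ℝ G] (g : J → G),
      (∀ j, ‖g j‖ ≤ L) → ‖∑ j, c j • g j‖ ≤ C * L := by
    intro G _ _ g hg
    calc ‖∑ j, c j • g j‖ ≤ ∑ j, ‖c j • g j‖ := norm_sum_le _ _
      _ ≤ ∑ j, |c j| * L := by
        refine Finset.sum_le_sum fun j _ => ?_
        rw [norm_smul, Real.norm_eq_abs]
        exact mul_le_mul_of_nonneg_left (hg j) (abs_nonneg _)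
      _ = (∑ j, |c j|) * L := by rw [Finset.sum_mul]
      _ ≤ C * L := mul_le_mul_of_nonneg_right hc hL
  have hd0 : ∀ z ∈ U, HasFDerivAt (fun z => ∑ j, c j * κ j z) (∑ j, c j • fderiv ℝ (κ j) z) z :=
    fun z hz => HasFDerivAt.fun_sum fun j _ => ((hκ j).diff₀ z hz).hasFDerivAt.const_mul (c j)
  -- Equality on a neighbourhood, not only at `z`, so that it can be differentiated again.
  have e0 : ∀ z ∈ U, fderiv ℝ (fun z => ∑ j, c j * κ j z) =ᶠ[nhds z]
      fun z => ∑ j, c j • fderiv ℝ (κ j) z := fun z hz =>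
    Filter.eventuallyEq_of_mem (hU.mem_nhds hz) fun u hu => (hd0 u hu).fderiv
  have hd1 : ∀ z ∈ U, HasFDerivAt (fderiv ℝ (fun z => ∑ j, c j * κ j z))
      (∑ j, c j • fderiv ℝ (fderiv ℝ (κ j)) z) z := fun z hz =>
    (HasFDerivAt.fun_sum fun j _ =>
      ((hκ j).diff₁ z hz).hasFDerivAt.const_smul (c j)).congr_of_eventuallyEq (e0 z hz)
  have e1 : ∀ z ∈ U, fderiv ℝ (fderiv ℝ (fun z => ∑ j, c j * κ j z)) =ᶠ[nhds z]
      fun z => ∑ j, c j • fderiv ℝ (fderiv ℝ (κ j)) z := fun z hz =>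
    Filter.eventuallyEq_of_mem (hU.mem_nhds hz) fun u hu => (hd1 u hu).fderiv
  have hd2 : ∀ z ∈ U, HasFDerivAt (fderiv ℝ (fderiv ℝ (fun z => ∑ j, c j * κ j z)))
      (∑ j, c j • fderiv ℝ (fderiv ℝ (fderiv ℝ (κ j))) z) z := fun z hz =>
    (HasFDerivAt.fun_sum fun j _ =>
      ((hκ j).diff₂ z hz).hasFDerivAt.const_smul (c j)).congr_of_eventuallyEq (e1 z hz)
  refine ⟨⟨fun z hz => (hd0 z hz).differentiableAt, fun z hz => (hd1 z hz).differentiableAt,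
    fun z hz => (hd2 z hz).differentiableAt, fun z hz => ?_, fun z hz => ?_, fun z hz => ?_,
    fun z hz => ?_⟩, fun z hz => (hd0 z hz).fderiv⟩
  · calc |∑ j, c j * κ j z| ≤ ∑ j, |c j| * L :=
          (Finset.abs_sum_le_sum_abs _ _).trans (Finset.sum_le_sum fun j _ => by
            rw [abs_mul]
            exact mul_le_mul_of_nonneg_left ((hκ j).bound₀ z hz) (abs_nonneg _))
      _ = (∑ j, |c j|) * L := by rw [Finset.sum_mul]
      _ ≤ C * L := mul_le_mul_of_nonneg_right hc hL
  · rw [(hd0 z hz).fderiv]; exact key _ fun j => (hκ j).bound₁ z hz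
  · rw [(hd1 z hz).fderiv]; exact key _ fun j => (hκ j).bound₂ z hz
  · rw [(hd2 z hz).fderiv]; exact key _ fun j => (hκ j).bound₃ z hz

end BoundedC3

/-- Up to a linear isometry, the derivative of order `n + 1` of `f` is the one of order `n` of
`fderiv ℝ f`; this turns iterated derivatives into nested ones. -/
theorem differentiableAt_fderiv_of_iteratedFDeriv {F : Type*} [NormedAddCommGroup F]
    [NormedSpace ℝ F] {n : ℕ} {f : E → F} {z : E}
    (h : DifferentiableAt ℝ (iteratedFDeriv ℝ (n + 1) f) z) :
    DifferentiableAt ℝ (iteratedFDeriv ℝ n (fderiv ℝ f)) z := by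
  rw [show iteratedFDeriv ℝ (n + 1) f = (continuousMultilinearCurryRightEquiv' ℝ n E F).symm ∘
    iteratedFDeriv ℝ n (fderiv ℝ f) from funext fun _ => iteratedFDeriv_succ_eq_comp_right] at h
  exact (LinearIsometryEquiv.comp_differentiableAt_iff _).1 h

theorem differentiableAt_of_iteratedFDeriv_zero {F : Type*} [NormedAddCommGroup F]
    [NormedSpace ℝ F] {f : E → F} {z : E}
    (h : DifferentiableAt ℝ (iteratedFDeriv ℝ 0 f) z) : DifferentiableAt ℝ f z := by
  rw [iteratedFDeriv_zero_eq_comp] at h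
  exact (LinearIsometryEquiv.comp_differentiableAt_iff _).1 h

/-- The derivative bounds hold on the interior only; compactness and continuity supply the bound for
the kernel itself on all of `Ωs`. -/
theorem KernelRegular.exists_bound {p d : ℕ} {Ωo : Set (Pt p)} {Ωs : Set (Pt d)}
    {k : Pt p → Pt d → ℝ} (hk : KernelRegular Ωo Ωs k) (hΩo : IsCompact Ωo)
    (hΩs : IsCompact Ωs) :
    ∃ L : ℝ, 1 ≤ L ∧ (∀ x ∈ Ωo, BoundedC3 L (interior Ωs) (k x)) ∧
      ∀ x ∈ Ωo, ∀ z ∈ Ωs, |k x z| ≤ L := by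
  obtain ⟨C, hC⟩ := hk.bounded
  obtain ⟨C', hC'⟩ := (hΩo.prod hΩs).exists_bound_of_continuousOn hk.continuousOn
  have hC'' : ∀ x ∈ Ωo, ∀ z ∈ Ωs, |k x z| ≤ max 1 (max C C') := fun x hx z hz =>
    (hC' (x, z) ⟨hx, hz⟩).trans ((le_max_right _ _).trans (le_max_right _ _))
  have hL : C ≤ max 1 (max C C') := (le_max_left _ _).trans (le_max_right _ _)
  refine ⟨max 1 (max C C'), le_max_left _ _, fun x hx => ?_, hC''⟩
  have hd : ∀ i < 3, ∀ z ∈ interior Ωs, DifferentiableAt ℝ (iteratedFDeriv ℝ i (k x)) z :=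
    fun i hi z hz => (hk.differentiableOn x hx i hi).differentiableAt
      (isOpen_interior.mem_nhds hz)
  refine ⟨fun z hz => ?_, fun z hz => ?_, fun z hz => ?_, fun z hz => ?_, fun z hz => ?_,
    fun z hz => ?_, fun z hz => ?_⟩
  · exact differentiableAt_of_iteratedFDeriv_zero (hd 0 (by norm_num) z hz)
  · exact differentiableAt_of_iteratedFDeriv_zero
      (differentiableAt_fderiv_of_iteratedFDeriv (hd 1 (by norm_num) z hz))
  · exact differentiableAt_of_iteratedFDeriv_zero (differentiableAt_fderiv_of_iteratedFDeriv
      (differentiableAt_fderiv_of_iteratedFDeriv (hd 2 (by norm_num) z hz)))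
  · exact hC'' x hx z (interior_subset hz)
  · refine le_trans (le_of_eq ?_) ((hC x hx z hz 1 (by norm_num)).trans hL)
    rw [norm_iteratedFDeriv_one]
  · refine le_trans (le_of_eq ?_) ((hC x hx z hz 2 (by norm_num)).trans hL)
    rw [← norm_iteratedFDeriv_one, norm_iteratedFDeriv_fderiv]
  · refine le_trans (le_of_eq ?_) ((hC x hx z hz 3 (by norm_num)).trans hL)
    rw [← norm_iteratedFDeriv_one, norm_iteratedFDeriv_fderiv, norm_iteratedFDeriv_fderiv]

end SmoothFunctions

/-! ### Coordinates `(q; y)` and the norm of `W†` -/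

noncomputable section Parametrization

variable {N d : ℕ}

/-- The amplitudes of a coordinate vector. -/
def amp (m : Idx N d → ℝ) : Fin N → ℝ := fun n => m (Sum.inl n)

/-- The locations of a coordinate vector. -/
def locs (m : Idx N d → ℝ) : Fin N → Pt d := fun n => WithLp.toLp 2 fun i => m (Sum.inr (n, i))

@[simp]
theorem stack_amp_locs (m : Idx N d → ℝ) : stack (amp m) (locs m) = m := by
  funext a
  rcases a with n | ⟨n, i⟩ <;> rfl

theorem amp_sub (m v : Idx N d → ℝ) (n : Fin N) : amp (m - v) n = amp m n - amp v n := rfl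

theorem locs_sub (m v : Idx N d → ℝ) (n : Fin N) : locs (m - v) n = locs m n - locs v n := rfl

theorem weight_pos {q : Fin N → ℝ} (hq : ∀ n, q n ≠ 0) (a : Idx N d) : 0 < weight d q a := by
  rcases a with n | ⟨n, i⟩
  · exact inv_pos.2 (mul_pos four_pos (abs_pos.2 (hq n)))
  · exact abs_pos.2 (hq n)

theorem wNorm_weight_sq (q : Fin N → ℝ) (hq : ∀ n, q n ≠ 0) (v : Idx N d → ℝ) :
    wNorm (weight d q) v ^ 2 = ∑ n, (amp v n ^ 2 / (4 * |q n|) + |q n| * ‖locs v n‖ ^ 2) := by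
  rw [wNorm_sq fun a => (weight_pos hq a).le, Fintype.sum_sum_type, Fintype.sum_prod_type,
    ← Finset.sum_add_distrib]
  refine Finset.sum_congr rfl fun n _ => ?_
  rw [EuclideanSpace.norm_sq_eq, Finset.mul_sum]
  simp only [weight, Sum.elim_inl, Sum.elim_inr, amp, locs, Real.norm_eq_abs, sq_abs]
  rw [inv_mul_eq_div]

theorem sq_le_wNorm_weight_sq {q : Fin N → ℝ} (hq : ∀ n, q n ≠ 0) (v : Idx N d → ℝ) (n : Fin N) :
    amp v n ^ 2 / (4 * |q n|) + |q n| * ‖locs v n‖ ^ 2 ≤ wNorm (weight d q) v ^ 2 := by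
  rw [wNorm_weight_sq q hq]
  exact Finset.single_le_sum (f := fun n => amp v n ^ 2 / (4 * |q n|) + |q n| * ‖locs v n‖ ^ 2)
    (fun n _ => by positivity) (Finset.mem_univ n)

theorem abs_amp_le {q : Fin N → ℝ} (hq : ∀ n, q n ≠ 0) (v : Idx N d → ℝ) (n : Fin N) :
    |amp v n| ≤ 2 * √|q n| * wNorm (weight d q) v := by
  have h := sq_le_wNorm_weight_sq hq v n
  have hqn : 0 < |q n| := abs_pos.2 (hq n)
  have h1 : amp v n ^ 2 / (4 * |q n|) ≤ wNorm (weight d q) v ^ 2 :=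
    le_trans (le_add_of_nonneg_right (by positivity)) h
  rw [div_le_iff₀ (by positivity)] at h1
  refine abs_le_of_sq_le_sq ?_
    (mul_nonneg (by positivity) (wNorm_nonneg _ _))
  calc amp v n ^ 2 ≤ wNorm (weight d q) v ^ 2 * (4 * |q n|) := h1
    _ = (2 * √|q n| * wNorm (weight d q) v) ^ 2 := by
      rw [mul_pow, mul_pow, Real.sq_sqrt hqn.le]; ring

theorem norm_locs_le {q : Fin N → ℝ} (hq : ∀ n, q n ≠ 0) (v : Idx N d → ℝ) (n : Fin N) :
    ‖locs v n‖ ≤ (√|q n|)⁻¹ * wNorm (weight d q) v := by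
  have h := sq_le_wNorm_weight_sq hq v n
  have hqn : 0 < |q n| := abs_pos.2 (hq n)
  have h1 : |q n| * ‖locs v n‖ ^ 2 ≤ wNorm (weight d q) v ^ 2 :=
    le_trans (le_add_of_nonneg_left (by positivity)) h
  rw [inv_mul_eq_div, le_div_iff₀ (Real.sqrt_pos.2 hqn)]
  refine abs_le_of_sq_le_sq' ?_ (wNorm_nonneg _ _) |>.2
  rw [mul_pow, Real.sq_sqrt hqn.le]
  linarith

variable {p No : ℕ}

theorem jac_mulVec_apply (k : Pt p → Pt d → ℝ) (x : Fin No → Pt p) (q : Fin N → ℝ)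
    (y : Fin N → Pt d) (v : Idx N d → ℝ) (j : Fin No) :
    (jac k x q y *ᵥ v) j =
      ∑ n, (amp v n * k (x j) (y n) + q n * fderiv ℝ (k (x j)) (y n) (locs v n)) := by
  have hsum : ∀ n, locs v n = ∑ i, v (Sum.inr (n, i)) • EuclideanSpace.single i (1 : ℝ) := by
    intro n
    ext i
    simp [locs, Finset.sum_apply, Pi.single_apply]
  rw [Matrix.mulVec, dotProduct, Fintype.sum_sum_type, Fintype.sum_prod_type,
    ← Finset.sum_add_distrib]
  refine Finset.sum_congr rfl fun n _ => ?_
  simp only [jac, Matrix.of_apply, Sum.elim_inl, Sum.elim_inr]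
  congr 1
  · rw [amp, mul_comm]
  · rw [hsum n, map_sum, Finset.mul_sum]
    refine Finset.sum_congr rfl fun i _ => ?_
    rw [map_smul, smul_eq_mul]; ring

theorem sum_le_card_mul {f : Fin N → ℝ} {c : ℝ} (h : ∀ n, |f n| ≤ c) : |∑ n, f n| ≤ N * c := by
  refine (Finset.abs_sum_le_sum_abs _ _).trans ((Finset.sum_le_sum fun n _ => h n).trans ?_)
  simp

end Parametrization

/-! ### Estimates for a single point source -/

noncomputable section PointSources

variable {E : Type*} [NormedAddCommGroup E] [NormedSpace ℝ E] {L : ℝ} {U V : Set E} {κ : E → ℝ}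

theorem BoundedC3.abs_source_deriv_le (hκ : BoundedC3 L U κ) {y t : E} (hy : y ∈ U) (s q : ℝ) :
    |s * κ y + q * fderiv ℝ κ y t| ≤ L * (|s| + |q| * ‖t‖) := by
  have h1 := hκ.bound₀ y hy
  have h2 : |fderiv ℝ κ y t| ≤ L * ‖t‖ :=
    ((fderiv ℝ κ y).le_opNorm t).trans (mul_le_mul_of_nonneg_right (hκ.bound₁ y hy) (norm_nonneg _))
  calc _ ≤ |s| * |κ y| + |q| * |fderiv ℝ κ y t| := by
        rw [← abs_mul, ← abs_mul]; exact abs_add_le _ _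
    _ ≤ |s| * L + |q| * (L * ‖t‖) := by gcongr
    _ = _ := by ring

theorem BoundedC3.abs_source_deriv_sub_le (hκ : BoundedC3 L U κ) (hV : Convex ℝ V) (hVU : V ⊆ U)
    {y₁ y₂ t : E} (h₁ : y₁ ∈ V) (h₂ : y₂ ∈ V) (s q₁ q₂ : ℝ) :
    |(s * κ y₁ + q₁ * fderiv ℝ κ y₁ t) - (s * κ y₂ + q₂ * fderiv ℝ κ y₂ t)| ≤
      L * (|s| * ‖y₁ - y₂‖ + |q₁ - q₂| * ‖t‖ + |q₂| * ‖y₁ - y₂‖ * ‖t‖) := by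
  have h1 := hκ.abs_sub_le hV hVU h₁ h₂
  have h2 : |fderiv ℝ κ y₁ t| ≤ L * ‖t‖ := ((fderiv ℝ κ y₁).le_opNorm t).trans
    (mul_le_mul_of_nonneg_right (hκ.bound₁ y₁ (hVU h₁)) (norm_nonneg _))
  have h3 : |(fderiv ℝ κ y₁ - fderiv ℝ κ y₂) t| ≤ L * ‖y₁ - y₂‖ * ‖t‖ :=
    ((fderiv ℝ κ y₁ - fderiv ℝ κ y₂).le_opNorm t).trans
    (mul_le_mul_of_nonneg_right (hκ.norm_fderiv_sub_le hV hVU h₁ h₂) (norm_nonneg _))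
  have e : (s * κ y₁ + q₁ * fderiv ℝ κ y₁ t) - (s * κ y₂ + q₂ * fderiv ℝ κ y₂ t) =
      s * (κ y₁ - κ y₂) + (q₁ - q₂) * fderiv ℝ κ y₁ t +
        q₂ * ((fderiv ℝ κ y₁ - fderiv ℝ κ y₂) t) := by
    rw [sub_apply]; ring
  rw [e]
  calc _ ≤ |s| * |κ y₁ - κ y₂| + |q₁ - q₂| * |fderiv ℝ κ y₁ t| +
        |q₂| * |(fderiv ℝ κ y₁ - fderiv ℝ κ y₂) t| := by
        rw [← abs_mul, ← abs_mul, ← abs_mul]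
        exact (abs_add_le _ _).trans (add_le_add_left (abs_add_le _ _) _)
    _ ≤ |s| * (L * ‖y₁ - y₂‖) + |q₁ - q₂| * (L * ‖t‖) + |q₂| * (L * ‖y₁ - y₂‖ * ‖t‖) := by gcongr
    _ = _ := by ring

/-- The linearization is frozen at `(q₀, y₀)`. The error is a sum of three products, each with a
small factor besides the increment: a kernel increment, a remainder of the kernel, or an amplitude
increment. -/
theorem BoundedC3.abs_source_sub_sub_le (hκ : BoundedC3 L U κ) {y₀ y₁ y₂ : E} {δ : ℝ}
    (hU : Metric.closedBall y₀ δ ⊆ U) (h₁ : ‖y₁ - y₀‖ ≤ δ) (h₂ : ‖y₂ - y₀‖ ≤ δ) (q₀ q₁ q₂ : ℝ) :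
    |q₁ * κ y₁ - q₂ * κ y₂ - ((q₁ - q₂) * κ y₀ + q₀ * fderiv ℝ κ y₀ (y₁ - y₂))| ≤
      L * (|q₁ - q₂| * δ + |q₂| * δ * ‖y₁ - y₂‖ + |q₂ - q₀| * ‖y₁ - y₂‖) := by
  have hδ : 0 ≤ δ := (norm_nonneg _).trans h₁
  have m₀ : y₀ ∈ Metric.closedBall y₀ δ := Metric.mem_closedBall_self hδ
  have hL : 0 ≤ L := hκ.nonneg (hU m₀)
  have h1 : |κ y₁ - κ y₀| ≤ L * δ :=
    (hκ.abs_sub_le (convex_closedBall y₀ δ) hU (mem_closedBall_iff_norm.2 h₁) m₀).trans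
      (mul_le_mul_of_nonneg_left h₁ hL)
  have h2 := hκ.abs_sub_sub_fderiv_le hU h₁ h₂
  have h3 : |fderiv ℝ κ y₀ (y₁ - y₂)| ≤ L * ‖y₁ - y₂‖ := ((fderiv ℝ κ y₀).le_opNorm _).trans
    (mul_le_mul_of_nonneg_right (hκ.bound₁ y₀ (hU m₀)) (norm_nonneg _))
  have e : q₁ * κ y₁ - q₂ * κ y₂ - ((q₁ - q₂) * κ y₀ + q₀ * fderiv ℝ κ y₀ (y₁ - y₂)) =
      (q₁ - q₂) * (κ y₁ - κ y₀) + q₂ * (κ y₁ - κ y₂ - fderiv ℝ κ y₀ (y₁ - y₂)) +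
        (q₂ - q₀) * fderiv ℝ κ y₀ (y₁ - y₂) := by ring
  rw [e]
  calc _ ≤ |q₁ - q₂| * |κ y₁ - κ y₀| + |q₂| * |κ y₁ - κ y₂ - fderiv ℝ κ y₀ (y₁ - y₂)| +
        |q₂ - q₀| * |fderiv ℝ κ y₀ (y₁ - y₂)| := by
        rw [← abs_mul, ← abs_mul, ← abs_mul]
        exact (abs_add_le _ _).trans (add_le_add_left (abs_add_le _ _) _)
    _ ≤ |q₁ - q₂| * (L * δ) + |q₂| * (L * δ * ‖y₁ - y₂‖) + |q₂ - q₀| * (L * ‖y₁ - y₂‖) := by gcongr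
    _ = _ := by ring

end PointSources

/-! ### Nonlinear least squares and the frozen Newton map -/

noncomputable section GaussNewton

variable {ι κ : Type*} [Fintype ι] [Fintype κ]

theorem transpose_mulVec_dotProduct (S : κ → ℝ) (J : Matrix κ ι ℝ) (z : κ → ℝ) (v : ι → ℝ) :
    (Jᵀ *ᵥ (S * z)) ⬝ᵥ v = ∑ i, S i * z i * (J *ᵥ v) i := by
  rw [Matrix.mulVec_transpose, ← Matrix.dotProduct_mulVec, dotProduct]
  rfl

variable [DecidableEq κ]

/-- The Gram matrix `Jᵀ diag(S) J`. -/
def gram (S : κ → ℝ) (J : Matrix κ ι ℝ) : Matrix ι ι ℝ := Jᵀ * Matrix.diagonal S * J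

theorem gram_mulVec (S : κ → ℝ) (J : Matrix κ ι ℝ) (v : ι → ℝ) :
    gram S J *ᵥ v = Jᵀ *ᵥ (S * (J *ᵥ v)) := by
  rw [gram, ← Matrix.mulVec_mulVec, ← Matrix.mulVec_mulVec]
  congr 1
  funext i
  rw [Matrix.mulVec_diagonal, Pi.mul_apply]

variable [DecidableEq ι]

/-- The quadratic form of the Gram matrix is `‖J v‖²`, which is definite when `J` is injective. -/
theorem isUnit_det_gram {S : κ → ℝ} (hS : ∀ i, 0 < S i) {J : Matrix κ ι ℝ}
    (hJ : LinearIndependent ℝ J.col) : IsUnit (gram S J).det := by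
  rw [← Matrix.isUnit_iff_isUnit_det, ← Matrix.mulVec_injective_iff_isUnit]
  have hinj := Matrix.mulVec_injective_iff.2 hJ
  rw [← Matrix.coe_mulVecLin, ← LinearMap.ker_eq_bot, LinearMap.ker_eq_bot']
  intro v hv
  rw [Matrix.mulVecLin_apply] at hv
  have h1 : (gram S J *ᵥ v) ⬝ᵥ v = wNorm S (J *ᵥ v) ^ 2 := by
    rw [gram_mulVec, transpose_mulVec_dotProduct, wNorm_sq fun i => (hS i).le]
    exact Finset.sum_congr rfl fun i _ => by ring
  rw [hv, zero_dotProduct] at h1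
  have h2 := eq_zero_of_wNorm_eq_zero hS (pow_eq_zero_iff two_ne_zero |>.1 h1.symm)
  exact hinj (by rw [h2, Matrix.mulVec_zero])

/-- A nonlinear least squares model `G` with Jacobian `J` near `m₀`, with quantitative bounds in
the norms given by the weights `w` (parameters) and `S` (observations). -/
structure LeastSquaresModel (w : ι → ℝ) (S : κ → ℝ) (G : (ι → ℝ) → κ → ℝ)
    (J : (ι → ℝ) → Matrix κ ι ℝ) (m₀ : ι → ℝ) (r₀ L M : ℝ) : Prop where
  w_pos : ∀ i, 0 < w i
  S_pos : ∀ j, 0 < S j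
  one_le : 1 ≤ L
  M_nonneg : 0 ≤ M
  r₀_le : r₀ ≤ 1
  deriv_le : ∀ v, wNorm S (J m₀ *ᵥ v) ≤ L * wNorm w v
  deriv_sub_le : ∀ m₁ m₂, wNorm w (m₁ - m₀) ≤ r₀ → wNorm w (m₂ - m₀) ≤ r₀ → ∀ v,
    wNorm S (J m₁ *ᵥ v - J m₂ *ᵥ v) ≤ L * wNorm w (m₁ - m₂) * wNorm w v
  taylor_le : ∀ r ≤ r₀, ∀ m₁ m₂, wNorm w (m₁ - m₀) ≤ r → wNorm w (m₂ - m₀) ≤ r →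
    wNorm S (G m₁ - G m₂ - J m₀ *ᵥ (m₁ - m₂)) ≤ L * r * wNorm w (m₁ - m₂)
  linearIndependent : LinearIndependent ℝ (J m₀).col
  inv_le : ∀ u, wNorm w ((gram S (J m₀))⁻¹ *ᵥ u) ≤ M * wNorm w⁻¹ u

/-- The gradient of `½ ‖G m - G m₀ - ε‖² + b ⬝ m`. -/
def lsGradient (S : κ → ℝ) (G : (ι → ℝ) → κ → ℝ) (J : (ι → ℝ) → Matrix κ ι ℝ) (m₀ : ι → ℝ)
    (ε : κ → ℝ) (b m : ι → ℝ) : ι → ℝ :=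
  (J m)ᵀ *ᵥ (S * (G m - (G m₀ + ε))) + b

/-- The minimizer `(Jᵀ S J)⁻¹ (Jᵀ S ε - b)` of `½ ‖J δ - ε‖² + b ⬝ δ`. -/
def lsLinear (S : κ → ℝ) (J : Matrix κ ι ℝ) (ε : κ → ℝ) (b : ι → ℝ) : ι → ℝ :=
  (gram S J)⁻¹ *ᵥ (Jᵀ *ᵥ (S * ε) - b)

namespace LeastSquaresModel

variable {w : ι → ℝ} {S : κ → ℝ} {G : (ι → ℝ) → κ → ℝ} {J : (ι → ℝ) → Matrix κ ι ℝ}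
  {m₀ : ι → ℝ} {r₀ L M : ℝ}

theorem w_nonneg (H : LeastSquaresModel w S G J m₀ r₀ L M) (i : ι) : 0 ≤ w i := (H.w_pos i).le

theorem S_nonneg (H : LeastSquaresModel w S G J m₀ r₀ L M) (j : κ) : 0 ≤ S j := (H.S_pos j).le

theorem L_nonneg (H : LeastSquaresModel w S G J m₀ r₀ L M) : 0 ≤ L := zero_le_one.trans H.one_le

theorem isUnit_det (H : LeastSquaresModel w S G J m₀ r₀ L M) : IsUnit (gram S (J m₀)).det :=
  isUnit_det_gram H.S_pos H.linearIndependent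

theorem wNorm_inv_transpose_mulVec_le (H : LeastSquaresModel w S G J m₀ r₀ L M) (z : κ → ℝ) :
    wNorm w⁻¹ ((J m₀)ᵀ *ᵥ (S * z)) ≤ L * wNorm S z := by
  refine wNorm_inv_le_of_dotProduct_le H.w_pos (mul_nonneg H.L_nonneg (wNorm_nonneg _ _))
    fun v => ?_
  rw [transpose_mulVec_dotProduct]
  refine (le_abs_self _).trans ((abs_sum_mul_mul_le H.S_nonneg z _).trans ?_)
  calc _ ≤ wNorm S z * (L * wNorm w v) :=
        mul_le_mul_of_nonneg_left (H.deriv_le v) (wNorm_nonneg _ _)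
    _ = _ := by ring

theorem wNorm_lsLinear_le (H : LeastSquaresModel w S G J m₀ r₀ L M) (ε : κ → ℝ) (b : ι → ℝ) :
    wNorm w (lsLinear S (J m₀) ε b) ≤ M * (L * wNorm S ε + wNorm w⁻¹ b) := by
  refine (H.inv_le _).trans (mul_le_mul_of_nonneg_left ?_ H.M_nonneg)
  refine (wNorm_sub_le (w := w⁻¹) (fun i => inv_nonneg.2 (H.w_nonneg i)) _ _).trans ?_
  gcongr
  exact H.wNorm_inv_transpose_mulVec_le ε

theorem wNorm_obs_sub_le (H : LeastSquaresModel w S G J m₀ r₀ L M) {r : ℝ} (hr : r ≤ r₀)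
    {m₁ m₂ : ι → ℝ} (h₁ : wNorm w (m₁ - m₀) ≤ r) (h₂ : wNorm w (m₂ - m₀) ≤ r) :
    wNorm S (G m₁ - G m₂) ≤ 2 * L * wNorm w (m₁ - m₂) := by
  have h3 := wNorm_add_le H.S_nonneg (G m₁ - G m₂ - J m₀ *ᵥ (m₁ - m₂)) (J m₀ *ᵥ (m₁ - m₂))
  rw [sub_add_cancel] at h3
  have h4 := H.taylor_le r hr m₁ m₂ h₁ h₂
  have h5 := H.deriv_le (m₁ - m₂)
  have h6 : L * r * wNorm w (m₁ - m₂) ≤ L * 1 * wNorm w (m₁ - m₂) := by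
    have := H.L_nonneg
    have := wNorm_nonneg w (m₁ - m₂)
    have := hr.trans H.r₀_le
    gcongr
  linarith

/-- The frozen Newton map cancels the linear part of the gradient. Its increment is therefore the
inverse Gram matrix applied to a second-order error, which is bounded by duality. -/
theorem wNorm_newton_sub_le (H : LeastSquaresModel w S G J m₀ r₀ L M) {r : ℝ} (hr : r ≤ r₀)
    (ε : κ → ℝ) (b : ι → ℝ) {m₁ m₂ : ι → ℝ} (h₁ : wNorm w (m₁ - m₀) ≤ r)
    (h₂ : wNorm w (m₂ - m₀) ≤ r) :
    wNorm w ((m₁ - (gram S (J m₀))⁻¹ *ᵥ lsGradient S G J m₀ ε b m₁) -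
        (m₂ - (gram S (J m₀))⁻¹ *ᵥ lsGradient S G J m₀ ε b m₂)) ≤
      5 * M * L ^ 2 * (r + wNorm S ε) * wNorm w (m₁ - m₂) := by
  have hL := H.L_nonneg
  have hr0 : 0 ≤ r := (wNorm_nonneg _ _).trans h₁
  set D := wNorm w (m₁ - m₂) with hD
  have hD0 : 0 ≤ D := wNorm_nonneg _ _
  set u := lsGradient S G J m₀ ε b m₁ - lsGradient S G J m₀ ε b m₂ -
    gram S (J m₀) *ᵥ (m₁ - m₂) with hu
  have e1 : (m₁ - (gram S (J m₀))⁻¹ *ᵥ lsGradient S G J m₀ ε b m₁) -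
        (m₂ - (gram S (J m₀))⁻¹ *ᵥ lsGradient S G J m₀ ε b m₂) =
      -((gram S (J m₀))⁻¹ *ᵥ u) := by
    rw [hu, Matrix.mulVec_sub, Matrix.mulVec_sub, Matrix.mulVec_mulVec,
      Matrix.nonsing_inv_mul _ H.isUnit_det, Matrix.one_mulVec]
    abel
  rw [e1, wNorm_neg]
  have hu' : wNorm w⁻¹ u ≤ 5 * L ^ 2 * (r + wNorm S ε) * D := by
    refine wNorm_inv_le_of_dotProduct_le H.w_pos
      (by have := wNorm_nonneg S ε; positivity) fun v => ?_
    set V := wNorm w v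
    have hV : 0 ≤ V := wNorm_nonneg _ _
    -- Product rule for differences. The three sums contribute `2`, `2` and `1` to the factor of `L²
    -- r D V`; the noise enters the first sum only.
    have e2 : u ⬝ᵥ v = (∑ i, S i * (G m₁ - (G m₀ + ε)) i * (J m₁ *ᵥ v - J m₂ *ᵥ v) i) +
        (∑ i, S i * (G m₁ - G m₂) i * (J m₂ *ᵥ v - J m₀ *ᵥ v) i) +
        ∑ i, S i * (G m₁ - G m₂ - J m₀ *ᵥ (m₁ - m₂)) i * (J m₀ *ᵥ v) i := by
      rw [hu, lsGradient, lsGradient, add_sub_add_right_eq_sub, sub_dotProduct, sub_dotProduct,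
        gram_mulVec, transpose_mulVec_dotProduct, transpose_mulVec_dotProduct,
        transpose_mulVec_dotProduct, ← Finset.sum_add_distrib, ← Finset.sum_add_distrib,
        ← Finset.sum_sub_distrib, ← Finset.sum_sub_distrib]
      refine Finset.sum_congr rfl fun i _ => ?_
      simp only [Pi.sub_apply, Pi.add_apply]
      ring
    have b1 : wNorm S (G m₁ - (G m₀ + ε)) ≤ 2 * L * r + wNorm S ε := by
      rw [← sub_sub]
      refine (wNorm_sub_le H.S_nonneg _ _).trans (add_le_add_left ?_ _)
      refine (H.wNorm_obs_sub_le hr h₁ (by simpa using hr0)).trans ?_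
      gcongr
    have b2 : wNorm S (G m₁ - G m₂) ≤ 2 * L * D := H.wNorm_obs_sub_le hr h₁ h₂
    have b3 := H.taylor_le r hr m₁ m₂ h₁ h₂
    have c1 := H.deriv_sub_le m₁ m₂ (h₁.trans hr) (h₂.trans hr) v
    have c2 : wNorm S (J m₂ *ᵥ v - J m₀ *ᵥ v) ≤ L * r * V :=
      (H.deriv_sub_le m₂ m₀ (h₂.trans hr) (by simpa using hr0.trans hr) v).trans (by gcongr)
    have c3 := H.deriv_le v
    have hε : 0 ≤ wNorm S ε := wNorm_nonneg _ _
    have d1 := (le_abs_self _).trans ((abs_sum_mul_mul_le H.S_nonneg (G m₁ - (G m₀ + ε))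
      (J m₁ *ᵥ v - J m₂ *ᵥ v)).trans
        (mul_le_mul b1 c1 (wNorm_nonneg _ _) (by positivity)))
    have d2 := (le_abs_self _).trans ((abs_sum_mul_mul_le H.S_nonneg (G m₁ - G m₂)
      (J m₂ *ᵥ v - J m₀ *ᵥ v)).trans (mul_le_mul b2 c2 (wNorm_nonneg _ _) (by positivity)))
    have d3 := (le_abs_self _).trans ((abs_sum_mul_mul_le H.S_nonneg
      (G m₁ - G m₂ - J m₀ *ᵥ (m₁ - m₂)) (J m₀ *ᵥ v)).trans
        (mul_le_mul b3 c3 (wNorm_nonneg _ _) (by positivity)))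
    have d4 : L * wNorm S ε * (D * V) ≤ L ^ 2 * wNorm S ε * (D * V) := by
      gcongr
      nlinarith [H.one_le]
    have d5 : 0 ≤ L ^ 2 * wNorm S ε * (D * V) := by positivity
    rw [e2]
    linarith
  calc _ ≤ M * wNorm w⁻¹ u := H.inv_le u
    _ ≤ M * (5 * L ^ 2 * (r + wNorm S ε) * D) := mul_le_mul_of_nonneg_left hu' H.M_nonneg
    _ = _ := by ring

theorem newton_center (ε : κ → ℝ) (b : ι → ℝ) :
    m₀ - (gram S (J m₀))⁻¹ *ᵥ lsGradient S G J m₀ ε b m₀ = m₀ + lsLinear S (J m₀) ε b := by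
  have : lsGradient S G J m₀ ε b m₀ = -((J m₀)ᵀ *ᵥ (S * ε) - b) := by
    rw [lsGradient, sub_add_cancel_left, mul_neg, Matrix.mulVec_neg]; abel
  rw [this, Matrix.mulVec_neg, lsLinear, sub_neg_eq_add]

theorem lsGradient_eq_zero_iff (H : LeastSquaresModel w S G J m₀ r₀ L M) (ε : κ → ℝ)
    (b m : ι → ℝ) : lsGradient S G J m₀ ε b m = 0 ↔
      m - (gram S (J m₀))⁻¹ *ᵥ lsGradient S G J m₀ ε b m = m := by
  rw [sub_eq_self]
  refine ⟨fun h => by rw [h, Matrix.mulVec_zero], fun h => ?_⟩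
  have := congrArg (fun v => gram S (J m₀) *ᵥ v) h
  simpa [Matrix.mulVec_mulVec, Matrix.mul_nonsing_inv _ H.isUnit_det] using this

/-- Zeros of the gradient are the fixed points of the frozen Newton map, whose first step from `m₀`
is the linear estimate. Hence `m - m₀` minus the linear estimate equals `T m - T m₀`. The
contraction factor `1 / 2` gives the bound by twice the linear estimate. -/
theorem exists_unique_zero (H : LeastSquaresModel w S G J m₀ r₀ L M) {r : ℝ} (hr : 0 ≤ r)
    (hr₀ : 3 / 2 * r ≤ r₀) (ε : κ → ℝ) (b : ι → ℝ)
    (hcontr : 5 * M * L ^ 2 * (3 / 2 * r + wNorm S ε) ≤ 1 / 2)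
    (hδ : wNorm w (lsLinear S (J m₀) ε b) ≤ r / 2) :
    ∃ m, wNorm w (m - m₀) ≤ r ∧ lsGradient S G J m₀ ε b m = 0 ∧
      (∀ m', wNorm w (m' - m₀) ≤ 3 / 2 * r → lsGradient S G J m₀ ε b m' = 0 → m' = m) ∧
      wNorm w (m - m₀) ≤ 2 * wNorm w (lsLinear S (J m₀) ε b) ∧
      wNorm w (m - m₀ - lsLinear S (J m₀) ε b) ≤
        5 * M * L ^ 2 * (wNorm w (m - m₀) + wNorm S ε) * wNorm w (m - m₀) := by
  set T : (ι → ℝ) → ι → ℝ := fun m => m - (gram S (J m₀))⁻¹ *ᵥ lsGradient S G J m₀ ε b m with hT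
  have hTc : ∀ m₁ m₂, wNorm w (m₁ - m₀) ≤ 3 / 2 * r → wNorm w (m₂ - m₀) ≤ 3 / 2 * r →
      wNorm w (T m₁ - T m₂) ≤ 1 / 2 * wNorm w (m₁ - m₂) := fun m₁ m₂ h₁ h₂ =>
    (H.wNorm_newton_sub_le hr₀ ε b h₁ h₂).trans
      (mul_le_mul_of_nonneg_right hcontr (wNorm_nonneg _ _))
  have hTm₀ : T m₀ = m₀ + lsLinear S (J m₀) ε b := newton_center ε b
  have hle : r ≤ 3 / 2 * r := by linarith
  obtain ⟨m, hm, hfix⟩ := exists_fixedPoint_of_contraction H.w_pos hr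
    (fun u v hu hv => hTc u v (hu.trans hle) (hv.trans hle)) (by rwa [hTm₀, add_sub_cancel_left])
  have hm₀ : wNorm w (m₀ - m₀) ≤ 3 / 2 * r := by simpa using hr.trans hle
  have e1 : T m - T m₀ = m - m₀ - lsLinear S (J m₀) ε b := by rw [hfix, hTm₀]; abel
  refine ⟨m, hm, (H.lsGradient_eq_zero_iff ε b m).2 hfix, fun m' hm' h0 => ?_, ?_, ?_⟩
  · have h1 := hTc m' m hm' (hm.trans hle)
    rw [hfix, show T m' = m' from (H.lsGradient_eq_zero_iff ε b m').1 h0] at h1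
    exact sub_eq_zero.1 (eq_zero_of_wNorm_eq_zero H.w_pos
      (le_antisymm (by linarith) (wNorm_nonneg _ _)))
  · have h1 := hTc m m₀ (hm.trans hle) hm₀
    rw [e1] at h1
    have h2 := wNorm_add_le H.w_nonneg (m - m₀ - lsLinear S (J m₀) ε b) (lsLinear S (J m₀) ε b)
    rw [sub_add_cancel] at h2
    linarith
  -- The Lipschitz estimate is used on the ball of radius exactly `‖m - m₀‖`, which makes the bound
  -- quadratic.
  · have h1 := H.wNorm_newton_sub_le ((hm.trans hle).trans hr₀) ε b le_rfl
      (m₂ := m₀) (by simpa using wNorm_nonneg _ _)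
    have h2 : wNorm w (T m - T m₀) ≤ _ := h1
    rwa [e1] at h2

/-- To first order the residual is `J δ - ε` with `δ` the linear estimate, and the part of `J δ`
that comes from `b` cancels against the added term. A Taylor remainder, the nonlinear correction of
`m` and a multiple of the noise remain. For `b = β (ρ; 0)` this measures the distance of the two
dual variables, times `β`. -/
theorem wNorm_residual_le (H : LeastSquaresModel w S G J m₀ r₀ L M) (ε : κ → ℝ) (b m : ι → ℝ)
    (hm : wNorm w (m - m₀) ≤ r₀)
    (hlin : wNorm w (m - m₀ - lsLinear S (J m₀) ε b) ≤
        5 * M * L ^ 2 * (wNorm w (m - m₀) + wNorm S ε) * wNorm w (m - m₀)) :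
    wNorm S (G m - (G m₀ + ε) + J m₀ *ᵥ ((gram S (J m₀))⁻¹ *ᵥ b)) ≤
      L * wNorm w (m - m₀) ^ 2 + 5 * M * L ^ 3 * (wNorm w (m - m₀) + wNorm S ε) *
        wNorm w (m - m₀) + (M * L ^ 2 + 1) * wNorm S ε := by
  have hL := H.L_nonneg
  set a := G m - G m₀ - J m₀ *ᵥ (m - m₀)
  set u := (gram S (J m₀))⁻¹ *ᵥ ((J m₀)ᵀ *ᵥ (S * ε)) with hu
  have e : G m - (G m₀ + ε) + J m₀ *ᵥ ((gram S (J m₀))⁻¹ *ᵥ b) =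
      a + J m₀ *ᵥ (m - m₀ - lsLinear S (J m₀) ε b) + (J m₀ *ᵥ u - ε) := by
    rw [lsLinear, Matrix.mulVec_sub _ ((J m₀)ᵀ *ᵥ (S * ε)) b, ← hu, Matrix.mulVec_sub _ (m - m₀),
      Matrix.mulVec_sub (J m₀) u]
    simp only [a]
    abel
  have h1 := H.taylor_le _ hm m m₀ le_rfl (by simpa using wNorm_nonneg _ _)
  have h2 := (H.deriv_le (m - m₀ - lsLinear S (J m₀) ε b)).trans
    (mul_le_mul_of_nonneg_left hlin hL)
  have h3 : wNorm S (J m₀ *ᵥ u) ≤ L * (M * (L * wNorm S ε)) :=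
    (H.deriv_le u).trans (mul_le_mul_of_nonneg_left ((H.inv_le _).trans
      (mul_le_mul_of_nonneg_left (H.wNorm_inv_transpose_mulVec_le ε) H.M_nonneg)) hL)
  rw [e]
  have h4 := wNorm_add_le H.S_nonneg (a + J m₀ *ᵥ (m - m₀ - lsLinear S (J m₀) ε b))
    (J m₀ *ᵥ u - ε)
  have h5 := wNorm_add_le H.S_nonneg a (J m₀ *ᵥ (m - m₀ - lsLinear S (J m₀) ε b))
  have h6 := wNorm_sub_le H.S_nonneg (J m₀ *ᵥ u) ε
  linarith

end LeastSquaresModel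

/-- `lsLinear` is the unique minimizer of the linearized least squares problem. -/
theorem isMinOn_linearized_iff {S : κ → ℝ} (hS : ∀ i, 0 < S i) {J : Matrix κ ι ℝ}
    (hJ : LinearIndependent ℝ J.col) (ε : κ → ℝ) (b δ : ι → ℝ) :
    IsMinOn (fun δ => 1 / 2 * wNorm S (J *ᵥ δ - ε) ^ 2 + b ⬝ᵥ δ) Set.univ δ ↔
      δ = lsLinear S J ε b := by
  set δ₀ := lsLinear S J ε b with hδ₀
  have hS' : ∀ i, 0 ≤ S i := fun i => (hS i).le
  have hopt : gram S J *ᵥ δ₀ = Jᵀ *ᵥ (S * ε) - b := by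
    rw [hδ₀, lsLinear, Matrix.mulVec_mulVec, Matrix.mul_nonsing_inv _ (isUnit_det_gram hS hJ),
      Matrix.one_mulVec]
  -- Completing the square: the normal equation `hopt` removes the cross term.
  have key : ∀ δ, 1 / 2 * wNorm S (J *ᵥ δ - ε) ^ 2 + b ⬝ᵥ δ =
      (1 / 2 * wNorm S (J *ᵥ δ₀ - ε) ^ 2 + b ⬝ᵥ δ₀) + 1 / 2 * wNorm S (J *ᵥ (δ - δ₀)) ^ 2 := by
    intro δ
    have h1 : b = Jᵀ *ᵥ (S * ε) - Jᵀ *ᵥ (S * (J *ᵥ δ₀)) := by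
      rw [← gram_mulVec, hopt]; abel
    have h2 : b ⬝ᵥ δ - b ⬝ᵥ δ₀ = ∑ i, S i * (ε i - (J *ᵥ δ₀) i) * ((J *ᵥ δ) i - (J *ᵥ δ₀) i) := by
      rw [← dotProduct_sub]
      conv_lhs => rw [h1]
      rw [sub_dotProduct, transpose_mulVec_dotProduct, transpose_mulVec_dotProduct,
        ← Finset.sum_sub_distrib]
      refine Finset.sum_congr rfl fun i _ => ?_
      rw [Matrix.mulVec_sub, Pi.sub_apply]; ring
    have h3 : 1 / 2 * wNorm S (J *ᵥ δ - ε) ^ 2 - 1 / 2 * wNorm S (J *ᵥ δ₀ - ε) ^ 2 -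
        1 / 2 * wNorm S (J *ᵥ (δ - δ₀)) ^ 2 =
        -∑ i, S i * (ε i - (J *ᵥ δ₀) i) * ((J *ᵥ δ) i - (J *ᵥ δ₀) i) := by
      rw [wNorm_sq hS', wNorm_sq hS', wNorm_sq hS', Finset.mul_sum, Finset.mul_sum,
        Finset.mul_sum, ← Finset.sum_sub_distrib, ← Finset.sum_sub_distrib, ← Finset.sum_neg_distrib]
      refine Finset.sum_congr rfl fun i _ => ?_
      rw [Matrix.mulVec_sub]
      simp only [Pi.sub_apply]; ring
    linarith
  constructor
  · intro h
    have h1 := h (Set.mem_univ δ₀)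
    simp only [Set.mem_ofPred_eq] at h1
    rw [key δ] at h1
    have h2 : wNorm S (J *ᵥ (δ - δ₀)) ^ 2 = 0 :=
      le_antisymm (by linarith) (sq_nonneg _)
    have h3 := eq_zero_of_wNorm_eq_zero hS (pow_eq_zero_iff two_ne_zero |>.1 h2)
    exact sub_eq_zero.1 (Matrix.mulVec_injective_iff.2 hJ (by rw [h3, Matrix.mulVec_zero]))
  · rintro rfl δ -
    simp only [Set.mem_ofPred_eq]
    rw [key δ]
    linarith [sq_nonneg (wNorm S (J *ᵥ (δ - lsLinear S J ε b)))]

end GaussNewton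

/-! ### Constants that are uniform over measurement setups -/

noncomputable section LocalConstants

variable {N d : ℕ}

/-- The field `∑ n, q n * κ (y n)` of the parameter `m = (q; y)`. -/
def source (κ : Pt d → ℝ) (m : Idx N d → ℝ) : ℝ := ∑ n, amp m n * κ (locs m n)

/-- The derivative of `source κ` at `m` in direction `v`. -/
def sourceDeriv (κ : Pt d → ℝ) (m v : Idx N d → ℝ) : ℝ :=
  ∑ n, (amp v n * κ (locs m n) + amp m n * fderiv ℝ κ (locs m n) (locs v n))

/-- Radii and a constant that control all point source models near `(q; y)` whose kernels have
three derivatives bounded by `Λ` on `U`. -/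
structure LocalConstants (Λ : ℝ) (U : Set (Pt d)) (q : Fin N → ℝ) (y : Fin N → Pt d)
    (R₀ r₀ L : ℝ) : Prop where
  R₀_pos : 0 < R₀
  r₀_pos : 0 < r₀
  r₀_le : r₀ ≤ 1
  one_le : 1 ≤ L
  ball_subset : ∀ n, Metric.closedBall (y n) (2 * R₀) ⊆ U
  separated : ∀ n n', y n ≠ y n' → 4 * R₀ ≤ ‖y n - y n'‖
  locs_near : ∀ m, wNorm (weight d q) (m - stack q y) ≤ r₀ → ∀ n, ‖locs m n - y n‖ ≤ R₀
  amp_near : ∀ m, wNorm (weight d q) (m - stack q y) ≤ r₀ → ∀ n, |amp m n - q n| ≤ |q n| / 2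
  locs_le : ∀ v n, ‖locs v n‖ ≤ L * wNorm (weight d q) v
  deriv_le : ∀ κ, BoundedC3 Λ U κ → ∀ v,
    |sourceDeriv κ (stack q y) v| ≤ L * wNorm (weight d q) v
  deriv_sub_le : ∀ κ, BoundedC3 Λ U κ → ∀ m₁ m₂, wNorm (weight d q) (m₁ - stack q y) ≤ r₀ →
    wNorm (weight d q) (m₂ - stack q y) ≤ r₀ → ∀ v, |sourceDeriv κ m₁ v - sourceDeriv κ m₂ v| ≤
      L * wNorm (weight d q) (m₁ - m₂) * wNorm (weight d q) v
  taylor_le : ∀ κ, BoundedC3 Λ U κ → ∀ r ≤ r₀, ∀ m₁ m₂,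
    wNorm (weight d q) (m₁ - stack q y) ≤ r → wNorm (weight d q) (m₂ - stack q y) ≤ r →
    |source κ m₁ - source κ m₂ - sourceDeriv κ (stack q y) (m₁ - m₂)| ≤
      L * r * wNorm (weight d q) (m₁ - m₂)

/-- The constants depend on `Λ`, `U`, `q`, `y` and not on the individual kernel `κ`; this makes them
valid for all setups at once. -/
theorem exists_localConstants {Λ : ℝ} (hΛ : 0 ≤ Λ) {U : Set (Pt d)} (hU : IsOpen U)
    {q : Fin N → ℝ} (hq : ∀ n, q n ≠ 0) {y : Fin N → Pt d} (hy : ∀ n, y n ∈ U) :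
    ∃ R₀ r₀ L, LocalConstants Λ U q y R₀ r₀ L := by
  have hR1 : ∀ᶠ R in nhdsWithin (0 : ℝ) (Set.Ioi 0), ∀ n,
      Metric.closedBall (y n) (2 * R) ⊆ U := by
    refine Filter.eventually_all.2 fun n => ?_
    obtain ⟨e, he, hsub⟩ := Metric.isOpen_iff.1 hU (y n) (hy n)
    filter_upwards [Ioo_mem_nhdsGT (half_pos he)] with R hR
    exact (Metric.closedBall_subset_ball (by linarith [hR.2])).trans hsub
  have hR2 : ∀ᶠ R in nhdsWithin (0 : ℝ) (Set.Ioi 0), ∀ n n', y n ≠ y n' →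
      4 * R ≤ ‖y n - y n'‖ := by
    refine Filter.eventually_all.2 fun n => Filter.eventually_all.2 fun n' => ?_
    by_cases h : y n = y n'
    · exact Filter.Eventually.of_forall fun R h' => absurd h h'
    · have : 0 < ‖y n - y n'‖ / 4 := div_pos (norm_pos_iff.2 (sub_ne_zero.2 h)) four_pos
      filter_upwards [Ioo_mem_nhdsGT this] with R hR _
      linarith [hR.2]
  obtain ⟨R₀, hR₀, hball, hsep⟩ := ((eventually_mem_nhdsWithin (α := ℝ)).and (hR1.and hR2)).exists
  have hR₀ : 0 < R₀ := hR₀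
  -- `A` dominates the factors that convert the `W†` norm into amplitudes and locations; `2 * |q n|
  -- ≤ A` also covers amplitudes perturbed by `|q n| / 2`.
  obtain ⟨A, hA1, hA⟩ : ∃ A : ℝ, 1 ≤ A ∧ ∀ n, 2 * √|q n| ≤ A ∧ (√|q n|)⁻¹ ≤ A ∧ 2 * |q n| ≤ A :=
    ((Filter.eventually_ge_atTop (1 : ℝ)).and (Filter.eventually_all.2 fun n =>
      (Filter.eventually_ge_atTop (2 * √|q n|)).and ((Filter.eventually_ge_atTop (√|q n|)⁻¹).and
        (Filter.eventually_ge_atTop (2 * |q n|))))).exists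
  have hr1 : ∀ᶠ r in nhdsWithin (0 : ℝ) (Set.Ioi 0), ∀ n, 2 * √|q n| * r ≤ |q n| / 2 := by
    refine Filter.eventually_all.2 fun n => ?_
    have hn : 0 < |q n| := abs_pos.2 (hq n)
    have hs := Real.sqrt_pos.2 hn
    filter_upwards [Ioo_mem_nhdsGT (show 0 < |q n| / 2 / (2 * √|q n|) by positivity)] with r hr
    have := (lt_div_iff₀ (by positivity)).1 hr.2
    linarith
  obtain ⟨r₀, hr₀, hr₀1, hr₀R, hr₀q⟩ : ∃ r₀ : ℝ, 0 < r₀ ∧ r₀ ≤ 1 ∧ A * r₀ ≤ R₀ ∧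
      ∀ n, 2 * √|q n| * r₀ ≤ |q n| / 2 := by
    have hr2 : ∀ᶠ r in nhdsWithin (0 : ℝ) (Set.Ioi 0), 0 < r ∧ r ≤ 1 ∧ A * r ≤ R₀ := by
      filter_upwards [Ioo_mem_nhdsGT (zero_lt_one (α := ℝ)),
        Ioo_mem_nhdsGT (show 0 < R₀ / A by positivity)] with r h1 h2
      refine ⟨h1.1, h1.2.le, ?_⟩
      have := (lt_div_iff₀ (by positivity)).1 h2.2
      linarith
    obtain ⟨r, ⟨h1, h2, h3⟩, h4⟩ := (hr2.and hr1).exists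
    exact ⟨r, h1, h2, h3, h4⟩
  set w := weight d q with hw
  have ampA : ∀ (v : Idx N d → ℝ) n, |amp v n| ≤ A * wNorm w v := fun v n =>
    (abs_amp_le hq v n).trans (mul_le_mul_of_nonneg_right (hA n).1 (wNorm_nonneg _ _))
  have locA : ∀ (v : Idx N d → ℝ) n, ‖locs v n‖ ≤ A * wNorm w v := fun v n =>
    (norm_locs_le hq v n).trans (mul_le_mul_of_nonneg_right (hA n).2.1 (wNorm_nonneg _ _))
  have locs_near : ∀ r, ∀ m, wNorm w (m - stack q y) ≤ r → ∀ n, ‖locs m n - y n‖ ≤ A * r :=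
    fun r m hm n => (locA (m - stack q y) n).trans (by gcongr)
  have amp_near : ∀ m, wNorm w (m - stack q y) ≤ r₀ → ∀ n, |amp m n - q n| ≤ |q n| / 2 :=
    fun m hm n => (abs_amp_le hq (m - stack q y) n).trans (le_trans (by gcongr) (hr₀q n))
  have ampQ : ∀ m, wNorm w (m - stack q y) ≤ r₀ → ∀ n, |amp m n| ≤ A := fun m hm n => by
    have h1 := amp_near m hm n
    have h2 := abs_sub_abs_le_abs_sub (amp m n) (q n)
    linarith [(hA n).2.2, abs_nonneg (q n)]
  -- The polynomial `A² (2 + A)` majorizes all three single-source estimates below; the factor `N`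
  -- comes from summing over the sources.
  have hconst : ∀ B : ℝ, 0 ≤ B → N * (Λ * (A ^ 2 * (2 + A) * B)) ≤
      (A + N * Λ * A ^ 2 * (2 + A)) * B := fun B hB => by nlinarith
  have hball' : ∀ n, Metric.closedBall (y n) R₀ ⊆ U := fun n =>
    (Metric.closedBall_subset_closedBall (by linarith)).trans (hball n)
  refine ⟨R₀, r₀, A + N * Λ * A ^ 2 * (2 + A), hR₀, hr₀, hr₀1, ?_, hball, hsep,
    fun m hm n => (locs_near _ m hm n).trans hr₀R, amp_near, fun v n => (locA v n).trans ?_,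
    fun κ hκ v => ?_, fun κ hκ m₁ m₂ h₁ h₂ v => ?_, fun κ hκ r hr m₁ m₂ h₁ h₂ => ?_⟩
  · have : 0 ≤ N * Λ * A ^ 2 * (2 + A) := by positivity
    linarith
  · refine mul_le_mul_of_nonneg_right ?_ (wNorm_nonneg _ _)
    have : 0 ≤ N * Λ * A ^ 2 * (2 + A) := by positivity
    linarith
  · refine (sum_le_card_mul fun n => ?_).trans (hconst _ (wNorm_nonneg w v))
    refine (hκ.abs_source_deriv_le (hy n) _ _).trans (mul_le_mul_of_nonneg_left ?_ hΛ)
    have h1 := ampA v n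
    have h2 := locA v n
    have h3 := wNorm_nonneg w v
    have h4 : |q n| ≤ A := by linarith [(hA n).2.2, abs_nonneg (q n)]
    calc |amp v n| + |q n| * ‖locs v n‖ ≤ A * wNorm w v + A * (A * wNorm w v) := by gcongr
      _ = (A * 1 + A ^ 2) * wNorm w v := by ring
      _ ≤ (A ^ 2 * (2 + A)) * wNorm w v := by
        refine mul_le_mul_of_nonneg_right ?_ h3
        nlinarith [sq_nonneg A]
  · rw [sourceDeriv, sourceDeriv, ← Finset.sum_sub_distrib, mul_assoc]
    refine (sum_le_card_mul fun n => ?_).trans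
      (hconst _ (mul_nonneg (wNorm_nonneg w (m₁ - m₂)) (wNorm_nonneg w v)))
    refine (hκ.abs_source_deriv_sub_le (convex_closedBall (y n) R₀) (hball' n)
      (mem_closedBall_iff_norm.2 ((locs_near _ _ h₁ n).trans hr₀R))
      (mem_closedBall_iff_norm.2 ((locs_near _ _ h₂ n).trans hr₀R)) _ _ _).trans
        (mul_le_mul_of_nonneg_left ?_ hΛ)
    have h1 := ampA v n
    have h2 := locA v n
    have h3 := ampA (m₁ - m₂) n
    have h4 := locA (m₁ - m₂) n
    rw [amp_sub] at h3
    rw [locs_sub] at h4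
    have h5 := ampQ m₂ h₂ n
    have h6 := wNorm_nonneg w v
    have h7 := wNorm_nonneg w (m₁ - m₂)
    calc _ ≤ A * wNorm w v * (A * wNorm w (m₁ - m₂)) + A * wNorm w (m₁ - m₂) * (A * wNorm w v) +
          A * (A * wNorm w (m₁ - m₂)) * (A * wNorm w v) := by gcongr
      _ = _ := by ring
  · rw [source, source, sourceDeriv, ← Finset.sum_sub_distrib, ← Finset.sum_sub_distrib, mul_assoc]
    have hr0 : 0 ≤ r := (wNorm_nonneg _ _).trans h₁
    refine (sum_le_card_mul fun n => ?_).trans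
      (hconst _ (mul_nonneg hr0 (wNorm_nonneg w (m₁ - m₂))))
    have hsub : Metric.closedBall (y n) (A * r) ⊆ U :=
      (Metric.closedBall_subset_closedBall (le_trans (by gcongr) hr₀R)).trans (hball' n)
    refine (hκ.abs_source_sub_sub_le hsub (locs_near r _ h₁ n) (locs_near r _ h₂ n)
      (q n) _ _).trans (mul_le_mul_of_nonneg_left ?_ hΛ)
    have h3 := ampA (m₁ - m₂) n
    have h4 := locA (m₁ - m₂) n
    rw [amp_sub] at h3
    rw [locs_sub] at h4
    have h5 := ampQ m₂ (h₂.trans hr) n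
    have h7 := wNorm_nonneg w (m₁ - m₂)
    have h8 : |amp m₂ n - q n| ≤ A * r := (ampA (m₂ - stack q y) n).trans (by gcongr)
    calc _ ≤ A * wNorm w (m₁ - m₂) * (A * r) + A * (A * r) * (A * wNorm w (m₁ - m₂)) +
          A * r * (A * wNorm w (m₁ - m₂)) := by gcongr
      _ = _ := by ring

variable {p No : ℕ} {Λ : ℝ} {U : Set (Pt d)} {q : Fin N → ℝ} {y : Fin N → Pt d} {R₀ r₀ L : ℝ}

theorem jac_mulVec_eq_sourceDeriv (k : Pt p → Pt d → ℝ) (x : Fin No → Pt p) (m v : Idx N d → ℝ)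
    (j : Fin No) : (jac k x (amp m) (locs m) *ᵥ v) j = sourceDeriv (k (x j)) m v :=
  jac_mulVec_apply k x (amp m) (locs m) v j

/-- Each row of the model is the field of one kernel `k (x j)`, and the weights `(s j)⁻¹` have sum
one. The maximum `max M 1` provides a positive constant. -/
theorem LocalConstants.leastSquaresModel (H : LocalConstants Λ U q y R₀ r₀ L)
    (hq : ∀ n, q n ≠ 0) {k : Pt p → Pt d → ℝ} {x : Fin No → Pt p}
    (hk : ∀ j, BoundedC3 Λ U (k (x j))) {s : Fin No → ℝ} (hs : ∀ j, 0 < s j)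
    (hs1 : ∑ j, (s j)⁻¹ = 1) (hinj : LinearIndependent ℝ (jac k x q y).col) {M : ℝ}
    (hM : wOpNorm (weight d q)⁻¹ (weight d q) (fisher k x s q y)⁻¹ ≤ M) :
    LeastSquaresModel (weight d q) s⁻¹ (fun m => obs k x (amp m) (locs m))
      (fun m => jac k x (amp m) (locs m)) (stack q y) r₀ L (max M 1) := by
  have hS : ∀ j, 0 < s⁻¹ j := fun j => inv_pos.2 (hs j)
  have hS' : ∀ j, 0 ≤ s⁻¹ j := fun j => (hS j).le
  have hS1 : ∑ j, s⁻¹ j ≤ 1 := hs1.le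
  have hw : ∀ a, 0 < weight d q a := weight_pos hq
  have hL : 0 ≤ L := zero_le_one.trans H.one_le
  refine ⟨hw, hS, H.one_le, zero_le_one.trans (le_max_right _ _), H.r₀_le, fun v => ?_,
    fun m₁ m₂ h₁ h₂ v => ?_, fun r hr m₁ m₂ h₁ h₂ => ?_, hinj, fun u => ?_⟩
  · refine wNorm_le_of_forall_abs_le hS' hS1 (mul_nonneg hL (wNorm_nonneg _ _)) fun j => ?_
    rw [jac_mulVec_eq_sourceDeriv]
    exact H.deriv_le _ (hk j) v
  · refine wNorm_le_of_forall_abs_le hS' hS1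
      (mul_nonneg (mul_nonneg hL (wNorm_nonneg _ _)) (wNorm_nonneg _ _)) fun j => ?_
    rw [Pi.sub_apply, jac_mulVec_eq_sourceDeriv, jac_mulVec_eq_sourceDeriv]
    exact H.deriv_sub_le _ (hk j) m₁ m₂ h₁ h₂ v
  · refine wNorm_le_of_forall_abs_le hS' hS1
      (mul_nonneg (mul_nonneg hL ((wNorm_nonneg _ _).trans h₁)) (wNorm_nonneg _ _)) fun j => ?_
    rw [Pi.sub_apply, Pi.sub_apply, jac_mulVec_eq_sourceDeriv]
    exact H.taylor_le _ (hk j) r hr m₁ m₂ h₁ h₂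
  · refine (wNorm_mulVec_le (fun a => inv_pos.2 (hw a)) _ u).trans
      (mul_le_mul_of_nonneg_right (hM.trans (le_max_left _ _)) (wNorm_nonneg _ _))

end LocalConstants

/-! ### Sparse signed measures, total variation and pairing -/

noncomputable section SparseMeasures

variable {X : Type*} [MeasurableSpace X] {N : ℕ}

/-- The positive measure `∑ n, max (a n) 0 • δ_{u n}`. -/
def posSparse (a : Fin N → ℝ) (u : Fin N → X) : Measure X :=
  ∑ n, ENNReal.ofReal (a n) • Measure.dirac (u n)

theorem posSparse_apply (a : Fin N → ℝ) (u : Fin N → X) {i : Set X} (hi : MeasurableSet i) :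
    posSparse a u i = ∑ n, ENNReal.ofReal (a n) * i.indicator 1 (u n) := by
  simp [posSparse, Measure.finsetSum_apply, Measure.dirac_apply' _ hi]

instance (a : Fin N → ℝ) (u : Fin N → X) : IsFiniteMeasure (posSparse a u) := by
  refine ⟨?_⟩
  rw [posSparse_apply a u MeasurableSet.univ]
  exact ENNReal.sum_lt_top.2 fun n _ => by simp

theorem posSparse_real_apply (a : Fin N → ℝ) (u : Fin N → X) {i : Set X} (hi : MeasurableSet i) :
    (posSparse a u).real i = ∑ n, max (a n) 0 * i.indicator 1 (u n) := by
  rw [Measure.real, posSparse_apply a u hi, ENNReal.toReal_sum fun n _ => ?_]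
  · refine Finset.sum_congr rfl fun n _ => ?_
    rw [ENNReal.toReal_mul, ENNReal.toReal_ofReal']
    congr 1
    by_cases h : u n ∈ i <;> simp [h]
  · by_cases h : u n ∈ i <;> simp [h]

theorem sparse_apply (q : Fin N → ℝ) (y : Fin N → X) {i : Set X} (hi : MeasurableSet i) :
    sparse q y i = ∑ n, q n * i.indicator 1 (y n) := by
  rw [sparse, FunLike.coe_sum, Finset.sum_apply]
  refine Finset.sum_congr rfl fun n _ => ?_
  rw [smul_apply, Measure.toSignedMeasure_apply_measurable hi, smul_eq_mul,
    Measure.real, Measure.dirac_apply' _ hi]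
  congr 1
  by_cases h : y n ∈ i <;> simp [h]

theorem posSparse_mutuallySingular [MeasurableSingletonClass X] (q : Fin N → ℝ) {y : Fin N → X}
    (hy : Function.Injective y) : posSparse q y ⟂ₘ posSparse (-q) y := by
  refine ⟨y '' {n | q n ≤ 0}, (Set.toFinite _).measurableSet, ?_, ?_⟩
  · rw [posSparse_apply _ _ (Set.toFinite _).measurableSet]
    refine Finset.sum_eq_zero fun n _ => ?_
    rcases le_or_gt (q n) 0 with h | h
    · simp [ENNReal.ofReal_of_nonpos h]
    · rw [Set.indicator_of_notMem, mul_zero]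
      rintro ⟨n', hn', he⟩
      rw [hy he] at hn'
      exact absurd hn' (not_le.2 h)
  · rw [posSparse_apply _ _ (Set.toFinite _).measurableSet.compl]
    refine Finset.sum_eq_zero fun n _ => ?_
    rcases le_or_gt (q n) 0 with h | h
    · rw [Set.indicator_of_notMem, mul_zero]
      exact fun hn => hn ⟨n, h, rfl⟩
    · simp [ENNReal.ofReal_of_nonpos (neg_nonpos.2 h.le)]

/-- Uniqueness of the Jordan decomposition: the atoms are distinct, so the two candidate parts are
mutually singular. -/
theorem toJordanDecomposition_sparse [MeasurableSingletonClass X] (q : Fin N → ℝ) {y : Fin N → X}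
    (hy : Function.Injective y) : (sparse q y).toJordanDecomposition =
      ⟨posSparse q y, posSparse (-q) y, posSparse_mutuallySingular q hy⟩ := by
  refine SignedMeasure.toJordanDecomposition_eq (VectorMeasure.ext fun i hi => ?_)
  rw [JordanDecomposition.toSignedMeasure, Measure.toSignedMeasure_sub_apply hi, sparse_apply q y hi,
    posSparse_real_apply _ _ hi, posSparse_real_apply _ _ hi, ← Finset.sum_sub_distrib]
  refine Finset.sum_congr rfl fun n _ => ?_
  rw [← sub_mul, Pi.neg_apply]
  congr 1
  exact (max_zero_sub_max_neg_zero_eq_self (q n)).symm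

theorem tvNorm_sparse [MeasurableSingletonClass X] (q : Fin N → ℝ) {y : Fin N → X}
    (hy : Function.Injective y) : tvNorm (sparse q y) = ∑ n, |q n| := by
  rw [tvNorm, SignedMeasure.totalVariation, toJordanDecomposition_sparse q hy]
  change (posSparse q y + posSparse (-q) y).real Set.univ = _
  rw [measureReal_add_apply, posSparse_real_apply _ _ MeasurableSet.univ,
    posSparse_real_apply _ _ MeasurableSet.univ, ← Finset.sum_add_distrib]
  refine Finset.sum_congr rfl fun n _ => ?_
  simp only [Set.indicator_univ, Pi.one_apply, mul_one, Pi.neg_apply]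
  rcases le_total (q n) 0 with h | h
  · rw [max_eq_right h, max_eq_left (neg_nonneg.2 h), abs_of_nonpos h, zero_add]
  · rw [max_eq_left h, max_eq_right (neg_nonpos.2 h), abs_of_nonneg h, add_zero]

theorem integral_sparse [MeasurableSingletonClass X] (f : X → ℝ) (q : Fin N → ℝ) (y : Fin N → X) :
    ∫ᵛ z, f z ∂<•(sparse q y) = ∑ n, q n * f (y n) := by
  have hint : ∀ n, ((Measure.dirac (y n)).toSignedMeasure : SignedMeasure X).Integrable f := by
    intro n
    rw [VectorMeasure.Integrable, Measure.variation_toSignedMeasure]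
    exact integrable_dirac (by simp)
  rw [sparse, VectorMeasure.integral_finsetSum_vectorMeasure
    fun n _ => (hint n).smul_vectorMeasure (q n)]
  refine Finset.sum_congr rfl fun n _ => ?_
  rw [VectorMeasure.integral_smul_vectorMeasure, VectorMeasure.integral_toSignedMeasure,
    integral_dirac, smul_eq_mul]

instance (μ : SignedMeasure X) : IsFiniteMeasure μ.variation := by
  rw [← SignedMeasure.totalVariation_eq_variation]; infer_instance

theorem tvNorm_eq (μ : SignedMeasure X) : tvNorm μ = μ.variation.real Set.univ := by
  rw [tvNorm, SignedMeasure.totalVariation_eq_variation]; rfl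

theorem integral_le_integral_abs (μ : SignedMeasure X) (f : X → ℝ) :
    ∫ᵛ z, f z ∂<•μ ≤ ∫ z, |f z| ∂μ.variation := by
  refine (Real.le_norm_self _).trans (VectorMeasure.norm_integral_le_integral_norm.trans ?_)
  have : ‖(ContinuousLinearMap.lsmul ℝ ℝ : ℝ →L[ℝ] ℝ →L[ℝ] ℝ).flip‖ ≤ 1 := by
    rw [ContinuousLinearMap.opNorm_flip]
    exact ContinuousLinearMap.opNorm_lsmul_le
  refine (mul_le_mul_of_nonneg_right this (integral_nonneg fun z => norm_nonneg _)).trans ?_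
  rw [one_mul]; rfl

theorem integral_le_tvNorm (μ : SignedMeasure X) {f : X → ℝ} (hf : Integrable f μ.variation)
    (h1 : ∀ z, |f z| ≤ 1) : ∫ᵛ z, f z ∂<•μ ≤ tvNorm μ := by
  refine (integral_le_integral_abs μ f).trans ?_
  rw [tvNorm_eq]
  refine (integral_mono hf.abs (integrable_const 1) h1).trans ?_
  simp

/-- Equality in the duality bound forces the nonnegative function `1 - |f|` to have zero integral.
-/
theorem ae_abs_eq_one_of_tvNorm_le (μ : SignedMeasure X) {f : X → ℝ}
    (hf : Integrable f μ.variation) (h1 : ∀ z, |f z| ≤ 1) (h : tvNorm μ ≤ ∫ᵛ z, f z ∂<•μ) :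
    ∀ᵐ z ∂μ.variation, |f z| = 1 := by
  have h2 : ∫ z, (1 - |f z|) ∂μ.variation = 0 := by
    refine le_antisymm ?_ (integral_nonneg fun z => sub_nonneg.2 (h1 z))
    rw [integral_sub (integrable_const 1) hf.abs]
    have := integral_le_integral_abs μ f
    rw [tvNorm_eq] at h
    simp only [integral_const, smul_eq_mul, mul_one]
    linarith
  rw [integral_eq_zero_iff_of_nonneg (fun z => sub_nonneg.2 (h1 z))
    ((integrable_const 1).sub hf.abs)] at h2
  filter_upwards [h2] with z hz
  have : 1 - |f z| = 0 := hz
  linarith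

theorem eq_sparse_of_ae_mem_range [MeasurableSingletonClass X] (μ : SignedMeasure X)
    {y : Fin N → X} (hy : Function.Injective y) (h : ∀ᵐ z ∂μ.variation, z ∈ Set.range y) :
    μ = sparse (fun n => μ {y n}) y := by
  have hF : MeasurableSet (Set.range y) := (Set.finite_range y).measurableSet
  refine VectorMeasure.ext fun i hi => ?_
  have h0 : μ (i \ Set.range y) = 0 := by
    have h1 : μ.variation (i \ Set.range y) = 0 :=
      measure_mono_null (fun z hz => hz.2) h
    have h2 := VectorMeasure.enorm_measure_le_variation μ (i \ Set.range y)
    rw [h1] at h2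
    simpa using h2
  classical
  have h1 : i = (i \ Set.range y) ∪ ⋃ n ∈ Finset.univ.filter (fun n => y n ∈ i), {y n} := by
    ext z
    simp only [Set.mem_union, Set.mem_sdiff, Set.mem_range, Set.mem_iUnion, Finset.mem_filter,
      Finset.mem_univ, true_and, Set.mem_singleton_iff, exists_prop]
    constructor
    · intro hz
      by_cases hr : ∃ n, y n = z
      · obtain ⟨n, rfl⟩ := hr
        exact Or.inr ⟨n, hz, rfl⟩
      · exact Or.inl ⟨hz, hr⟩
    · rintro (hz | ⟨n, hn, rfl⟩)
      exacts [hz.1, hn]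
  have h2 : Disjoint (i \ Set.range y) (⋃ n ∈ Finset.univ.filter (fun n => y n ∈ i), {y n}) := by
    rw [Set.disjoint_left]
    rintro z hz hz'
    simp only [Set.mem_iUnion, Set.mem_singleton_iff] at hz'
    obtain ⟨n, -, rfl⟩ := hz'
    exact hz.2 ⟨n, rfl⟩
  rw [sparse_apply _ _ hi]
  conv_lhs => rw [h1]
  rw [VectorMeasure.of_union h2 (hi.diff hF)
      (Finset.measurableSet_biUnion _ fun n _ => measurableSet_singleton _), h0, zero_add,
    VectorMeasure.of_biUnion_finset (fun n _ n' _ hn => by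
      simpa [Function.onFun] using fun h => hn (hy h)) (fun n _ => measurableSet_singleton _),
    Finset.sum_filter]
  refine Finset.sum_congr rfl fun n _ => ?_
  by_cases h : y n ∈ i <;> simp [h]

end SparseMeasures

/-! ### Optimality for the Tikhonov problem through a dual certificate -/

noncomputable section Tikhonov

variable {p d No N : ℕ} {Ωs : Set (Pt d)} {k : Pt p → Pt d → ℝ} {x : Fin No → Pt p}

theorem forwardOp_sparse (q : Fin N → ℝ) (y : Fin N → Ωs) :
    forwardOp k x (sparse q y) = obs k x q (fun n => (y n).1) := by
  funext j
  exact integral_sparse (fun z : Ωs => k (x j) z) q y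

theorem integrable_of_continuousOn (hΩs : IsCompact Ωs) {f : Pt d → ℝ} (hf : ContinuousOn f Ωs)
    (μ : Measure Ωs) [IsFiniteMeasure μ] : Integrable (fun z : Ωs => f z) μ := by
  have hc : Continuous (fun z : Ωs => f z) := continuousOn_iff_continuous_domRestrict.1 hf
  obtain ⟨C, hC⟩ := hΩs.exists_bound_of_continuousOn hf
  exact Integrable.of_bound hc.aestronglyMeasurable C (Filter.Eventually.of_forall fun z => hC z z.2)

theorem continuousOn_adjointOp (hk : ∀ j, ContinuousOn (k (x j)) Ωs) (z : Fin No → ℝ) :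
    ContinuousOn (adjointOp k x z) Ωs :=
  continuousOn_finsetSum _ fun j _ => continuousOn_const.mul (hk j)

theorem integral_adjointOp (hΩs : IsCompact Ωs) (hk : ∀ j, ContinuousOn (k (x j)) Ωs)
    (z : Fin No → ℝ) (μ : SignedMeasure Ωs) :
    ∫ᵛ y : Ωs, adjointOp k x z y ∂<•μ = ∑ j, z j * forwardOp k x μ j := by
  have : ∫ᵛ y : Ωs, adjointOp k x z y ∂<•μ = ∫ᵛ y : Ωs, ∑ j, z j • k (x j) y ∂<•μ := rfl
  rw [this, VectorMeasure.integral_finsetSum]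
  · refine Finset.sum_congr rfl fun j _ => ?_
    rw [VectorMeasure.integral_fun_smul]; rfl
  · intro j _
    exact (integrable_of_continuousOn hΩs (hk j) _).smul (z j)

/-- A sparse measure whose certificate is strictly below one off the support is the only solution
of the Tikhonov problem, provided the observation determines the amplitudes. -/
theorem isMinOn_tikhonov_iff (hΩs : IsCompact Ωs) (hk : ∀ j, ContinuousOn (k (x j)) Ωs)
    {s : Fin No → ℝ} (hs : ∀ j, 0 < s j) {β : ℝ} (hβ : 0 < β) {z ζ : Fin No → ℝ} {q : Fin N → ℝ}
    {y : Fin N → Ωs} (hy : Function.Injective y)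
    (hζ : β • ζ = z - forwardOp k x (sparse q y))
    (hsign : ∀ n, q n * certificate k x s ζ (y n) = |q n|)
    (hle : ∀ u : Ωs, |certificate k x s ζ u| ≤ 1)
    (hlt : ∀ u : Ωs, u ∉ Set.range y → |certificate k x s ζ u| < 1)
    (hinj : ∀ c, forwardOp k x (sparse c y) = forwardOp k x (sparse q y) → c = q)
    (μ : SignedMeasure Ωs) :
    IsMinOn (tikhonov k x s β z) Set.univ μ ↔ μ = sparse q y := by
  have hS : ∀ j, 0 < s⁻¹ j := fun j => inv_pos.2 (hs j)
  have hS' : ∀ j, 0 ≤ s⁻¹ j := fun j => (hS j).le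
  have hcont : ContinuousOn (certificate k x s ζ) Ωs := continuousOn_adjointOp hk _
  have hint : ∀ μ : SignedMeasure Ωs,
      Integrable (fun u : Ωs => certificate k x s ζ u) μ.variation := fun μ =>
    integrable_of_continuousOn hΩs hcont _
  have htv : tvNorm (sparse q y) = ∫ᵛ u : Ωs, certificate k x s ζ u ∂<•(sparse q y) := by
    rw [tvNorm_sparse q hy, integral_sparse (fun u : Ωs => certificate k x s ζ u)]
    exact Finset.sum_congr rfl fun n _ => (hsign n).symm
  -- The excess over the candidate is half the squared distance of the observations plus `β` times a
  -- duality gap, both nonnegative. A minimizer makes both vanish: a zero gap puts it on the points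
  -- `y`, and equal observations then fix its amplitudes by `hinj`.
  have key : ∀ μ, tikhonov k x s β z μ = tikhonov k x s β z (sparse q y) +
      1 / 2 * wNorm s⁻¹ (forwardOp k x μ - forwardOp k x (sparse q y)) ^ 2 +
      β * (tvNorm μ - ∫ᵛ u : Ωs, certificate k x s ζ u ∂<•μ) := by
    intro μ
    have h1 : ∫ᵛ u : Ωs, certificate k x s ζ u ∂<•μ -
        ∫ᵛ u : Ωs, certificate k x s ζ u ∂<•(sparse q y) =
        ∑ j, s⁻¹ j * ζ j * (forwardOp k x μ j - forwardOp k x (sparse q y) j) := by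
      simp only [certificate]
      rw [integral_adjointOp hΩs hk, integral_adjointOp hΩs hk, ← Finset.sum_sub_distrib]
      refine Finset.sum_congr rfl fun j _ => ?_
      rw [Pi.mul_apply]; ring
    have h2 : 1 / 2 * wNorm s⁻¹ (forwardOp k x μ - z) ^ 2 =
        1 / 2 * wNorm s⁻¹ (forwardOp k x (sparse q y) - z) ^ 2 +
        1 / 2 * wNorm s⁻¹ (forwardOp k x μ - forwardOp k x (sparse q y)) ^ 2 -
        β * ∑ j, s⁻¹ j * ζ j * (forwardOp k x μ j - forwardOp k x (sparse q y) j) := by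
      rw [wNorm_sq hS', wNorm_sq hS', wNorm_sq hS', Finset.mul_sum, Finset.mul_sum,
        Finset.mul_sum, Finset.mul_sum, ← Finset.sum_add_distrib, ← Finset.sum_sub_distrib]
      refine Finset.sum_congr rfl fun j _ => ?_
      have h3 : z j = β * ζ j + forwardOp k x (sparse q y) j := by
        have := congrFun hζ j
        simp only [Pi.smul_apply, smul_eq_mul, Pi.sub_apply] at this
        linarith
      simp only [Pi.sub_apply]
      rw [h3]; ring
    rw [tikhonov, tikhonov, h2, htv, ← h1]
    ring
  have hnn : ∀ μ : SignedMeasure Ωs, 0 ≤ tvNorm μ - ∫ᵛ u : Ωs, certificate k x s ζ u ∂<•μ :=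
    fun μ => sub_nonneg.2 (integral_le_tvNorm μ (hint μ) hle)
  constructor
  · intro h
    have h1 : tikhonov k x s β z μ ≤ tikhonov k x s β z (sparse q y) := h (Set.mem_univ _)
    rw [key μ] at h1
    have h2 := sq_nonneg (wNorm s⁻¹ (forwardOp k x μ - forwardOp k x (sparse q y)))
    have h3 := mul_nonneg hβ.le (hnn μ)
    have h4 : wNorm s⁻¹ (forwardOp k x μ - forwardOp k x (sparse q y)) ^ 2 = 0 := by linarith
    have h5 : tvNorm μ ≤ ∫ᵛ u : Ωs, certificate k x s ζ u ∂<•μ := by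
      by_contra! hcon
      have := mul_pos hβ (sub_pos.2 hcon)
      linarith
    have h6 : μ = sparse (fun n => μ {y n}) y := by
      refine eq_sparse_of_ae_mem_range μ hy ?_
      filter_upwards [ae_abs_eq_one_of_tvNorm_le μ (hint μ) hle h5] with u hu
      by_contra hcon
      exact (hlt u hcon).ne hu
    have h7 := sub_eq_zero.1 (eq_zero_of_wNorm_eq_zero hS (pow_eq_zero_iff two_ne_zero |>.1 h4))
    rw [h6] at h7
    rw [h6, hinj _ h7]
  · rintro rfl ν -
    simp only [Set.mem_ofPred_eq]
    rw [key ν]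
    have h2 := sq_nonneg (wNorm s⁻¹ (forwardOp k x ν - forwardOp k x (sparse q y)))
    have h3 := mul_nonneg hβ.le (hnn ν)
    linarith

end Tikhonov

/-! ### Upper bounds for the Hellinger–Kantorovich distance -/

noncomputable section HellingerKantorovich

theorem coneDistSq_le {X : Type*} [MetricSpace X] (a b : ℝ≥0 × X) :
    coneDistSq a b ≤ ((a.1 : ℝ) - b.1) ^ 2 + a.1 * b.1 * dist a.2 b.2 ^ 2 := by
  have h0 : 0 ≤ min (dist a.2 b.2 / 2) (Real.pi / 2) := le_min (by positivity) (by positivity)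
  have h1 : Real.sin (min (dist a.2 b.2 / 2) (Real.pi / 2)) ^ 2 ≤ (dist a.2 b.2 / 2) ^ 2 := by
    refine sq_le_sq' ?_ ((Real.sin_le h0).trans (min_le_left _ _))
    have := Real.sin_nonneg_of_nonneg_of_le_pi h0
      ((min_le_right _ _).trans (by linarith [Real.pi_pos]))
    have h2 : 0 ≤ dist a.2 b.2 := dist_nonneg
    linarith
  have h2 : (0 : ℝ) ≤ 4 * a.1 * b.1 := by positivity
  have h3 := mul_le_mul_of_nonneg_left h1 h2
  rw [coneDistSq]
  linarith

section Uniform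

variable {Y Z ι : Type*} [MeasurableSpace Y] [MeasurableSpace Z] [Fintype ι]

/-- The uniform measure on the points `t i`, counted with multiplicity. -/
def uniformOn (t : ι → Y) : Measure Y := ∑ i, ((Fintype.card ι : ℝ≥0∞)⁻¹) • Measure.dirac (t i)

theorem map_uniformOn (t : ι → Y) {f : Y → Z} (hf : Measurable f) :
    (uniformOn t).map f = uniformOn (f ∘ t) := by
  ext i hi
  rw [Measure.map_apply hf hi]
  simp [uniformOn, Measure.finsetSum_apply, Measure.dirac_apply' _ hi,
    Measure.dirac_apply' _ (hf hi), Set.indicator]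
  rfl

theorem lintegral_uniformOn [MeasurableSingletonClass Y] (t : ι → Y) (f : Y → ℝ≥0∞) :
    ∫⁻ z, f z ∂uniformOn t = ∑ i, (Fintype.card ι : ℝ≥0∞)⁻¹ * f (t i) := by
  rw [uniformOn, lintegral_finsetSum_measure]
  refine Finset.sum_congr rfl fun i _ => ?_
  rw [lintegral_smul_measure, lintegral_dirac, smul_eq_mul]

instance [Nonempty ι] (t : ι → Y) : IsProbabilityMeasure (uniformOn t) := by
  refine ⟨?_⟩
  simp [uniformOn, Measure.finsetSum_apply, ENNReal.mul_inv_cancel]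

variable {X : Type*} [MeasurableSpace X]

/-- Lifts must be probability measures while the masses are arbitrary. Each atom gets probability `1
/ card ι`, and the radius `√(card ι * a i)` restores its mass `a i`. -/
theorem isLift_uniformOn [MeasurableSingletonClass X] [Nonempty ι] (a : ι → ℝ) (u : ι → X) :
    IsLift (∑ i, ENNReal.ofReal (a i) • Measure.dirac (u i))
      (uniformOn fun i => ((NNReal.sqrt (Fintype.card ι * (a i).toNNReal), u i) : ℝ≥0 × X)) := by
  have hc : (Fintype.card ι : ℝ≥0∞) ≠ 0 := by simp
  have hmul : ∀ i, (Fintype.card ι : ℝ≥0∞)⁻¹ *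
      ((NNReal.sqrt (Fintype.card ι * (a i).toNNReal) : ℝ≥0) : ℝ≥0∞) ^ 2 = ENNReal.ofReal (a i) := by
    intro i
    rw [← ENNReal.coe_pow, NNReal.sq_sqrt, ENNReal.coe_mul, ENNReal.coe_natCast, ← mul_assoc,
      ENNReal.inv_mul_cancel hc (by simp), one_mul, ENNReal.ofReal]
  refine ⟨inferInstance, ?_, ?_⟩
  · rw [lintegral_uniformOn]
    refine ENNReal.sum_lt_top.2 fun i _ => ?_
    rw [hmul]
    exact ENNReal.ofReal_lt_top
  · ext s hs
    have hs' : MeasurableSet (Prod.snd ⁻¹' s : Set (ℝ≥0 × X)) := measurable_snd hs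
    rw [homMarginal, Measure.map_apply measurable_snd hs, withDensity_apply _ hs',
      ← lintegral_indicator hs', lintegral_uniformOn, Measure.finsetSum_apply]
    refine Finset.sum_congr rfl fun i _ => ?_
    rw [Measure.smul_apply, Measure.dirac_apply' _ hs, smul_eq_mul]
    by_cases h : u i ∈ s
    · simp [h, hmul]
    · simp [h]

/-- The coupling matches the atoms index by index. The squared cone metric is two-homogeneous in the
radii, so the factor `card ι` cancels. -/
theorem hkPos_sq_le_sum {X : Type*} [MetricSpace X] [MeasurableSpace X]
    [MeasurableSingletonClass X] [Nonempty ι] (a b : ι → ℝ) (u v : ι → X) (ha : ∀ i, 0 ≤ a i)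
    (hb : ∀ i, 0 ≤ b i) :
    hkPos (∑ i, ENNReal.ofReal (a i) • Measure.dirac (u i))
      (∑ i, ENNReal.ofReal (b i) • Measure.dirac (v i)) ^ 2 ≤
      ENNReal.ofReal (∑ i, ((√(a i) - √(b i)) ^ 2 + √(a i) * √(b i) * dist (u i) (v i) ^ 2)) := by
  rw [hkPos, ← ENNReal.rpow_natCast, ← ENNReal.rpow_mul]
  norm_num
  refine (iInf₂_le _ (isLift_uniformOn a u)).trans ((iInf₂_le _ (isLift_uniformOn b v)).trans ?_)
  rw [coneW2Sq]
  refine (iInf₂_le (uniformOn fun i =>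
    (((NNReal.sqrt (Fintype.card ι * (a i).toNNReal), u i),
      (NNReal.sqrt (Fintype.card ι * (b i).toNNReal), v i)) : (ℝ≥0 × X) × (ℝ≥0 × X)))
    ⟨map_uniformOn _ measurable_fst, map_uniformOn _ measurable_snd⟩).trans ?_
  rw [lintegral_uniformOn, ENNReal.ofReal_sum_of_nonneg fun i _ => by positivity]
  refine Finset.sum_le_sum fun i _ => ?_
  have hc : (Fintype.card ι : ℝ≥0∞) ≠ 0 := by simp
  rw [mul_comm, ← div_eq_mul_inv]
  refine ENNReal.div_le_of_le_mul ?_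
  rw [← ENNReal.ofReal_natCast, ← ENNReal.ofReal_mul (by positivity)]
  refine ENNReal.ofReal_le_ofReal ((coneDistSq_le _ _).trans (le_of_eq ?_))
  simp only [Real.coe_sqrt, NNReal.coe_mul, NNReal.coe_natCast, Real.coe_toNNReal _ (ha i),
    Real.coe_toNNReal _ (hb i)]
  rw [Real.sqrt_mul (Nat.cast_nonneg _) (a i), Real.sqrt_mul (Nat.cast_nonneg _) (b i)]
  have := Real.sq_sqrt (Nat.cast_nonneg (α := ℝ) (Fintype.card ι))
  linear_combination ((√(a i) - √(b i)) ^ 2 + √(a i) * √(b i) * dist (u i) (v i) ^ 2) * this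

end Uniform

variable {X : Type*} [MetricSpace X] [MeasurableSpace X] [MeasurableSingletonClass X] {N : ℕ}

theorem hkPos_posSparse_sq_le [Nonempty X] (a b : Fin N → ℝ) (u v : Fin N → X)
    (ha : ∀ n, 0 ≤ a n) (hb : ∀ n, 0 ≤ b n) :
    hkPos (posSparse a u) (posSparse b v) ^ 2 ≤
      ENNReal.ofReal (∑ n, ((√(a n) - √(b n)) ^ 2 + √(a n) * √(b n) * dist (u n) (v n) ^ 2)) := by
  obtain ⟨z⟩ := ‹Nonempty X›
  -- A dummy atom of mass zero makes the index set nonempty when `N = 0`.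
  have h := hkPos_sq_le_sum (ι := Option (Fin N)) (fun o => o.elim 0 a) (fun o => o.elim 0 b)
    (fun o => o.elim z u) (fun o => o.elim z v) (by rintro (_ | n) <;> simp [ha])
    (by rintro (_ | n) <;> simp [hb])
  simpa [Fintype.sum_option, posSparse] using h

/-- Corresponding amplitudes have the same sign. A negative pair changes sides in the definition of
the signed distance, and the symmetric cost is unaffected by this swap. -/
theorem dHK_sparse_sq_le [Nonempty X] {q₁ q₂ : Fin N → ℝ} {y₁ y₂ : Fin N → X}
    (h₁ : Function.Injective y₁) (h₂ : Function.Injective y₂) (hq : ∀ n, q₂ n ≠ 0)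
    (hclose : ∀ n, |q₁ n - q₂ n| ≤ |q₂ n| / 2) :
    dHK (sparse q₁ y₁) (sparse q₂ y₂) ^ 2 ≤ ENNReal.ofReal
      (2 * ∑ n, ((q₁ n - q₂ n) ^ 2 / (4 * |q₂ n|) + |q₂ n| * dist (y₁ n) (y₂ n) ^ 2)) := by
  -- Closeness gives `√A ≥ √B / 2`, hence `(√A + √B)² ≥ 2 B`, which controls `(√A - √B)² = (A - B)²
  -- / (√A + √B)²`. Also `√A √B ≤ 2 B`.
  have hcost : ∀ A B D : ℝ, 0 < B → |A - B| ≤ B / 2 → (√A - √B) ^ 2 + √A * √B * D ^ 2 ≤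
      2 * ((A - B) ^ 2 / (4 * B) + B * D ^ 2) := by
    intro A B D hB hAB
    rw [abs_le] at hAB
    have hA : 0 ≤ A := by linarith [hAB.1]
    have eA := Real.sq_sqrt hA
    have eB := Real.sq_sqrt hB.le
    have pA := Real.sqrt_nonneg A
    have pB := Real.sqrt_pos.2 hB
    generalize √A = α at *
    generalize √B = β at *
    have h1 : β / 2 ≤ α := by nlinarith
    have h2 : α * β ≤ 2 * B := by nlinarith [sq_nonneg (α - β)]
    have h3 : (α - β) ^ 2 ≤ 2 * ((A - B) ^ 2 / (4 * B)) := by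
      have : 2 * ((A - B) ^ 2 / (4 * B)) = (A - B) ^ 2 / (2 * B) := by field_simp; ring
      rw [this, le_div_iff₀ (by positivity), ← eA, ← eB,
        show (α ^ 2 - β ^ 2) ^ 2 = (α - β) ^ 2 * (α + β) ^ 2 by ring]
      refine mul_le_mul_of_nonneg_left ?_ (sq_nonneg _)
      nlinarith
    nlinarith [mul_le_mul_of_nonneg_right h2 (sq_nonneg D)]
  have hcase : ∀ n, (0 < q₂ n ∧ 0 < q₁ n) ∨ (q₂ n < 0 ∧ q₁ n < 0) := by
    intro n
    have h := abs_le.1 (hclose n)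
    rcases lt_or_gt_of_ne (hq n) with h0 | h0
    · rw [abs_of_neg h0] at h
      exact Or.inr ⟨h0, by linarith [h.2]⟩
    · rw [abs_of_pos h0] at h
      exact Or.inl ⟨h0, by linarith [h.1]⟩
  rw [dHK, toJordanDecomposition_sparse q₁ h₁, toJordanDecomposition_sparse q₂ h₂]
  change hkPos (posSparse q₁ y₁ + posSparse (-q₂) y₂) (posSparse q₂ y₂ + posSparse (-q₁) y₁) ^ 2 ≤ _
  have e1 : posSparse q₁ y₁ + posSparse (-q₂) y₂ =
      posSparse (fun n => if 0 < q₂ n then q₁ n else -q₂ n)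
        (fun n => if 0 < q₂ n then y₁ n else y₂ n) := by
    rw [posSparse, posSparse, posSparse, ← Finset.sum_add_distrib]
    refine Finset.sum_congr rfl fun n _ => ?_
    rcases hcase n with ⟨h, h'⟩ | ⟨h, h'⟩
    · simp [h, ENNReal.ofReal_of_nonpos (neg_nonpos.2 h.le)]
    · simp [not_lt.2 h.le, ENNReal.ofReal_of_nonpos h'.le]
  have e2 : posSparse q₂ y₂ + posSparse (-q₁) y₁ =
      posSparse (fun n => if 0 < q₂ n then q₂ n else -q₁ n)
        (fun n => if 0 < q₂ n then y₂ n else y₁ n) := by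
    rw [posSparse, posSparse, posSparse, ← Finset.sum_add_distrib]
    refine Finset.sum_congr rfl fun n _ => ?_
    rcases hcase n with ⟨h, h'⟩ | ⟨h, h'⟩
    · simp [h, ENNReal.ofReal_of_nonpos (neg_nonpos.2 h'.le)]
    · simp [not_lt.2 h.le, ENNReal.ofReal_of_nonpos h.le]
  rw [e1, e2]
  refine (hkPos_posSparse_sq_le _ _ _ _ (fun n => ?_) (fun n => ?_)).trans
    (ENNReal.ofReal_le_ofReal ?_)
  · rcases hcase n with ⟨h, h'⟩ | ⟨h, h'⟩
    · simp [h, h'.le]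
    · simp [not_lt.2 h.le, h.le]
  · rcases hcase n with ⟨h, h'⟩ | ⟨h, h'⟩
    · simp [h, h.le]
    · simp [not_lt.2 h.le, h'.le]
  · rw [Finset.mul_sum]
    refine Finset.sum_le_sum fun n _ => ?_
    have hn := hclose n
    rcases hcase n with ⟨h, h'⟩ | ⟨h, h'⟩
    · simp only [h, if_true]
      rw [abs_of_pos h] at hn ⊢
      exact hcost _ _ _ h hn
    · simp only [not_lt.2 h.le, if_false]
      rw [abs_of_neg h] at hn ⊢
      have := hcost (-q₁ n) (-q₂ n) (dist (y₁ n) (y₂ n)) (neg_pos.2 h)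
        (by rwa [← abs_neg, show -(-q₁ n - -q₂ n) = q₁ n - q₂ n by ring])
      rw [dist_comm (y₂ n)]
      calc _ = (√(-q₁ n) - √(-q₂ n)) ^ 2 + √(-q₁ n) * √(-q₂ n) * dist (y₁ n) (y₂ n) ^ 2 := by ring
        _ ≤ _ := this
        _ = _ := by ring

end HellingerKantorovich

/-! ### Certificates and the closed form of the minimal-norm one -/

noncomputable section Certificates

variable {p d No N : ℕ} {k : Pt p → Pt d → ℝ} {x : Fin No → Pt p} {s : Fin No → ℝ} {Λ : ℝ}
  {U : Set (Pt d)}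

theorem certificate_apply (ζ : Fin No → ℝ) (z : Pt d) :
    certificate k x s ζ z = ∑ j, (s⁻¹ * ζ) j * k (x j) z := rfl

theorem certificate_add (ζ ξ : Fin No → ℝ) (z : Pt d) :
    certificate k x s (ζ + ξ) z = certificate k x s ζ z + certificate k x s ξ z := by
  simp only [certificate_apply, ← Finset.sum_add_distrib]
  exact Finset.sum_congr rfl fun j _ => by simp only [Pi.mul_apply, Pi.add_apply]; ring

theorem certificate_smul (c : ℝ) (ζ : Fin No → ℝ) (z : Pt d) :
    certificate k x s (c • ζ) z = c * certificate k x s ζ z := by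
  simp only [certificate_apply, Finset.mul_sum]
  exact Finset.sum_congr rfl fun j _ => by simp only [Pi.mul_apply, Pi.smul_apply, smul_eq_mul]; ring

/-- Cauchy–Schwarz against the constant vector, which has norm one because the weights have sum one.
-/
theorem sum_abs_inv_mul_le (hs : ∀ j, 0 < s j) (hs1 : ∑ j, (s j)⁻¹ = 1) (ζ : Fin No → ℝ) :
    ∑ j, |(s⁻¹ * ζ) j| ≤ wNorm s⁻¹ ζ := by
  have hS : ∀ j, 0 ≤ s⁻¹ j := fun j => (inv_pos.2 (hs j)).le
  have h1 : wNorm s⁻¹ (1 : Fin No → ℝ) = 1 := by simp [wNorm, hs1]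
  have h2 : wNorm s⁻¹ |ζ| = wNorm s⁻¹ ζ := by simp [wNorm]
  have h3 := (le_abs_self _).trans (abs_sum_mul_mul_le hS |ζ| 1)
  rw [h1, h2, mul_one] at h3
  refine le_trans (le_of_eq (Finset.sum_congr rfl fun j _ => ?_)) h3
  rw [Pi.mul_apply, abs_mul, abs_of_nonneg (hS j)]
  simp

theorem abs_certificate_le (hs : ∀ j, 0 < s j) (hs1 : ∑ j, (s j)⁻¹ = 1) (hΛ : 0 ≤ Λ)
    {z : Pt d} (hk : ∀ j, |k (x j) z| ≤ Λ) (ζ : Fin No → ℝ) :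
    |certificate k x s ζ z| ≤ wNorm s⁻¹ ζ * Λ := by
  calc |certificate k x s ζ z| ≤ ∑ j, |(s⁻¹ * ζ) j| * Λ := by
        rw [certificate_apply]
        refine (Finset.abs_sum_le_sum_abs _ _).trans (Finset.sum_le_sum fun j _ => ?_)
        rw [abs_mul]
        exact mul_le_mul_of_nonneg_left (hk j) (abs_nonneg _)
    _ = (∑ j, |(s⁻¹ * ζ) j|) * Λ := by rw [Finset.sum_mul]
    _ ≤ _ := mul_le_mul_of_nonneg_right (sum_abs_inv_mul_le hs hs1 ζ) hΛ

theorem boundedC3_certificate (hU : IsOpen U) (hk : ∀ j, BoundedC3 Λ U (k (x j))) (hΛ : 0 ≤ Λ)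
    (hs : ∀ j, 0 < s j) (hs1 : ∑ j, (s j)⁻¹ = 1) (ζ : Fin No → ℝ) :
    BoundedC3 (wNorm s⁻¹ ζ * Λ) U (certificate k x s ζ) :=
  (BoundedC3.sum hΛ hk hU (sum_abs_inv_mul_le hs hs1 ζ)).1

theorem fderiv_certificate (hU : IsOpen U) (hk : ∀ j, BoundedC3 Λ U (k (x j))) (hΛ : 0 ≤ Λ)
    (ζ : Fin No → ℝ) {z : Pt d} (hz : z ∈ U) :
    fderiv ℝ (certificate k x s ζ) z = ∑ j, (s⁻¹ * ζ) j • fderiv ℝ (k (x j)) z :=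
  (BoundedC3.sum hΛ hk hU (le_refl (∑ j, |(s⁻¹ * ζ) j|))).2 z hz

theorem jac_transpose_mulVec (hU : IsOpen U) (hk : ∀ j, BoundedC3 Λ U (k (x j))) (hΛ : 0 ≤ Λ)
    (q : Fin N → ℝ) {y : Fin N → Pt d} (hy : ∀ n, y n ∈ U) (ζ : Fin No → ℝ) :
    (jac k x q y)ᵀ *ᵥ (s⁻¹ * ζ) = Sum.elim (fun n => certificate k x s ζ (y n))
      (fun a => q a.1 * fderiv ℝ (certificate k x s ζ) (y a.1) (EuclideanSpace.single a.2 1)) := by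
  funext a
  rcases a with n | ⟨n, i⟩
  · simp only [Sum.elim_inl, Matrix.mulVec, dotProduct, Matrix.transpose_apply, jac, Matrix.of_apply,
      certificate_apply]
    exact Finset.sum_congr rfl fun j _ => mul_comm _ _
  · simp only [Sum.elim_inr, Matrix.mulVec, dotProduct, Matrix.transpose_apply, jac, Matrix.of_apply]
    rw [fderiv_certificate hU hk hΛ ζ (hy n), sum_apply, Finset.mul_sum]
    refine Finset.sum_congr rfl fun j _ => ?_
    rw [smul_apply, smul_eq_mul]
    ring

/-- The location equations carry the factor `q n`, which is nonzero and can be divided out. -/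
theorem jac_transpose_mulVec_eq_iff (hU : IsOpen U) (hk : ∀ j, BoundedC3 Λ U (k (x j)))
    (hΛ : 0 ≤ Λ) {q : Fin N → ℝ} (hq : ∀ n, q n ≠ 0) {y : Fin N → Pt d} (hy : ∀ n, y n ∈ U)
    (ζ : Fin No → ℝ) (ρ : Fin N → ℝ) :
    (jac k x q y)ᵀ *ᵥ (s⁻¹ * ζ) = Sum.elim ρ 0 ↔
      (∀ n, certificate k x s ζ (y n) = ρ n) ∧ ∀ n, fderiv ℝ (certificate k x s ζ) (y n) = 0 := by
  rw [jac_transpose_mulVec hU hk hΛ q hy]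
  constructor
  · intro h
    refine ⟨fun n => congrFun h (Sum.inl n), fun n => ?_⟩
    have h1 : ∀ i, fderiv ℝ (certificate k x s ζ) (y n) (EuclideanSpace.single i 1) = 0 := by
      intro i
      have := congrFun h (Sum.inr (n, i))
      simpa [hq n] using this
    refine ContinuousLinearMap.coe_injective
      ((EuclideanSpace.basisFun (Fin d) ℝ).toBasis.ext fun i => ?_)
    simpa using h1 i
  · rintro ⟨h1, h2⟩
    funext a
    rcases a with n | ⟨n, i⟩
    · exact h1 n
    · simp [h2 n]

/-- A bounded function that vanishes quadratically at the sources is dominated by a multiple of the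
admissibility gap. Adding a small multiple of it to an admissible certificate therefore keeps
feasibility. -/
theorem exists_smul_le_iInf {f : Pt d → ℝ} {Ωs : Set (Pt d)} {B R θ : ℝ} (hR : 0 < R)
    (hθ : 0 < θ) {q : Fin N → ℝ} (hq : ∀ n, q n ≠ 0) {y : Fin N → Pt d}
    (hB : ∀ z ∈ Ωs, |f z| ≤ B) (hB0 : 0 ≤ B)
    (hquad : ∀ n z, ‖z - y n‖ ≤ R → |f z| ≤ B * ‖z - y n‖ ^ 2) :
    ∃ A, 0 < A ∧ ∀ z ∈ Ωs,
      |f z| ≤ A * ⨅ o : Option (Fin N), o.elim θ (fun n => ‖√|q n| • (z - y n)‖ ^ 2) := by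
  have hqn : ∀ n, 0 < |q n| := fun n => abs_pos.2 (hq n)
  have hterm : ∀ n, 0 ≤ B / |q n| + B / (|q n| * R ^ 2) := fun n => by
    have := hqn n
    positivity
  have hsum : 0 ≤ ∑ n, (B / |q n| + B / (|q n| * R ^ 2)) := Finset.sum_nonneg fun n _ => hterm n
  -- The summands serve the cases where the minimum is `θ`, where it is attained at a source within
  -- `R`, and where it is attained at a source beyond `R`.
  refine ⟨1 + B / θ + ∑ n, (B / |q n| + B / (|q n| * R ^ 2)), by positivity, fun z hz => ?_⟩
  obtain ⟨o, ho⟩ := exists_eq_ciInf_of_finite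
    (f := fun o : Option (Fin N) => o.elim θ (fun n => ‖√|q n| • (z - y n)‖ ^ 2))
  rw [← ho]
  rcases o with _ | n
  · simp only [Option.elim_none]
    calc |f z| ≤ B := hB z hz
      _ = B / θ * θ := by field_simp
      _ ≤ _ := mul_le_mul_of_nonneg_right (by linarith) hθ.le
  · have hn := hqn n
    have hle : B / |q n| + B / (|q n| * R ^ 2) ≤
        1 + B / θ + ∑ n, (B / |q n| + B / (|q n| * R ^ 2)) := by
      have h1 := Finset.single_le_sum (f := fun n => B / |q n| + B / (|q n| * R ^ 2))
        (fun n _ => hterm n) (Finset.mem_univ n)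
      have h2 : 0 ≤ B / θ := by positivity
      have h3 : B / |q n| + B / (|q n| * R ^ 2) ≤ _ := h1
      linarith
    simp only [Option.elim_some]
    rw [norm_smul, Real.norm_of_nonneg (Real.sqrt_nonneg _), mul_pow, Real.sq_sqrt hn.le]
    refine le_trans ?_ (mul_le_mul_of_nonneg_right hle (by positivity))
    have e : (B / |q n| + B / (|q n| * R ^ 2)) * (|q n| * ‖z - y n‖ ^ 2) =
        B * ‖z - y n‖ ^ 2 + B * (‖z - y n‖ ^ 2 / R ^ 2) := by field_simp
    rw [e]
    rcases le_or_gt ‖z - y n‖ R with h | h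
    · have h1 := hquad n z h
      have h2 : 0 ≤ B * (‖z - y n‖ ^ 2 / R ^ 2) := by positivity
      linarith
    · have h1 : 1 ≤ ‖z - y n‖ ^ 2 / R ^ 2 := by
        rw [one_le_div (by positivity)]
        gcongr
      have h2 : 0 ≤ B * ‖z - y n‖ ^ 2 := by positivity
      nlinarith [hB z hz]

theorem sign_mul_self_eq_abs (a : ℝ) : Real.sign a * a = |a| := by
  rcases lt_trichotomy a 0 with h | h | h
  · rw [Real.sign_of_neg h, abs_of_neg h]; ring
  · simp [h]
  · rw [Real.sign_of_pos h, abs_of_pos h]; ring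

theorem abs_sign_of_ne_zero {a : ℝ} (h : a ≠ 0) : |Real.sign a| = 1 := by
  rcases Real.sign_apply_eq_of_ne_zero a h with h | h <;> simp [h]

theorem sign_mul_sign_of_ne_zero {a : ℝ} (h : a ≠ 0) : Real.sign a * Real.sign a = 1 := by
  rcases Real.sign_apply_eq_of_ne_zero a h with h | h <;> simp [h]

theorem fderiv_eq_zero_of_abs_le_one {f : Pt d → ℝ} {a : Pt d} (hf : ∀ᶠ z in nhds a, |f z| ≤ 1)
    (ha : |f a| = 1) : fderiv ℝ f a = 0 := by
  rcases (abs_eq zero_le_one).1 ha with h | h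
  · refine IsLocalMax.fderiv_eq_zero ?_
    filter_upwards [hf] with z hz
    rw [h]
    exact (abs_le.1 hz).2
  · refine IsLocalMin.fderiv_eq_zero ?_
    filter_upwards [hf] with z hz
    rw [h]
    exact (abs_le.1 hz).1

theorem IsAdmissible.abs_le_one {Ωs : Set (Pt d)} {θ : ℝ} {q : Fin N → ℝ} {y : Fin N → Pt d}
    {η : Pt d → ℝ} (h : IsAdmissible Ωs θ q y η) (hθ : 0 < θ) {z : Pt d} (hz : z ∈ Ωs) :
    |η z| ≤ 1 := by
  refine (h.1 z hz).trans (sub_le_self _ (mul_nonneg hθ.le (Real.iInf_nonneg ?_)))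
  rintro (_ | n)
  · exact hθ.le
  · exact sq_nonneg _

theorem IsAdmissible.fderiv_eq_zero {Ωs : Set (Pt d)} {θ : ℝ} {q : Fin N → ℝ} {y : Fin N → Pt d}
    {η : Pt d → ℝ} (h : IsAdmissible Ωs θ q y η) (hθ : 0 < θ) (hq : ∀ n, q n ≠ 0) (n : Fin N)
    (hy : y n ∈ interior Ωs) : fderiv ℝ η (y n) = 0 := by
  refine fderiv_eq_zero_of_abs_le_one ?_ (by rw [h.2 n, abs_sign_of_ne_zero (hq n)])
  filter_upwards [mem_interior_iff_mem_nhds.1 hy] with z hz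
  exact h.abs_le_one hθ hz

/-- An admissible minimal-norm certificate is the one with vanishing derivatives and smallest
norm, which is given in closed form. -/
theorem IsMinNormDualSolution.eq_precertificate {Ωs : Set (Pt d)}
    (hk : ∀ j, BoundedC3 Λ (interior Ωs) (k (x j))) (hkb : ∀ j, ∀ z ∈ Ωs, |k (x j) z| ≤ Λ)
    (hΛ : 0 ≤ Λ) (hs : ∀ j, 0 < s j) (hs1 : ∑ j, (s j)⁻¹ = 1) {q : Fin N → ℝ} (hq : ∀ n, q n ≠ 0)
    {y : Fin N → Ωs} {R θ : ℝ} (hR : 0 < R)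
    (hball : ∀ n, Metric.closedBall (y n : Pt d) R ⊆ interior Ωs)
    (hinj : LinearIndependent ℝ (jac k x q (fun n => (y n).1)).col) (hθ : 0 < θ)
    {ζ : Fin No → ℝ} (hmin : IsMinNormDualSolution k x s (sparse q y) ζ)
    (hadm : IsAdmissible Ωs θ q (fun n => (y n).1) (certificate k x s ζ)) :
    ζ = jac k x q (fun n => (y n).1) *ᵥ ((gram s⁻¹ (jac k x q (fun n => (y n).1)))⁻¹ *ᵥ
      (Sum.elim (fun n => Real.sign (q n)) 0 : Idx N d → ℝ)) := by
  have hS : ∀ j, 0 < s⁻¹ j := fun j => inv_pos.2 (hs j)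
  have hS' : ∀ j, 0 ≤ s⁻¹ j := fun j => (hS j).le
  have hy : ∀ n, (y n : Pt d) ∈ interior Ωs := fun n => hball n (Metric.mem_closedBall_self hR.le)
  set J := jac k x q (fun n => (y n).1) with hJ
  set b : Idx N d → ℝ := Sum.elim (fun n => Real.sign (q n)) 0 with hb
  set v := (gram s⁻¹ J)⁻¹ *ᵥ b with hv
  -- The direction from `ζ` to the closed-form vector. Its certificate vanishes to first order at
  -- all sources, so moving along `D` changes neither the signs there nor the dual objective.
  set D := J *ᵥ v - ζ with hD
  have hpre : Jᵀ *ᵥ (s⁻¹ * (J *ᵥ v)) = b := by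
    rw [← gram_mulVec, hv, Matrix.mulVec_mulVec, Matrix.mul_nonsing_inv _ (isUnit_det_gram hS hinj),
      Matrix.one_mulVec]
  have hζ : Jᵀ *ᵥ (s⁻¹ * ζ) = b :=
    (jac_transpose_mulVec_eq_iff isOpen_interior hk hΛ hq hy ζ _).2
      ⟨hadm.2, fun n => hadm.fderiv_eq_zero hθ hq n (hy n)⟩
  have hDb : Jᵀ *ᵥ (s⁻¹ * D) = 0 := by
    rw [hD, mul_sub, Matrix.mulVec_sub, hpre, hζ, sub_self]
  obtain ⟨hD0, hD1⟩ := (jac_transpose_mulVec_eq_iff isOpen_interior hk hΛ hq hy D 0).1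
    (by rw [← hJ, hDb]; funext a; rcases a with n | a <;> rfl)
  have hDC := boundedC3_certificate isOpen_interior hk hΛ hs hs1 D
  obtain ⟨A, hA, hDA⟩ := exists_smul_le_iInf (f := certificate k x s D) (Ωs := Ωs) hR hθ hq
    (y := fun n => (y n).1) (fun z hz => abs_certificate_le hs hs1 hΛ (fun j => hkb j z hz) D)
    (mul_nonneg (wNorm_nonneg _ _) hΛ) (fun n z hz => by
      have hsub : Metric.closedBall (y n : Pt d) ‖z - y n‖ ⊆ interior Ωs :=
        (Metric.closedBall_subset_closedBall hz).trans (hball n)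
      have := hDC.abs_sub_sub_fderiv_le hsub (a := z) (b := y n) le_rfl (by simp)
      rw [hD0 n, hD1 n] at this
      simpa [sq, mul_assoc] using this)
  -- With `t * A ≤ θ` the perturbation is absorbed by the admissibility gap.
  set t := min 1 (θ / A) with ht
  have ht0 : 0 < t := lt_min one_pos (div_pos hθ hA)
  have ht1 : t ≤ 1 := min_le_left _ _
  have htA : t * A ≤ θ := (le_div_iff₀ hA).1 (min_le_right _ _)
  have hfeas : ∀ z ∈ Ωs, |certificate k x s (ζ + t • D) z| ≤ 1 := by
    intro z hz
    rw [certificate_add, certificate_smul]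
    have h1 := hadm.1 z hz
    have h2 := hDA z hz
    have h3 : 0 ≤ ⨅ o : Option (Fin N), o.elim θ (fun n => ‖√|q n| • (z - y n)‖ ^ 2) := by
      refine Real.iInf_nonneg ?_
      rintro (_ | n)
      exacts [hθ.le, sq_nonneg _]
    generalize (⨅ o : Option (Fin N), o.elim θ (fun n => ‖√|q n| • (z - y n)‖ ^ 2)) = m at *
    refine (abs_add_le _ _).trans ?_
    rw [abs_mul, abs_of_pos ht0]
    have h4 : t * |certificate k x s D z| ≤ t * (A * m) := mul_le_mul_of_nonneg_left h2 ht0.le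
    have h5 : t * A * m ≤ θ * m := mul_le_mul_of_nonneg_right htA h3
    linarith
  have hint : ∫ᵛ u : Ωs, certificate k x s (ζ + t • D) u ∂<•(sparse q y) =
      ∫ᵛ u : Ωs, certificate k x s ζ u ∂<•(sparse q y) := by
    rw [integral_sparse (fun u : Ωs => certificate k x s (ζ + t • D) u),
      integral_sparse (fun u : Ωs => certificate k x s ζ u)]
    refine Finset.sum_congr rfl fun n _ => ?_
    have := hD0 n
    simp only [Pi.zero_apply] at this
    rw [certificate_add, certificate_smul, this, mul_zero, add_zero]
  have hdual : IsDualSolution k x s (sparse q y) (ζ + t • D) := by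
    refine ⟨fun ξ hξ => ?_, hfeas⟩
    have := hmin.1.1 hξ
    simp only [Set.mem_ofPred_eq] at this ⊢
    rwa [hint]
  have hle := hmin.2 _ hdual
  -- `D` is orthogonal to the range of `J`, so moving by `t • D` lowers the squared norm by `(2 t -
  -- t²) ‖D‖²`; minimality forces `D = 0`.
  have horth : ∑ j, s⁻¹ j * D j * (J *ᵥ v) j = 0 := by
    rw [← transpose_mulVec_dotProduct, hDb, zero_dotProduct]
  have hsq : wNorm s⁻¹ (ζ + t • D) ^ 2 = wNorm s⁻¹ ζ ^ 2 - (2 * t - t ^ 2) * wNorm s⁻¹ D ^ 2 +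
      2 * t * ∑ j, s⁻¹ j * D j * (J *ᵥ v) j := by
    rw [wNorm_sq hS', wNorm_sq hS', wNorm_sq hS', Finset.mul_sum, Finset.mul_sum,
      ← Finset.sum_sub_distrib, ← Finset.sum_add_distrib]
    refine Finset.sum_congr rfl fun j _ => ?_
    simp only [hD, Pi.add_apply, Pi.smul_apply, Pi.sub_apply, smul_eq_mul]
    ring
  rw [horth, mul_zero, add_zero] at hsq
  have h1 : wNorm s⁻¹ ζ ^ 2 ≤ wNorm s⁻¹ (ζ + t • D) ^ 2 :=
    pow_le_pow_left₀ (wNorm_nonneg _ _) hle 2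
  have h2 : 0 < 2 * t - t ^ 2 := by nlinarith
  have h3 : wNorm s⁻¹ D ^ 2 = 0 := by
    refine le_antisymm ?_ (sq_nonneg _)
    by_contra! hcon
    have := mul_pos h2 hcon
    linarith
  have h4 := eq_zero_of_wNorm_eq_zero hS (pow_eq_zero_iff two_ne_zero |>.1 h3)
  exact (sub_eq_zero.1 h4).symm

end Certificates

/-! ### Stability of admissibility and of the signs -/

noncomputable section Perturbation

variable {p d No N : ℕ} {k : Pt p → Pt d → ℝ} {x : Fin No → Pt p} {s : Fin No → ℝ} {Λ : ℝ}

/-- Strict admissibility survives a small perturbation of the certificate that still interpolates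
the signs with vanishing gradient, at slightly moved points. -/
theorem abs_certificate_lt_one_of_perturbation {Ωs : Set (Pt d)}
    (hk : ∀ j, BoundedC3 Λ (interior Ωs) (k (x j))) (hkb : ∀ j, ∀ z ∈ Ωs, |k (x j) z| ≤ Λ)
    (hΛ : 0 ≤ Λ) (hs : ∀ j, 0 < s j) (hs1 : ∑ j, (s j)⁻¹ = 1)
    {q : Fin N → ℝ} (hq : ∀ n, q n ≠ 0) {y b : Fin N → Pt d} {R₀ R θ qm Z τ δ : ℝ}
    (hball : ∀ n, Metric.closedBall (y n) (2 * R₀) ⊆ interior Ωs)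
    (hsep : ∀ n n', y n ≠ y n' → 4 * R₀ ≤ ‖y n - y n'‖)
    (hqm : ∀ n, qm ≤ |q n|) (hqm0 : 0 < qm) (hθ : 0 < θ) (hR : 0 < R) (hRR₀ : R ≤ R₀)
    (hRθ : qm * R ^ 2 ≤ θ) {ζ ζ' : Fin No → ℝ} (hadm : IsAdmissible Ωs θ q y (certificate k x s ζ))
    (hZ : wNorm s⁻¹ ζ ≤ Z) (hτ : wNorm s⁻¹ (ζ' - ζ) ≤ τ) (hδ : ∀ n, ‖b n - y n‖ ≤ δ)
    (hb : ∀ n, certificate k x s ζ' (b n) = Real.sign (q n))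
    (hb' : ∀ n, fderiv ℝ (certificate k x s ζ') (b n) = 0)
    (h1 : Z * Λ * δ + τ * Λ < θ * qm) (h2 : (Z + τ) * Λ * R ≤ 1) (h3 : δ ≤ R / 2)
    (h4 : τ * Λ < θ * (qm * R ^ 2 / 4)) {z : Pt d} (hz : z ∈ Ωs) (hzb : z ∉ Set.range b) :
    |certificate k x s ζ' z| < 1 := by
  have hS' : ∀ j, 0 ≤ s⁻¹ j := fun j => (inv_pos.2 (hs j)).le
  have hdecomp : ∀ z, certificate k x s ζ' z =
      certificate k x s ζ z + certificate k x s (ζ' - ζ) z := by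
    intro z; rw [← certificate_add, add_sub_cancel]
  have hscale : ∀ n (z : Pt d), ‖√|q n| • (z - y n)‖ ^ 2 = |q n| * ‖z - y n‖ ^ 2 := by
    intro n z
    rw [norm_smul, Real.norm_of_nonneg (Real.sqrt_nonneg _), mul_pow, Real.sq_sqrt (abs_nonneg _)]
  by_cases hnear : ∃ n, ‖z - b n‖ ≤ R
  · obtain ⟨n, hn⟩ := hnear
    -- Multiplying by the sign reduces to a peak of height `+1`.
    set σ := Real.sign (q n) with hσ
    have hσσ : σ * σ = 1 := sign_mul_sign_of_ne_zero (hq n)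
    have hσa : |σ| = 1 := abs_sign_of_ne_zero (hq n)
    have hδn := hδ n
    have hR2 : R ≤ 2 * R₀ := by linarith
    have hnormσ : ∀ ξ : Fin No → ℝ, wNorm s⁻¹ (σ • ξ) = wNorm s⁻¹ ξ := fun ξ => by
      rw [wNorm_smul, hσa, one_mul]
    have hin : ∀ w : Pt d, ‖w - b n‖ ≤ R → w ∈ Metric.closedBall (y n) (2 * R₀) := by
      intro w hw
      rw [mem_closedBall_iff_norm]
      have := norm_add_le (w - b n) (b n - y n)
      rw [sub_add_sub_cancel] at this
      linarith
    have hbin : b n ∈ Metric.closedBall (y n) (2 * R₀) := hin _ (by simpa using hR.le)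
    have hyin : y n ∈ interior Ωs :=
      hball n (Metric.mem_closedBall_self (by linarith))
    have hf : BoundedC3 (Z * Λ) (interior Ωs) (certificate k x s (σ • ζ)) :=
      (boundedC3_certificate isOpen_interior hk hΛ hs hs1 _).mono
        (mul_le_mul_of_nonneg_right ((hnormσ ζ).le.trans hZ) hΛ)
    have he : BoundedC3 (τ * Λ) (interior Ωs) (certificate k x s (σ • (ζ' - ζ))) :=
      (boundedC3_certificate isOpen_interior hk hΛ hs hs1 _).mono
        (mul_le_mul_of_nonneg_right ((hnormσ _).le.trans hτ) hΛ)
    have hfun : ∀ ξ : Fin No → ℝ, certificate k x s (σ • ξ) = fun z => σ * certificate k x s ξ z :=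
      fun ξ => funext fun z => certificate_smul σ ξ z
    have hfd : ∀ ξ : Fin No → ℝ, ∀ w ∈ interior Ωs, fderiv ℝ (certificate k x s (σ • ξ)) w =
        σ • fderiv ℝ (certificate k x s ξ) w := by
      intro ξ w hw
      rw [hfun]
      exact fderiv_const_mul
        ((boundedC3_certificate isOpen_interior hk hΛ hs hs1 ξ).diff₀ w hw) σ
    have hsum : ∀ w, certificate k x s (σ • ζ) w + certificate k x s (σ • (ζ' - ζ)) w =
        σ * certificate k x s ζ' w := by
      intro w
      rw [certificate_smul, certificate_smul, hdecomp w]; ring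
    have hpeak : ∀ w, ‖w - y n‖ ≤ R →
        certificate k x s (σ • ζ) w ≤ 1 - θ * qm * ‖w - y n‖ ^ 2 := by
      intro w hw
      have hwin : w ∈ Ωs := interior_subset (hball n (mem_closedBall_iff_norm.2 (hw.trans hR2)))
      have hinf : qm * ‖w - y n‖ ^ 2 ≤
          ⨅ o : Option (Fin N), o.elim θ (fun n => ‖√|q n| • (w - y n)‖ ^ 2) := by
        refine le_ciInf ?_
        rintro (_ | n')
        · exact le_trans (by gcongr) hRθ
        · simp only [Option.elim_some]
          rw [hscale]
          -- Within `R ≤ R₀` of `y n`, any other source is at least `3 R₀` away, so `y n` is the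
          -- nearest one.
          have : ‖w - y n‖ ≤ ‖w - y n'‖ := by
            by_cases hnn : y n = y n'
            · rw [hnn]
            · have h5 := hsep n n' hnn
              have h6 := norm_sub_le_norm_sub_add_norm_sub (y n) w (y n')
              rw [norm_sub_rev (y n) w] at h6
              linarith
          gcongr
          exact hqm n'
      rw [certificate_smul]
      have h5 := (le_abs_self _).trans (le_of_eq (abs_mul σ (certificate k x s ζ w)))
      rw [hσa, one_mul] at h5
      have h6 := hadm.1 w hwin
      have h7 := mul_le_mul_of_nonneg_left hinf hθ.le
      linarith
    have hmain := hf.add_le_of_peak he (a := y n) (b := b n) (y := z) (R := R) (hball n)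
      (by linarith) (by rw [certificate_smul, hadm.2 n, hσσ])
      (by rw [hfd _ _ hyin, hadm.fderiv_eq_zero hθ hq n hyin, smul_zero])
      hpeak (by rw [hsum, hb n, hσσ])
      (by
        have hbi := hball n hbin
        have hd1 := (hf.diff₀ _ hbi).hasFDerivAt.add (he.diff₀ _ hbi).hasFDerivAt
        have hd2 : fderiv ℝ (certificate k x s (σ • ζ')) (b n) = 0 := by
          rw [hfd _ _ hbi, hb' n, smul_zero]
        rw [← hd1.fderiv, ← hd2]
        congr 1
        funext w
        rw [Pi.add_apply, hsum, certificate_smul]) hn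
    have hpos : 0 < θ * qm - Z * Λ * ‖b n - y n‖ - τ * Λ := by
      have hZ0 : 0 ≤ Z := (wNorm_nonneg _ _).trans hZ
      have : Z * Λ * ‖b n - y n‖ ≤ Z * Λ * δ := by gcongr
      linarith
    have hne : 0 < ‖z - b n‖ := norm_pos_iff.2 (sub_ne_zero.2 fun h => hzb ⟨n, h.symm⟩)
    rw [hsum] at hmain
    have hup : σ * certificate k x s ζ' z < 1 := by
      have := mul_pos hpos (pow_pos hne 2)
      linarith
    have hζ' : wNorm s⁻¹ ζ' ≤ Z + τ := by
      have := wNorm_add_le hS' ζ (ζ' - ζ)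
      rw [add_sub_cancel] at this
      linarith
    have hlip := (boundedC3_certificate isOpen_interior hk hΛ hs hs1 ζ').abs_sub_le
      (convex_closedBall (y n) (2 * R₀)) (hball n) (hin z hn) hbin
    -- The Lipschitz bound keeps `σ` times the certificate nonnegative on the ball, so the upper
    -- bound alone controls its modulus.
    have hlip' : |certificate k x s ζ' z - σ| ≤ 1 := by
      rw [hσ, ← hb n]
      refine hlip.trans (le_trans ?_ h2)
      gcongr
      exact mul_nonneg ((wNorm_nonneg _ _).trans hζ') hΛ
    have hlow : 0 ≤ σ * certificate k x s ζ' z := by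
      have h5 : |σ * (certificate k x s ζ' z - σ)| ≤ 1 := by rwa [abs_mul, hσa, one_mul]
      have h6 := (abs_le.1 h5).1
      rw [mul_sub, hσσ] at h6
      linarith
    have h7 : |certificate k x s ζ' z| = |σ * certificate k x s ζ' z| := by
      rw [abs_mul, hσa, one_mul]
    rw [h7, abs_of_nonneg hlow]
    exact hup
  · push Not at hnear
    -- Away from all `b n`, the distance to each `y n` is at least `R - δ ≥ R / 2`; the resulting
    -- gap exceeds the uniform perturbation.
    have hinf : qm * R ^ 2 / 4 ≤
        ⨅ o : Option (Fin N), o.elim θ (fun n => ‖√|q n| • (z - y n)‖ ^ 2) := by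
      refine le_ciInf ?_
      rintro (_ | n)
      · have : 0 ≤ qm * R ^ 2 := by positivity
        simp only [Option.elim_none]
        linarith
      · simp only [Option.elim_some]
        rw [hscale]
        have h5 : R / 2 ≤ ‖z - y n‖ := by
          have h6 := norm_sub_le_norm_sub_add_norm_sub z (y n) (b n)
          rw [norm_sub_rev (y n) (b n)] at h6
          linarith [hnear n, hδ n]
        calc qm * R ^ 2 / 4 = qm * (R / 2) ^ 2 := by ring
          _ ≤ |q n| * ‖z - y n‖ ^ 2 := by
            gcongr
            exact hqm n
    have h5 := hadm.1 z hz
    have h6 := mul_le_mul_of_nonneg_left hinf hθ.le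
    have h7 := abs_certificate_le hs hs1 hΛ (fun j => hkb j z hz) (ζ' - ζ)
    have h8 : wNorm s⁻¹ (ζ' - ζ) * Λ ≤ τ * Λ := mul_le_mul_of_nonneg_right hτ hΛ
    rw [hdecomp]
    refine (abs_add_le _ _).trans_lt ?_
    linarith

theorem isSubgradientL1_sign (q : Fin N → ℝ) : IsSubgradientL1 q (fun n => Real.sign (q n)) := by
  intro q'
  rw [← Finset.sum_add_distrib]
  refine Finset.sum_le_sum fun n _ => ?_
  rw [mul_sub, sign_mul_self_eq_abs]
  have h1 : |Real.sign (q n)| ≤ 1 := by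
    rcases Real.sign_apply_eq (q n) with h | h | h <;> simp [h]
  have h2 : Real.sign (q n) * q' n ≤ |q' n| := by
    refine (le_abs_self _).trans ?_
    rw [abs_mul]
    exact mul_le_of_le_one_left (abs_nonneg _) h1
  linarith

/-- Testing with the `n`-th coordinate doubled and with it set to zero gives `ρ n * q n = |q n|`. -/
theorem IsSubgradientL1.eq_sign {q ρ : Fin N → ℝ} (h : IsSubgradientL1 q ρ) {n : Fin N}
    (hq : q n ≠ 0) : ρ n = Real.sign (q n) := by
  classical
  have key : ∀ t : ℝ, |q n| + ρ n * t ≤ |q n + t| := by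
    intro t
    have h1 := h (Function.update q n (q n + t))
    have h2 : ∑ i, ρ i * (Function.update q n (q n + t) i - q i) = ρ n * t := by
      rw [Finset.sum_eq_single n]
      · simp
      · intro i _ hi; simp [hi]
      · simp
    have h3 : ∑ i, |Function.update q n (q n + t) i| - ∑ i, |q i| = |q n + t| - |q n| := by
      rw [← Finset.sum_sub_distrib, Finset.sum_eq_single n]
      · simp
      · intro i _ hi; simp [hi]
      · simp
    linarith
  have h1 := key (q n)
  have h2 := key (-q n)
  have h3 : |q n + q n| = 2 * |q n| := by rw [← two_mul, abs_mul]; norm_num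
  rw [h3] at h1
  rw [add_neg_cancel, abs_zero] at h2
  have h4 : ρ n * q n = Real.sign (q n) * q n := by rw [sign_mul_self_eq_abs]; linarith
  exact mul_right_cancel₀ hq h4

theorem sign_eq_of_abs_sub_le {a c : ℝ} (hc : c ≠ 0) (h : |a - c| ≤ |c| / 2) :
    Real.sign a = Real.sign c := by
  rw [abs_le] at h
  rcases lt_or_gt_of_ne hc with h0 | h0
  · rw [abs_of_neg h0] at h
    rw [Real.sign_of_neg h0, Real.sign_of_neg (by linarith)]
  · rw [abs_of_pos h0] at h
    rw [Real.sign_of_pos h0, Real.sign_of_pos (by linarith)]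

theorem ne_zero_of_abs_sub_le {a c : ℝ} (hc : c ≠ 0) (h : |a - c| ≤ |c| / 2) : a ≠ 0 := by
  rintro rfl
  have := abs_pos.2 hc
  rw [zero_sub, abs_neg] at h
  linarith

/-- Amplitudes that stay within half of `|q n|` keep their sign, so the subdifferential is the
single vector `sign q`. -/
theorem isStationary_iff_lsGradient_eq_zero {q q₁ : Fin N → ℝ} {y y₁ : Fin N → Pt d} {β : ℝ}
    {ε : Fin No → ℝ} (hq : ∀ n, q n ≠ 0) (hclose : ∀ n, |q₁ n - q n| ≤ |q n| / 2) :
    IsStationary k x s β (obs k x q y + ε) q₁ y₁ ↔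
      lsGradient s⁻¹ (fun m : Idx N d → ℝ => obs k x (amp m) (locs m))
        (fun m => jac k x (amp m) (locs m)) (stack q y) ε
        (β • Sum.elim (fun n => Real.sign (q n)) 0) (stack q₁ y₁) = 0 := by
  have hsign : (fun n => Real.sign (q₁ n)) = fun n => Real.sign (q n) :=
    funext fun n => sign_eq_of_abs_sub_le (hq n) (hclose n)
  constructor
  · rintro ⟨ρ, hρ, h⟩
    have : ρ = fun n => Real.sign (q n) := by
      rw [← hsign]
      exact funext fun n => hρ.eq_sign (ne_zero_of_abs_sub_le (hq n) (hclose n))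
    rw [this] at h
    exact h
  · intro h
    refine ⟨fun n => Real.sign (q n), ?_, h⟩
    rw [← hsign]
    exact isSubgradientL1_sign q₁

end Perturbation

/-! ### Recovery for one measurement setup -/

noncomputable section Recovery

variable {p d No N : ℕ}

theorem linObjective_eq (k : Pt p → Pt d → ℝ) (x : Fin No → Pt p) (s : Fin No → ℝ) (β : ℝ)
    (ε : Fin No → ℝ) (q : Fin N → ℝ) (y : Fin N → Pt d) :
    linObjective k x s β ε q y = fun δ => 1 / 2 * wNorm s⁻¹ (jac k x q y *ᵥ δ - ε) ^ 2 +
      (β • Sum.elim (fun n => Real.sign (q n)) 0 : Idx N d → ℝ) ⬝ᵥ δ := by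
  funext δ
  rw [linObjective, smul_dotProduct, dotProduct, Fintype.sum_sum_type]
  simp

/-- Two equal locations would produce two equal amplitude columns. -/
theorem injective_of_linearIndependent_jac {k : Pt p → Pt d → ℝ} {x : Fin No → Pt p}
    {q : Fin N → ℝ} {y : Fin N → Pt d} (h : LinearIndependent ℝ (jac k x q y).col) :
    Function.Injective y := by
  intro n n' hn
  refine Sum.inl_injective (h.injective (funext fun j => ?_))
  simp [Matrix.col, jac, hn]

/-- The recovery result for one measurement setup, under explicit smallness conditions. -/
theorem exists_recovery {Ωs : Set (Pt d)} (hΩs : IsCompact Ωs) {k : Pt p → Pt d → ℝ}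
    {x : Fin No → Pt p} {s : Fin No → ℝ} {Λ : ℝ} (hk : ∀ j, BoundedC3 Λ (interior Ωs) (k (x j)))
    (hkb : ∀ j, ∀ z ∈ Ωs, |k (x j) z| ≤ Λ) (hkc : ∀ j, ContinuousOn (k (x j)) Ωs) (hΛ : 0 ≤ Λ)
    (hs : ∀ j, 0 < s j) (hs1 : ∑ j, (s j)⁻¹ = 1) (hne : Ωs.Nonempty)
    {q : Fin N → ℝ} (hq : ∀ n, q n ≠ 0) {y : Fin N → Ωs} {R₀ r₀ L M : ℝ}
    (H : LocalConstants Λ (interior Ωs) q (fun n => (y n).1) R₀ r₀ L)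
    (hinj : LinearIndependent ℝ (jac k x q (fun n => (y n).1)).col)
    (hM : wOpNorm (weight d q)⁻¹ (weight d q) (fisher k x s q (fun n => (y n).1))⁻¹ ≤ M)
    {θ : ℝ} {ζ : Fin No → ℝ} (hθ : 0 < θ) (hmin : IsMinNormDualSolution k x s (sparse q y) ζ)
    (hadm : IsAdmissible Ωs θ q (fun n => (y n).1) (certificate k x s ζ))
    {ε : Fin No → ℝ} {β : ℝ} (hβ : 0 < β) {r D qm R Z τ δ : ℝ} (hr : 0 < r) (hr₀ : 3 / 2 * r ≤ r₀)
    (hcontr : 5 * max M 1 * L ^ 2 * (3 / 2 * r + wNorm s⁻¹ ε) ≤ 1 / 2)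
    (hD : wNorm (weight d q) (linEstimate k x s β ε q (fun n => (y n).1)) ≤ D) (hDr : D ≤ r / 2)
    (hqm : ∀ n, qm ≤ |q n|) (hqm0 : 0 < qm) (hR : 0 < R) (hRR₀ : R ≤ R₀) (hRθ : qm * R ^ 2 ≤ θ)
    (hZ : wNorm s⁻¹ ζ ≤ Z)
    (hτ : L * (2 * D) ^ 2 + 5 * max M 1 * L ^ 3 * (2 * D + wNorm s⁻¹ ε) * (2 * D) +
      (max M 1 * L ^ 2 + 1) * wNorm s⁻¹ ε ≤ β * τ)
    (hδ : L * (2 * D) ≤ δ) (h1 : Z * Λ * δ + τ * Λ < θ * qm) (h2 : (Z + τ) * Λ * R ≤ 1)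
    (h3 : δ ≤ R / 2) (h4 : τ * Λ < θ * (qm * R ^ 2 / 4)) :
    ∃ (qh : Fin N → ℝ) (yh : Fin N → Ωs),
      wNorm (weight d q) (stack qh (fun n => (yh n).1) - stack q (fun n => (y n).1)) ≤ r ∧
      IsStationary k x s β (obs k x q (fun n => (y n).1) + ε) qh (fun n => (yh n).1) ∧
      (∀ (q₁ : Fin N → ℝ) (y₁ : Fin N → Ωs),
        wNorm (weight d q) (stack q₁ (fun n => (y₁ n).1) - stack q (fun n => (y n).1))
          ≤ 3 / 2 * r →
        IsStationary k x s β (obs k x q (fun n => (y n).1) + ε) q₁ (fun n => (y₁ n).1) →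
        q₁ = qh ∧ y₁ = yh) ∧
      (∀ μ : SignedMeasure Ωs,
        IsMinOn (tikhonov k x s β (forwardOp k x (sparse q y) + ε)) Set.univ μ ↔
        μ = sparse qh yh) ∧
      (∀ δ : Idx N d → ℝ,
        IsMinOn (linObjective k x s β ε q (fun n => (y n).1)) Set.univ δ ↔
        δ = linEstimate k x s β ε q (fun n => (y n).1)) ∧
      dHK (sparse qh yh) (sparse q y) ^ 2 ≤ ENNReal.ofReal (8 * wNorm (weight d q)
        (linEstimate k x s β ε q (fun n => (y n).1)) ^ 2) := by
  set w := weight d q with hw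
  set m₀ : Idx N d → ℝ := stack q (fun n => (y n).1) with hm₀
  set ρ : Idx N d → ℝ := Sum.elim (fun n => Real.sign (q n)) 0 with hρ
  set G : (Idx N d → ℝ) → Fin No → ℝ := fun m => obs k x (amp m) (locs m) with hG
  set J : (Idx N d → ℝ) → Matrix (Fin No) (Idx N d) ℝ := fun m => jac k x (amp m) (locs m) with hJ
  set E := linEstimate k x s β ε q (fun n => (y n).1) with hE
  have hS : ∀ j, 0 < s⁻¹ j := fun j => inv_pos.2 (hs j)
  have hS' : ∀ j, 0 ≤ s⁻¹ j := fun j => (hS j).le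
  have hw' : ∀ a, 0 ≤ w a := fun a => (weight_pos hq a).le
  have hL : 0 ≤ L := zero_le_one.trans H.one_le
  have hε : 0 ≤ wNorm s⁻¹ ε := wNorm_nonneg _ _
  have hMx : 0 ≤ max M 1 := zero_le_one.trans (le_max_right _ _)
  have Mdl : LeastSquaresModel w s⁻¹ G J m₀ r₀ L (max M 1) :=
    H.leastSquaresModel hq hk hs hs1 hinj hM
  have hElin : lsLinear s⁻¹ (J m₀) ε (β • ρ) = E := rfl
  obtain ⟨m, hm, hzero, huniq, hm2, hlin⟩ := Mdl.exists_unique_zero hr.le hr₀ ε (β • ρ) hcontr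
    (by rw [hElin]; exact hD.trans hDr)
  rw [hElin] at hm2 hlin
  have hmr₀ : wNorm w (m - m₀) ≤ r₀ := hm.trans (by linarith)
  have hyinj : Function.Injective (fun n => (y n).1) := injective_of_linearIndependent_jac hinj
  have hnear := H.locs_near m hmr₀
  have hlocs : ∀ n, locs m n ∈ interior Ωs := fun n => H.ball_subset n
    (mem_closedBall_iff_norm.2 ((hnear n).trans (by linarith [H.R₀_pos])))
  have hamp := H.amp_near m hmr₀
  have hamp0 : ∀ n, amp m n ≠ 0 := fun n => ne_zero_of_abs_sub_le (hq n) (hamp n)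
  set yh : Fin N → Ωs := fun n => ⟨locs m n, interior_subset (hlocs n)⟩ with hyh
  have hstack : stack (amp m) (fun n => (yh n).1) = m := stack_amp_locs m
  -- Each location moves by at most `R₀`, while distinct sources are `4 R₀` apart.
  have hyhinj : Function.Injective yh := by
    intro n n' hn
    by_contra hnn
    have e : locs m n = locs m n' := congrArg Subtype.val hn
    have h5 := H.separated n n' fun h => hnn (hyinj h)
    have h6 := norm_sub_le_norm_sub_add_norm_sub (y n).1 (locs m n) (y n').1
    have h7 := hnear n
    have h8 := hnear n'
    rw [← e] at h8
    rw [norm_sub_rev (y n).1 (locs m n)] at h6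
    linarith [H.R₀_pos]
  -- the dual variable of the candidate
  set ζ' : Fin No → ℝ := -(β⁻¹ • (G m - (G m₀ + ε))) with hζ'
  have hgrad : ∀ v : Idx N d → ℝ, (J v)ᵀ *ᵥ (s⁻¹ * (G m - (G m₀ + ε))) + β • ρ = 0 ↔
      (J v)ᵀ *ᵥ (s⁻¹ * ζ') = ρ := by
    intro v
    have e : (J v)ᵀ *ᵥ (s⁻¹ * ζ') = -(β⁻¹ • ((J v)ᵀ *ᵥ (s⁻¹ * (G m - (G m₀ + ε))))) := by
      rw [hζ', mul_neg, mul_smul_comm, Matrix.mulVec_neg, Matrix.mulVec_smul]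
    rw [e, ← smul_neg, inv_smul_eq_iff₀ hβ.ne', neg_eq_iff_add_eq_zero]
  obtain ⟨hval, hder⟩ := (jac_transpose_mulVec_eq_iff isOpen_interior hk hΛ hamp0 hlocs ζ'
    (fun n => Real.sign (q n))).1 ((hgrad m).1 hzero)
  have hζeq := hmin.eq_precertificate hk hkb hΛ hs hs1 hq (R := R₀) H.R₀_pos
    (fun n => (Metric.closedBall_subset_closedBall (by linarith [H.R₀_pos])).trans
      (H.ball_subset n)) hinj hθ hadm
  -- By the closed form of `ζ`, the difference is `-β⁻¹` times the corrected residual of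
  -- `wNorm_residual_le`.
  have hdiff : ζ' - ζ = -(β⁻¹ • (G m - (G m₀ + ε) +
      J m₀ *ᵥ ((gram s⁻¹ (J m₀))⁻¹ *ᵥ (β • ρ)))) := by
    have e : ζ = J m₀ *ᵥ ((gram s⁻¹ (J m₀))⁻¹ *ᵥ ρ) := hζeq
    rw [e, hζ', Matrix.mulVec_smul, Matrix.mulVec_smul, smul_add, inv_smul_smul₀ hβ.ne']
    abel
  have hm2' : wNorm w (m - m₀) ≤ 2 * D := hm2.trans (by linarith)
  have hmnn : 0 ≤ wNorm w (m - m₀) := wNorm_nonneg _ _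
  have hD0 : 0 ≤ D := (wNorm_nonneg _ _).trans hD
  have hτ' : wNorm s⁻¹ (ζ' - ζ) ≤ τ := by
    rw [hdiff, wNorm_neg, wNorm_smul, abs_of_pos (inv_pos.2 hβ), inv_mul_le_iff₀ hβ]
    refine (Mdl.wNorm_residual_le ε (β • ρ) m hmr₀ hlin).trans (le_trans ?_ hτ)
    gcongr
  have hδ' : ∀ n, ‖locs m n - (y n).1‖ ≤ δ := fun n => by
    refine le_trans (H.locs_le (m - m₀) n) (le_trans ?_ hδ)
    gcongr
  have hlt : ∀ z ∈ Ωs, z ∉ Set.range (locs m) → |certificate k x s ζ' z| < 1 := fun z hz hzb =>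
    abs_certificate_lt_one_of_perturbation hk hkb hΛ hs hs1 hq H.ball_subset H.separated hqm hqm0
      hθ hR hRR₀ hRθ hadm hZ hτ' hδ' hval hder h1 h2 h3 h4 hz hzb
  have hstat : IsStationary k x s β (obs k x q (fun n => (y n).1) + ε) (amp m)
      (fun n => (yh n).1) :=
    (isStationary_iff_lsGradient_eq_zero hq hamp).2 (by rw [hstack]; exact hzero)
  have huniq' : ∀ (q₁ : Fin N → ℝ) (y₁ : Fin N → Ωs),
      wNorm w (stack q₁ (fun n => (y₁ n).1) - m₀) ≤ 3 / 2 * r →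
      IsStationary k x s β (obs k x q (fun n => (y n).1) + ε) q₁ (fun n => (y₁ n).1) →
      q₁ = amp m ∧ y₁ = yh := by
    intro q₁ y₁ hball hst
    have h5 := (isStationary_iff_lsGradient_eq_zero hq (H.amp_near _ (hball.trans hr₀))).1 hst
    have h6 := huniq _ hball h5
    refine ⟨congrArg amp h6, funext fun n => Subtype.ext ?_⟩
    exact congrFun (congrArg locs h6) n
  refine ⟨amp m, yh, by rw [hstack]; exact hm, hstat, huniq', ?_, fun δ => ?_, ?_⟩
  · refine isMinOn_tikhonov_iff hΩs hkc hs hβ hyhinj (ζ := ζ') ?_ (fun n => ?_) (fun u => ?_)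
      (fun u hu => ?_) (fun c hc => ?_)
    · rw [forwardOp_sparse, forwardOp_sparse, hζ', smul_neg, smul_inv_smul₀ hβ.ne', neg_sub]
      rfl
    · have : certificate k x s ζ' (yh n) = Real.sign (q n) := hval n
      rw [this, ← sign_eq_of_abs_sub_le (hq n) (hamp n), mul_comm, sign_mul_self_eq_abs]
    · by_cases hu : (u : Pt d) ∈ Set.range (locs m)
      · obtain ⟨n, hn⟩ := hu
        rw [← hn, hval n, abs_sign_of_ne_zero (hq n)]
      · exact (hlt u u.2 hu).le
    · refine hlt u u.2 ?_
      rintro ⟨n, hn⟩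
      exact hu ⟨n, Subtype.ext hn⟩
    -- If other amplitudes `c` gave the same observation, moving slightly towards them would change
    -- neither locations nor observation, hence not the dual variable. The moved point would be
    -- another stationary point near `m₀`, against uniqueness.
    · rw [forwardOp_sparse, forwardOp_sparse] at hc
      set v : Idx N d → ℝ := stack c (fun n => (yh n).1) - m with hv
      -- A step of length at most `r / 2` from the `r`-ball stays in the ball of radius `3 / 2 * r`,
      -- where uniqueness holds.
      obtain ⟨t, ht0, ht⟩ : ∃ t : ℝ, 0 < t ∧ t * wNorm w v ≤ r / 2 := by
        have hpos : 0 < wNorm w v + 1 := by linarith [wNorm_nonneg w v]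
        refine ⟨r / 2 / (wNorm w v + 1), by positivity, ?_⟩
        rw [div_mul_eq_mul_div, div_le_iff₀ hpos]
        nlinarith
      set m' := m + t • v with hm'
      have hm'loc : locs m' = locs m := by
        funext n
        ext i
        simp [hm', hv, locs, stack, hyh]
      have hm'ball : wNorm w (m' - m₀) ≤ 3 / 2 * r := by
        have e : m' - m₀ = (m - m₀) + t • v := by rw [hm']; abel
        have h5 := wNorm_add_le hw' (m - m₀) (t • v)
        rw [wNorm_smul, abs_of_pos ht0] at h5
        rw [e]
        linarith
      have hGm' : G m' = G m := by
        funext j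
        have h5 := congrFun hc j
        simp only [hG, obs] at h5 ⊢
        rw [hm'loc]
        have h6 : ∀ n, amp m' n * k (x j) (locs m n) = amp m n * k (x j) (locs m n) +
            t * (c n * k (x j) (locs m n) - amp m n * k (x j) (locs m n)) := by
          intro n
          have : amp m' n = amp m n + t * (c n - amp m n) := rfl
          rw [this]; ring
        rw [Finset.sum_congr rfl fun n _ => h6 n, Finset.sum_add_distrib, ← Finset.mul_sum,
          Finset.sum_sub_distrib]
        have h7 : ∑ n, c n * k (x j) (locs m n) = ∑ n, amp m n * k (x j) (locs m n) := h5
        rw [h7]; ring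
      have hzero' : lsGradient s⁻¹ G J m₀ ε (β • ρ) m' = 0 := by
        rw [lsGradient, hGm', hgrad]
        have hamp' : ∀ n, amp m' n ≠ 0 := fun n =>
          ne_zero_of_abs_sub_le (hq n) (H.amp_near m' (hm'ball.trans hr₀) n)
        refine (jac_transpose_mulVec_eq_iff isOpen_interior hk hΛ hamp' (fun n => ?_) ζ'
          (fun n => Real.sign (q n))).2 ⟨fun n => ?_, fun n => ?_⟩
        · rw [hm'loc]; exact hlocs n
        · rw [hm'loc]; exact hval n
        · rw [hm'loc]; exact hder n
      have h5 := huniq m' hm'ball hzero'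
      funext n
      have h6 : t * (c n - amp m n) = 0 := by
        have h7 : amp m' n = amp m n + t * (c n - amp m n) := rfl
        rw [h5] at h7
        linarith
      exact sub_eq_zero.1 ((mul_eq_zero.1 h6).resolve_left ht0.ne')
  · rw [linObjective_eq]
    exact isMinOn_linearized_iff hS hinj ε (β • ρ) δ
  · have : Nonempty Ωs := hne.to_subtype
    refine (dHK_sparse_sq_le hyhinj (fun n n' h => hyinj (congrArg Subtype.val h)) hq hamp).trans
      (ENNReal.ofReal_le_ofReal ?_)
    have e : ∑ n, ((amp m n - q n) ^ 2 / (4 * |q n|) + |q n| * dist (yh n) (y n) ^ 2) =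
        wNorm w (m - m₀) ^ 2 := by
      rw [wNorm_weight_sq q hq]
      refine Finset.sum_congr rfl fun n _ => ?_
      rw [Subtype.dist_eq, dist_eq_norm]
      rfl
    rw [e]
    -- The factor `8` is `2 · 2²`: the coupling cost and the bound `‖m - m₀‖ ≤ 2 ‖E‖`.
    have h5 := pow_le_pow_left₀ hmnn hm2 2
    rw [mul_pow] at h5
    linarith

end Recovery
-- Elementary inequalities for the smallness conditions
theorem radius_smallness {K A r e β : ℝ} (hK : 0 < K) (hA : 0 < A) (hr : 0 < r) (he : 0 ≤ e)
    (hβ : 0 < β) (h : (4 * K + 2 * A / r) * (e + β) ≤ 1) :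
    K * e ≤ 1 / 4 ∧ A * (e + β) ≤ r / 2 := by
  have h1 : 0 ≤ 2 * A / r * (e + β) := by positivity
  have h2 : 0 ≤ K * e := by positivity
  have h3 : 0 ≤ K * β := by positivity
  rw [add_mul, mul_assoc, mul_add K] at h
  have h4 : 2 * A / r * (e + β) ≤ 1 := by linarith
  rw [div_mul_eq_mul_div, div_le_one hr] at h4
  exact ⟨by linarith, by linarith⟩

/-- Every summand of the constant is nonnegative, so each of the last four yields one of the
conclusions; `θ² ≤ θ ≤ √θ` adapts the power of `θ`. -/
theorem certificate_smallness {L A B Z Λ qm R θ Q : ℝ} (hL : 0 < L) (hA : 0 < A) (hB : 0 < B)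
    (hΛ : 0 < Λ) (hqm : 0 < qm) (hR : 0 < R) (hZ : 0 ≤ Z) (hθ : 0 < θ) (hθ1 : θ ≤ 1) (hQ : 0 < Q)
    (h : (1 + B + 2 * Λ * (2 * Z * L * A + B) / qm + 4 * L * A / R + 8 * Λ * B / (qm * R ^ 2)) * Q
      ≤ θ ^ 2 / 32) :
    B * Q ≤ 1 ∧ 2 * (Λ * (2 * Z * L * A + B) * Q) ≤ θ * qm ∧ 4 * L * A * Q ≤ R * √θ ∧
      8 * Λ * B * Q ≤ θ ^ 2 * (qm * R ^ 2) := by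
  have hθ2 : θ ^ 2 ≤ θ := by nlinarith
  have t1 : 0 ≤ B * Q := by positivity
  have t2 : 0 ≤ 2 * Λ * (2 * Z * L * A + B) / qm * Q := by positivity
  have t3 : 0 ≤ 4 * L * A / R * Q := by positivity
  have t4 : 0 ≤ 8 * Λ * B / (qm * R ^ 2) * Q := by positivity
  have t5 : 0 ≤ θ ^ 2 := sq_nonneg θ
  rw [add_mul, add_mul, add_mul, add_mul, one_mul] at h
  refine ⟨by linarith, ?_, ?_, ?_⟩
  · have h1 : 2 * Λ * (2 * Z * L * A + B) / qm * Q ≤ θ := by linarith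
    rw [div_mul_eq_mul_div, div_le_iff₀ hqm] at h1
    linarith
  · have h1 : 4 * L * A / R * Q ≤ √θ := (by linarith : _ ≤ θ).trans (Real.le_sqrt_of_sq_le hθ2)
    rw [div_mul_eq_mul_div, div_le_iff₀ hR] at h1
    linarith
  · have h1 : 8 * Λ * B / (qm * R ^ 2) * Q ≤ θ ^ 2 := by linarith
    rwa [div_mul_eq_mul_div, div_le_iff₀ (by positivity)] at h1

theorem mul_add_le_sq_add {e β : ℝ} (he : 0 ≤ e) (hβ : 0 < β) :
    β * (e + β) ≤ (e + β) ^ 2 + e := by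
  nlinarith [mul_nonneg he hβ.le, sq_nonneg e]

/-- The residual estimate with `‖m - m†‖ ≤ 2 A (e + β)` inserted; everything is quadratic in `e + β`
or linear in the noise `e`. -/
theorem residual_le {L A m e β : ℝ} (hL : 0 < L) (hA : 0 < A) (hm : 0 < m) (he : 0 ≤ e)
    (hβ : 0 < β) :
    L * (2 * (A * (e + β))) ^ 2 + 5 * m * L ^ 3 * (2 * (A * (e + β)) + e) * (2 * (A * (e + β))) +
        (m * L ^ 2 + 1) * e ≤
      (4 * L * A ^ 2 + 10 * m * L ^ 3 * (2 * A + 1) * A + (m * L ^ 2 + 1)) *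
        ((e + β) ^ 2 + e) := by
  have h1 : 0 ≤ 10 * m * L ^ 3 * A * (e + β) * β := by positivity
  have h2 : 0 ≤ 4 * L * A ^ 2 * e := by positivity
  have h3 : 0 ≤ 10 * m * L ^ 3 * (2 * A + 1) * A * e := by positivity
  have h4 : 0 ≤ (m * L ^ 2 + 1) * (e + β) ^ 2 := by positivity
  linear_combination h1 + h2 + h3 + h4

end SparseInverse

/-! ### Choice of the constants and conclusion -/

set_option maxHeartbeats 1000000 in
theorem theorem5p4 {dₒ d : ℕ} (hdo : 1 ≤ dₒ) (hd : 1 ≤ d)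
    (Ωo : Set (SparseInverse.Pt dₒ)) (hΩo : IsCompact Ωo)
    (Ωs : Set (SparseInverse.Pt d)) (hΩs : IsCompact Ωs) (hint : (interior Ωs).Nonempty)
    (k : SparseInverse.Pt dₒ → SparseInverse.Pt d → ℝ)
    (hk : SparseInverse.KernelRegular Ωo Ωs k)
    -- the ground truth, with parameters `m† = (q†; y†)`
    {N : ℕ} (q : Fin N → ℝ) (y : Fin N → Ωs) (hq : ∀ n, q n ≠ 0)
    (hy : ∀ n, (y n : SparseInverse.Pt d) ∈ interior Ωs)
    -- a bound for the norm of the inverse Fisher information matrix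
    (M : ℝ) :
    ∃ C₁ C₂ r : ℝ, 0 < C₁ ∧ 0 < C₂ ∧ 0 < r ∧
      -- the ball of radius `(3/2) r` around `m†` lies in the parameter domain
      (∀ (q₁ : Fin N → ℝ) (y₁ : Fin N → SparseInverse.Pt d),
        SparseInverse.wNorm (SparseInverse.weight d q)
          (SparseInverse.stack q₁ y₁ - SparseInverse.stack q (fun n => (y n).1)) ≤ 3 / 2 * r →
        ∀ n, y₁ n ∈ interior Ωs) ∧
      -- all measurement setups
      ∀ (No : ℕ) (x : Fin No → SparseInverse.Pt dₒ) (s : Fin No → ℝ),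
        (∀ j, x j ∈ Ωo) → (∀ j, 0 < s j) → ∑ j, (s j)⁻¹ = 1 →
        LinearIndependent ℝ (SparseInverse.jac k x q (fun n => (y n).1)).col →
        SparseInverse.wOpNorm (SparseInverse.weight d q)⁻¹ (SparseInverse.weight d q)
          (SparseInverse.fisher k x s q (fun n => (y n).1))⁻¹ ≤ M →
      -- the minimal-norm dual certificate is `θ`-admissible
      ∀ (θ : ℝ) (ζ : Fin No → ℝ), 0 < θ → θ ≤ 1 →
        SparseInverse.IsMinNormDualSolution k x s (SparseInverse.sparse q y) ζ →
        SparseInverse.IsAdmissible Ωs θ q (fun n => (y n).1)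
          (SparseInverse.certificate k x s ζ) →
      -- noise and regularization parameter
      ∀ (ε : Fin No → ℝ) (β : ℝ), 0 < β →
        C₁ * (SparseInverse.wNorm s⁻¹ ε + β) ≤ √(θ / 32) →
        C₂ * β⁻¹ * ((SparseInverse.wNorm s⁻¹ ε + β) ^ 2 + SparseInverse.wNorm s⁻¹ ε)
          ≤ θ ^ 2 / 32 →
      ∃ (qh : Fin N → ℝ) (yh : Fin N → Ωs),
        -- `m̂ = (qh; yh)` is the unique stationary point near `m†`
        SparseInverse.wNorm (SparseInverse.weight d q)
          (SparseInverse.stack qh (fun n => (yh n).1)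
            - SparseInverse.stack q (fun n => (y n).1)) ≤ r ∧
        SparseInverse.IsStationary k x s β
          (SparseInverse.obs k x q (fun n => (y n).1) + ε) qh (fun n => (yh n).1) ∧
        (∀ (q₁ : Fin N → ℝ) (y₁ : Fin N → Ωs),
          SparseInverse.wNorm (SparseInverse.weight d q)
            (SparseInverse.stack q₁ (fun n => (y₁ n).1)
              - SparseInverse.stack q (fun n => (y n).1)) ≤ 3 / 2 * r →
          SparseInverse.IsStationary k x s β
            (SparseInverse.obs k x q (fun n => (y n).1) + ε) q₁ (fun n => (y₁ n).1) →
          q₁ = qh ∧ y₁ = yh) ∧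
        -- the Tikhonov problem has exactly one solution, the measure parametrized by `m̂`
        (∀ μ : SignedMeasure Ωs,
          IsMinOn (SparseInverse.tikhonov k x s β
            (SparseInverse.forwardOp k x (SparseInverse.sparse q y) + ε)) Set.univ μ ↔
          μ = SparseInverse.sparse qh yh) ∧
        -- `δm̂` is the unique solution of the linearized problem
        (∀ δ : SparseInverse.Idx N d → ℝ,
          IsMinOn (SparseInverse.linObjective k x s β ε q (fun n => (y n).1)) Set.univ δ ↔
          δ = SparseInverse.linEstimate k x s β ε q (fun n => (y n).1)) ∧
        -- the error estimate
        SparseInverse.dHK (SparseInverse.sparse qh yh) (SparseInverse.sparse q y) ^ 2 ≤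
          ENNReal.ofReal (8 * SparseInverse.wNorm (SparseInverse.weight d q)
            (SparseInverse.linEstimate k x s β ε q (fun n => (y n).1)) ^ 2) := by
  classical
  obtain ⟨Λ, hΛ1, hkΛ, hkb⟩ := hk.exists_bound hΩo hΩs
  have hΛ : 0 < Λ := one_pos.trans_le hΛ1
  obtain ⟨R₀, r₀, L, H⟩ := SparseInverse.exists_localConstants hΛ.le isOpen_interior hq hy
  have hL1 := H.one_le
  have hL : 0 < L := one_pos.trans_le hL1
  obtain ⟨qm, hqm0, hqm⟩ : ∃ qm : ℝ, 0 < qm ∧ ∀ n, qm ≤ |q n| := by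
    have h : ∀ᶠ t in nhdsWithin (0 : ℝ) (Set.Ioi 0), ∀ n, t ≤ |q n| :=
      Filter.eventually_all.2 fun n => by
        filter_upwards [Ioo_mem_nhdsGT (abs_pos.2 (hq n))] with t ht using ht.2.le
    obtain ⟨t, ht⟩ := ((eventually_mem_nhdsWithin (α := ℝ)).and h).exists
    exact ⟨t, ht.1, ht.2⟩
  set ρ : SparseInverse.Idx N d → ℝ := Sum.elim (fun n => Real.sign (q n)) 0 with hρ
  obtain ⟨m, hm⟩ : ∃ m, m = max M 1 := ⟨_, rfl⟩
  have hm1 : 1 ≤ m := hm ▸ le_max_right _ _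
  have hm0 : 0 < m := one_pos.trans_le hm1
  obtain ⟨P, hP⟩ : ∃ P, P = SparseInverse.wNorm (SparseInverse.weight d q)⁻¹ ρ := ⟨_, rfl⟩
  have hP0 : 0 ≤ P := hP ▸ SparseInverse.wNorm_nonneg _ _
  -- `K` is the contraction constant, `A (e + β)` bounds the linear estimate, `B` bounds the
  -- residual, and `Z` bounds the minimal-norm dual variable through its closed form.
  obtain ⟨K, hK⟩ : ∃ K, K = 5 * m * L ^ 2 := ⟨_, rfl⟩
  have hK0 : 0 < K := by rw [hK]; positivity
  obtain ⟨A, hA⟩ : ∃ A, A = m * (L + P) := ⟨_, rfl⟩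
  have hA0 : 0 < A := by rw [hA]; positivity
  obtain ⟨B, hB⟩ : ∃ B, B = 4 * L * A ^ 2 + 10 * m * L ^ 3 * (2 * A + 1) * A + (m * L ^ 2 + 1) :=
    ⟨_, rfl⟩
  have hB0 : 0 < B := by rw [hB]; positivity
  obtain ⟨Z, hZ⟩ : ∃ Z, Z = L * (m * P) := ⟨_, rfl⟩
  have hZ0 : 0 ≤ Z := by rw [hZ]; positivity
  -- The radius uses half of the contraction budget `1 / 2`; the noise gets the other half.
  obtain ⟨r, hr, hr₀, hrK⟩ : ∃ r : ℝ, 0 < r ∧ 3 / 2 * r ≤ r₀ ∧ K * (3 / 2 * r) ≤ 1 / 4 := by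
    have hr₀ := H.r₀_pos
    refine ⟨min (r₀ / 2) (1 / (6 * K)), lt_min (by positivity) (by positivity), ?_, ?_⟩
    · linarith [min_le_left (r₀ / 2) (1 / (6 * K))]
    · have h := min_le_right (r₀ / 2) (1 / (6 * K))
      rw [le_div_iff₀ (by positivity)] at h
      linarith
  obtain ⟨R₁, hR₁, hR₁R, hR₁q, hR₁Z⟩ : ∃ R₁ : ℝ, 0 < R₁ ∧ R₁ ≤ R₀ ∧ qm * R₁ ^ 2 ≤ 1 ∧
      (Z + 1) * Λ * R₁ ≤ 1 := by
    have hR₀ := H.R₀_pos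
    have h1 : 0 < min R₀ (min (1 / (qm + 1)) (1 / ((Z + 1) * Λ))) :=
      lt_min hR₀ (lt_min (by positivity) (by positivity))
    refine ⟨_, h1, min_le_left _ _, ?_, ?_⟩
    · have h2 : min R₀ (min (1 / (qm + 1)) (1 / ((Z + 1) * Λ))) ≤ 1 / (qm + 1) :=
        (min_le_right _ _).trans (min_le_left _ _)
      generalize min R₀ (min (1 / (qm + 1)) (1 / ((Z + 1) * Λ))) = t at *
      rw [le_div_iff₀ (by positivity)] at h2
      have h3 : t ≤ 1 := by nlinarith
      nlinarith
    · have h2 : min R₀ (min (1 / (qm + 1)) (1 / ((Z + 1) * Λ))) ≤ 1 / ((Z + 1) * Λ) :=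
        (min_le_right _ _).trans (min_le_right _ _)
      rw [le_div_iff₀ (by positivity)] at h2
      linarith
  refine ⟨4 * K + 2 * A / r, 1 + B + 2 * Λ * (2 * Z * L * A + B) / qm + 4 * L * A / R₁ +
    8 * Λ * B / (qm * R₁ ^ 2), r, by positivity, by positivity, hr, fun q₁ y₁ h n => ?_, ?_⟩
  · exact H.ball_subset n (mem_closedBall_iff_norm.2
      ((H.locs_near _ (h.trans hr₀) n).trans (by linarith [H.R₀_pos])))
  intro No x s hx hs hs1 hinj hM θ ζ hθ hθ1 hmin hadm ε β hβ hC₁ hC₂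
  have hkx : ∀ j, SparseInverse.BoundedC3 Λ (interior Ωs) (k (x j)) := fun j => hkΛ _ (hx j)
  have hkbx : ∀ j, ∀ z ∈ Ωs, |k (x j) z| ≤ Λ := fun j => hkb _ (hx j)
  have hkc : ∀ j, ContinuousOn (k (x j)) Ωs := fun j =>
    hk.continuousOn.comp (f := fun z => (x j, z)) (by fun_prop) fun z hz => ⟨hx j, hz⟩
  have Mdl := H.leastSquaresModel hq hkx hs hs1 hinj hM
  rw [← hm] at Mdl
  obtain ⟨e, he⟩ : ∃ e, e = SparseInverse.wNorm s⁻¹ ε := ⟨_, rfl⟩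
  have he0 : 0 ≤ e := he ▸ SparseInverse.wNorm_nonneg _ _
  rw [← he] at hC₁ hC₂
  obtain ⟨Q, hQ⟩ : ∃ Q, Q = β⁻¹ * ((e + β) ^ 2 + e) := ⟨_, rfl⟩
  have hβQ : β * Q = (e + β) ^ 2 + e := by rw [hQ, mul_inv_cancel_left₀ hβ.ne']
  -- Thus `Q` controls the shift of the locations as well as the perturbation of the certificate.
  have hhQ : e + β ≤ Q := by
    refine le_of_mul_le_mul_left ?_ hβ
    rw [hβQ]
    exact SparseInverse.mul_add_le_sq_add he0 hβ
  have hQ0 : 0 < Q := by linarith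
  obtain ⟨hKh, hAh⟩ := SparseInverse.radius_smallness hK0 hA0 hr he0 hβ
    (hC₁.trans (Real.sqrt_le_one.2 (by linarith)))
  obtain ⟨u1, u2, u3, u4⟩ := SparseInverse.certificate_smallness hL hA0 hB0 hΛ hqm0 hR₁ hZ0 hθ hθ1
    hQ0 ((by rw [hQ, ← mul_assoc]; exact hC₂ : _ * Q ≤ θ ^ 2 / 32))
  have hsq : √θ ^ 2 = θ := Real.sq_sqrt hθ.le
  have hsqrt1 : √θ ≤ 1 := Real.sqrt_le_one.2 hθ1
  have hsqrt0 : 0 < √θ := Real.sqrt_pos.2 hθ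
  have hbnorm : SparseInverse.wNorm (SparseInverse.weight d q)⁻¹ (β • ρ) = β * P := by
    rw [SparseInverse.wNorm_smul, abs_of_pos hβ, hP]
  have hlin := Mdl.wNorm_lsLinear_le ε (β • ρ)
  rw [hbnorm, ← he] at hlin
  have hζ : SparseInverse.wNorm s⁻¹ ζ ≤ Z := by
    have h1 := hmin.eq_precertificate hkx hkbx hΛ.le hs hs1 hq (R := R₀) H.R₀_pos
      (fun n => (Metric.closedBall_subset_closedBall (by linarith [H.R₀_pos])).trans
        (H.ball_subset n)) hinj hθ hadm
    rw [h1, hZ, hP]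
    exact (Mdl.deriv_le _).trans (mul_le_mul_of_nonneg_left (Mdl.inv_le _) hL.le)
  have hne : Ωs.Nonempty := hint.mono interior_subset
  -- The peak radius scales as `√θ` so that `qm * R² ≤ θ`. The gap `θ * (qm * R² / 4)` away from the
  -- sources is then of order `θ²`, which is the origin of `θ²` in the second smallness condition.
  refine SparseInverse.exists_recovery hΩs hkx hkbx hkc hΛ.le hs hs1 hne hq H hinj hM hθ hmin
    hadm hβ hr hr₀ (D := A * (e + β)) (qm := qm) (R := R₁ * √θ) (Z := Z) (τ := B * Q)
    (δ := 2 * L * A * Q) ?_ (hlin.trans ?_) hAh hqm hqm0 (by positivity) ?_ ?_ hζ ?_ ?_ ?_ ?_ ?_ ?_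
  · rw [← hm, ← he, ← hK, mul_add]
    linarith
  · rw [hA, mul_assoc]
    refine mul_le_mul_of_nonneg_left ?_ hm0.le
    linarith [mul_nonneg hL.le hβ.le, mul_nonneg hP0 he0,
      (by ring : (L + P) * (e + β) = L * e + L * β + P * e + β * P)]
  · exact (mul_le_of_le_one_right hR₁.le hsqrt1).trans hR₁R
  · rw [mul_pow, hsq, ← mul_assoc]
    exact mul_le_of_le_one_left hθ.le hR₁q
  · rw [← hm, ← he, mul_left_comm β, hβQ, hB]
    exact SparseInverse.residual_le hL hA0 hm0 he0 hβ
  · calc L * (2 * (A * (e + β))) = 2 * L * A * (e + β) := by ring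
      _ ≤ 2 * L * A * Q := by gcongr
  · have h1 : 0 < θ * qm := by positivity
    calc Z * Λ * (2 * L * A * Q) + B * Q * Λ = Λ * (2 * Z * L * A + B) * Q := by ring
      _ < θ * qm := by linarith
  · calc (Z + B * Q) * Λ * (R₁ * √θ) ≤ (Z + 1) * Λ * (R₁ * 1) := by gcongr
      _ ≤ 1 := by linarith
  · linarith
  · have h1 : 0 < θ ^ 2 * (qm * R₁ ^ 2) := by positivity
    calc B * Q * Λ = 8 * Λ * B * Q / 8 := by ring
      _ ≤ θ ^ 2 * (qm * R₁ ^ 2) / 8 := by gcongr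
      _ < θ ^ 2 * (qm * R₁ ^ 2) / 4 := by linarith
      _ = _ := by rw [mul_pow, hsq]; ring
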